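/- **Setting.** Time is slotted, $t=0,1,2,\dots$. A network has $r$ queues and $M$ states. The states $S(t)\in\{s_1,\dots,s_M\}$ are independent over time, $S(t)$ having distribution $\pi(t)$. When $S(t)=s_i$, an action $x(t)$ is chosen, without knowledge of the future states, from a non-empty compact set $\mathcal X_i$; it has cost $f(s_i,x)$ and brings traffic $A_j(s_i,x)\ge 0$ and service $\mu_j(s_i,x)\ge 0$ to queue $j$, and $|f|,A_j,\mu_j\le\delta_{\max}$. The backlogs satisfy $q(0)=0$ and $q_j(t+1)=\max[q_j(t)-\mu_j(t)+A_j(t),0]$. For a fixed distribution $\pi$, $f^{\pi}_{\rm av}$ is the infimum of $\limsup_T\frac1T\sum_{t<T}\mathbb E f(t)$ over all feasible causal (possibly randomized) policies with $\limsup_T\frac1T\sum_{t<T}\sum_j\mathbb E q_j(t)<\infty$. For $V\ge1$ let $$g(\gamma,\pi)=\inf_{x_i\in\mathcal X_i}\sum_i\pi_i\Big\{Vf(s_i,x_i)+\sum_j\gamma_j[A_j(s_i,x_i)-\mu_j(s_i,x_i)]\Big\}.$$ Distances of distributions are $\|\pi-\pi'\|_{tv}=\sum_i|\pi_i-\pi'_i|$.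 **Assumptions on a distribution $\pi$** (with constants $\eta_0,\rho>0$). (1) For some $\epsilon>0$, for every distribution $\pi'$ with $\|\pi'-\pi\|_{tv}\le\epsilon$ there is a randomization over countably many feasible actions in each state under which $\mathbb E_{\pi'}[A_j-\mu_j]\le-\eta_0$ for all $j$. (2) $g(\cdot,\pi)$ has a unique maximizer $\gamma^*\ne0$ over $\gamma\succeq0$. (3) The system is polyhedral: $g(\gamma^*,\pi)\ge g(\gamma,\pi)+\rho\|\gamma^*-\gamma\|$ for all $\gamma\succeq0$. **Algorithm PLC.** At time $t$ predictions $\hat\pi(t),\dots,\hat\pi(t+w)$ with $\|\hat\pi(t+k)-\pi(t+k)\|_{tv}\le e(k)$ are available; $e_w=\frac1{w+1}\sum_{k=0}^w e(k)$. The parameters are $d=\lceil\log(V)^3/\epsilon_d^2\rceil\ge w+1$ with $\epsilon_d>0$, $T_l=\max(V^c,e_w^{-2})$ with $c\in(0,1)$ ($T_l=\infty$ if $e_w=0$), and $\theta=2\log(V)^2(1+V/\sqrt{T_l})$. PLC keeps a detection window (the most recent observed states and the predictions, about $d$ slots) and a learning window (at most $T_l$ earlier observed states); it restarts both windows if the learning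 window has at least $d$ elements and their empirical distributions differ by more than $\epsilon_d$, or if the learning window has $T_l$ elements and some prediction $\hat\pi(t+k)$ differs from its empirical distribution by more than $e(k)+2M\log(T_l)/\sqrt{T_l}$. Its estimate $\pi_a(t)$ is the empirical distribution of the learning window if that window has $T_l$ elements, and $\frac1{w+1}\sum_{k=0}^w\hat\pi(t+k)$ otherwise. It takes a maximizer $\gamma^*(t)$ of $g(\cdot,\pi_a(t))$ over $\gamma\succeq0$ ($\gamma^*(t)=V\log(V)\mathbf 1$ if there is none), sets $Q_j(t)=q_j(t)+(\gamma^*_j(t)-\theta)^+$, and chooses $x(t)\in\mathcal X_i$, when $S(t)=s_i$, maximizing $-Vf(s_i,x)+\sum_jQ_j(t)[\mu_j(s_i,x)-A_j(s_i,x)]$. If the learning window had $T_l$ elements at time $t-1$ and $\pi_a(t)\neq\pi_a(t-1)$, all queues are emptied at time $t+w+1$. Queues are served last-in-first-out, the traffic of the current slot being on top of the stack. **Theorem.** Let $e_w=0$ (perfect prediction) and $q(0)=0$. Fix the network and $\rho,\eta_0>0$. (a) (Stationary system.) There are constants $C,V_0$, depending only on the network, $\rho$ and $\eta_0$, such that for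 all $V\ge V_0$ and every $\pi$ satisfying (1)–(3), if $\pi(t)=\pi$ for all $t$, then PLC achieves the $[O(\epsilon),O(\log(1/\epsilon)^2)]$ utility–delay tradeoff with $\epsilon=1/V$: * Utility: $|f^{\rm PLC}_{\rm av}-f^{\pi}_{\rm av}|\le C/V$. * Delay: for every set $J$ of queues and every $\lambda>0$ such that the expected traffic arriving at $J$ in the first $T$ slots is at least $\lambda T$ for all large $T$, all but at most a $\frac{C}{\lambda V}$ fraction of the traffic arriving at $J$ has average delay at most $\frac C\lambda\log(V)^2$. Precisely, there is $K$ such that for all large $T$, of the expected traffic arriving at $J$ in the first $T$ slots, at most the fraction $\frac C{\lambda V}$ is not served with delay at most $K$, and the average delay of the part that is served with delay at most $K$ is at most $\frac C\lambda\log(V)^2$. * Backlog: $\frac1T\sum_{t<T}\sum_j\mathbb E q_j(t)\le C\log(V)^2$ for all large $T$. (b) (Piecewise stationary system.) Let $\epsilon_d,\epsilon>0$. There are constants $C,V_0$, depending only on the network, $\rho$, $\eta_0$, $\epsilon_d$ and $\epsilon$, such that the following holds for all $V\ge V_0$. Let $0=t_0<t_1<\cdots$, $d_k=t_{k+1}-t_k$,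 and $\pi(t)=\pi_k$ for $t_k\le t<t_{k+1}$, where $d_k\ge d\log(V)^2$ and every $\pi_k$ satisfies (1)–(3). Then under PLC, for every $k$ with $d_k\ge V^{1+\epsilon}$, $$\Big|\frac1{d_k}\sum_{t=t_k}^{t_{k+1}-1}\mathbb E f(t)-f^{\pi_k}_{\rm av}\Big|\le\frac CV,$$ and for every $k$, $\ \sum_j\mathbb E\,q_j(t_k)\le C\log(V)^4$. -/

import Mathlib

open MeasureTheory ProbabilityTheory Filter Finset

/-- A slotted-time network with `M` states, `r` queues and actions in `X`: compact feasible action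
sets, bounded cost functions, and bounded nonnegative traffic and service functions. Costs may have
either sign, which covers both cost minimization and reward maximization. -/
structure Network (M r : ℕ) (X : Type*) [TopologicalSpace X] where
  /-- feasible actions in each state -/
  feasible : Fin M → Set X
  nonempty_feasible : ∀ i, (feasible i).Nonempty
  isCompact_feasible : ∀ i, IsCompact (feasible i)
  /-- cost `f(s_i, x)` -/
  cost : Fin M → X → ℝ
  /-- traffic `A_j(s_i, x)` -/
  traffic : Fin M → X → Fin r → ℝ
  /-- service `μ_j(s_i, x)` -/
  service : Fin M → X → Fin r → ℝ
  /-- uniform bound -/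
  deltaMax : ℝ
  deltaMax_pos : 0 < deltaMax
  abs_cost_le : ∀ i, ∀ x ∈ feasible i, |cost i x| ≤ deltaMax
  traffic_nonneg : ∀ i, ∀ x ∈ feasible i, ∀ j, 0 ≤ traffic i x j
  traffic_le : ∀ i, ∀ x ∈ feasible i, ∀ j, traffic i x j ≤ deltaMax
  service_nonneg : ∀ i, ∀ x ∈ feasible i, ∀ j, 0 ≤ service i x j
  service_le : ∀ i, ∀ x ∈ feasible i, ∀ j, service i x j ≤ deltaMax

/-- Total variation distance in the normalization `∑ |p_i - p'_i|`. -/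
def tvDist {M : ℕ} (p p' : Fin M → ℝ) : ℝ := ∑ i, |p i - p' i|

noncomputable section

namespace Network

variable {M r : ℕ} {X : Type*} [TopologicalSpace X] (net : Network M r X)

/-- The dual function `g(γ, p)` of the deterministic problem with parameter `V`. -/
def dual (V : ℝ) (γ : Fin r → ℝ) (p : Fin M → ℝ) : ℝ :=
  ⨅ x : (∀ i, net.feasible i), ∑ i, p i * (V * net.cost i (x i) +
    ∑ j, γ j * (net.traffic i (x i) j - net.service i (x i) j))

/-- `γ` solves the dual problem: maximize `g(·, p)` over the nonnegative orthant. -/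
def IsDualOptimal (V : ℝ) (p : Fin M → ℝ) (γ : Fin r → ℝ) : Prop :=
  0 ≤ γ ∧ ∀ γ', 0 ≤ γ' → net.dual V γ' p ≤ net.dual V γ p

/-- The dual problem has a unique solution, and it is nonzero. -/
def HasUniqueMultiplier (V : ℝ) (p : Fin M → ℝ) : Prop :=
  ∃ γ, γ ≠ 0 ∧ net.IsDualOptimal V p γ ∧ ∀ γ', net.IsDualOptimal V p γ' → γ' = γ

/-- Polyhedral with parameter `ρ` under `p`:
`g(γ*, p) ≥ g(γ, p) + ρ ‖γ* - γ‖` (Euclidean norm) for all multipliers `γ ⪰ 0`. -/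
def IsPolyhedral (V : ℝ) (p : Fin M → ℝ) (ρ : ℝ) : Prop :=
  ∃ γs, net.IsDualOptimal V p γs ∧
    ∀ γ, 0 ≤ γ → net.dual V γ p + ρ * ‖WithLp.toLp 2 (γs - γ)‖ ≤ net.dual V γs p

/-- Slackness with slack `η` for every distribution within `ε` of `p`: some randomization over
countably many feasible actions in each state gives every queue a mean net input at most `-η`. -/
def HasSlack (p : Fin M → ℝ) (ε η : ℝ) : Prop :=
  ∀ p' ∈ stdSimplex ℝ (Fin M), tvDist p' p ≤ ε →
    ∃ (x : Fin M → ℕ → X) (a : Fin M → ℕ → ℝ),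
      (∀ i z, x i z ∈ net.feasible i) ∧ (∀ i z, 0 ≤ a i z) ∧ (∀ i, HasSum (a i) 1) ∧
      ∀ j, ∑ i, p' i * ∑' z, a i z * (net.traffic i (x i z) j - net.service i (x i z) j) ≤ -η

/-- A feasible, causal control process. `S t` is the network state, with law `dist t`; `x t` is the
action; `ℱ t` is the information before slot `t`, so `S t` is independent of `ℱ t`, while the state
and the outcome of slot `t` are known at `t + 1`. The action may use the past, the current state and
additional randomization. -/
structure IsAdmissible (dist : ℕ → Fin M → ℝ) {Ω : Type*} [mΩ : MeasurableSpace Ω]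
    (P : Measure Ω) (ℱ : Filtration ℕ mΩ) (S : ℕ → Ω → Fin M) (x : ℕ → Ω → X) : Prop where
  isProbability : IsProbabilityMeasure P
  measurable_state : ∀ t, Measurable[ℱ (t + 1)] (S t)
  measurable_cost : ∀ t, Measurable[ℱ (t + 1)] fun ω => net.cost (S t ω) (x t ω)
  measurable_traffic : ∀ t j, Measurable[ℱ (t + 1)] fun ω => net.traffic (S t ω) (x t ω) j
  measurable_service : ∀ t j, Measurable[ℱ (t + 1)] fun ω => net.service (S t ω) (x t ω) j
  indep : ∀ t, Indep (MeasurableSpace.comap (S t) ⊤) (ℱ t) P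
  law : ∀ t i, P.real (S t ⁻¹' {i}) = dist t i
  mem_feasible : ∀ t ω, x t ω ∈ net.feasible (S t ω)

/-- Backlog process from the empty system: `q_j(t+1) = max (q_j(t) - μ_j(t) + A_j(t)) 0`. -/
def backlog (s : ℕ → Fin M) (x : ℕ → X) : ℕ → Fin r → ℝ
  | 0 => 0
  | t + 1 => fun j => max (backlog s x t j - net.service (s t) (x t) j + net.traffic (s t) (x t) j) 0

/-- Expected cost in slot `t`. -/
def meanCost {Ω : Type*} [MeasurableSpace Ω] (P : Measure Ω)
    (S : ℕ → Ω → Fin M) (x : ℕ → Ω → X) (t : ℕ) : ℝ :=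
  ∫ ω, net.cost (S t ω) (x t ω) ∂P

/-- Time average cost `limsup_T (1/T) ∑_{t<T} E f(t)`. -/
def avgCost {Ω : Type*} [MeasurableSpace Ω] (P : Measure Ω)
    (S : ℕ → Ω → Fin M) (x : ℕ → Ω → X) : ℝ :=
  limsup (fun T : ℕ => (∑ t ∈ range T, net.meanCost P S x t) / T) atTop

/-- Optimal value of the stochastic problem under the fixed state distribution `p`: the infimum of
the time average cost over all feasible causal policies for which
`limsup_T (1/T) ∑_{t<T} ∑_j E q_j(t) < ∞`. -/
def optimalCost (p : Fin M → ℝ) : ℝ :=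
  sInf {c | ∃ (Ω : Type) (mΩ : MeasurableSpace Ω) (P : Measure Ω) (ℱ : Filtration ℕ mΩ)
    (S : ℕ → Ω → Fin M) (x : ℕ → Ω → X),
    net.IsAdmissible (fun _ => p) P ℱ S x ∧
    IsBoundedUnder (· ≤ ·) atTop (fun T : ℕ => (∑ t ∈ range T, ∑ j,
      ∫ ω, net.backlog (fun t => S t ω) (fun t => x t ω) t j ∂P) / T) ∧
    c = net.avgCost P S x}

end Network

/-! ### The algorithm -/

/-- Parameters of the predictive learning-aided control algorithm. -/
structure PLCParams where
  V : ℝ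
  /-- the prediction window has size `w + 1` -/
  w : ℕ
  /-- prediction error curve -/
  e : ℕ → ℝ
  /-- size of the detection window -/
  d : ℕ
  /-- detection threshold -/
  epsd : ℝ
  /-- learning length, possibly infinite -/
  Tl : ℕ∞
  /-- offset of the multiplier -/
  theta : ℝ

/-- Average prediction error `e_w`. -/
def avgError (w : ℕ) (e : ℕ → ℝ) : ℝ := (∑ k ∈ range (w + 1), e k) / (w + 1)

open Classical in
/-- `T_l = max (V^c) (e_w⁻²)` (rounded up), which is infinite when `e_w = 0`. -/
def learningLength (V c ew : ℝ) : ℕ∞ :=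
  if ew = 0 then ⊤ else ((⌈max (V ^ c) (ew ^ 2)⁻¹⌉₊ : ℕ) : ℕ∞)

open Classical in
/-- `θ = 2 log(V)² (1 + V / √T_l)`. -/
def offset (V : ℝ) (Tl : ℕ∞) : ℝ :=
  2 * Real.log V ^ 2 * (1 + if Tl = ⊤ then 0 else V / √(Tl.toNat : ℝ))

/-- The parameter choice `d = log(V)³ / ε_d²` (rounded up), `T_l = max (V^c) (e_w⁻²)`,
`θ = 2 log(V)² (1 + V / √T_l)`. -/
def plcParams (V c epsd : ℝ) (w : ℕ) (e : ℕ → ℝ) : PLCParams where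
  V := V
  w := w
  e := e
  d := ⌈Real.log V ^ 3 / epsd ^ 2⌉₊
  epsd := epsd
  Tl := learningLength V c (avgError w e)
  theta := offset V (learningLength V c (avgError w e))

/-- The window pointers `b_d^s`, `b_d^e`, `b_m`. -/
structure Windows where
  ds : ℕ
  de : ℕ
  m : ℕ

section Estimator

variable {M : ℕ} (par : PLCParams) (s : ℕ → Fin M) (pred : ℕ → ℕ → Fin M → ℝ)

/-- The learning window: at most the first `T_l` slots of `{b_m, …, b_d^s - 1}`. -/
def learningWindow (b : Windows) : Finset ℕ :=
  {τ ∈ Ico b.m b.ds | ((τ - b.m : ℕ) : ℕ∞) < par.Tl}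

/-- Empirical distribution of the learning window. -/
def empLearning (b : Windows) : Fin M → ℝ := fun i =>
  (∑ τ ∈ learningWindow par b, if s τ = i then (1 : ℝ) else 0) / #(learningWindow par b)

/-- Distribution of the detection window at time `t`: recent samples and the predictions
`pred t k` made at time `t` for time `t + k`. -/
def empDetection (t : ℕ) : Fin M → ℝ := fun i =>
  (∑ τ ∈ Ico (t + par.w - par.d) t, (if s τ = i then (1 : ℝ) else 0) +
    ∑ k ∈ range (par.w + 1), pred t k i) / par.d

/-- At time `t`, with pointers `b`, the estimator declares a change. -/
def DeclaresChange (t : ℕ) (b : Windows) : Prop :=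
  (par.d ≤ #(learningWindow par b) ∧
    par.epsd < tvDist (empDetection par s pred t) (empLearning par s b)) ∨
  ((#(learningWindow par b) : ℕ∞) = par.Tl ∧ ∃ k ≤ par.w,
    par.e k + 2 * M * Real.log par.Tl.toNat / √(par.Tl.toNat : ℝ) <
      tvDist (pred t k) (empLearning par s b))

open Classical in
/-- Evolution of the window pointers of the average distribution estimator. -/
def adeWindows : ℕ → Windows
  | 0 => ⟨0, par.w, 0⟩
  | t + 1 =>
    if DeclaresChange par s pred (t + 1) (adeWindows t) then
      ⟨t + 1 + par.w + 1, t + 1 + par.w + 1, t + 1 + par.w + 1⟩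
    else if t + 1 ≤ (adeWindows t).ds then adeWindows t
    else ⟨t + 1 + par.w - par.d, t + 1 + par.w, (adeWindows t).m⟩

open Classical in
/-- The output `π_a(t)` of the estimator. -/
def adeEstimate (t : ℕ) : Fin M → ℝ :=
  if par.Tl ≤ (#(learningWindow par (adeWindows par s pred t)) : ℕ∞) then
    empLearning par s (adeWindows par s pred t)
  else fun i => (∑ k ∈ range (par.w + 1), pred t k i) / (par.w + 1)

/-- The algorithm empties all queues at time `n`. -/
def DropsAt (n : ℕ) : Prop :=
  ∃ t, n = t + 1 + par.w + 1 ∧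
    (#(learningWindow par (adeWindows par s pred t)) : ℕ∞) = par.Tl ∧
    adeEstimate par s pred (t + 1) ≠ adeEstimate par s pred t

end Estimator

namespace Network

variable {M r : ℕ} {X : Type*} [TopologicalSpace X] (net : Network M r X)

/-- The empirical multiplier: a solution of the dual problem for the estimate `p`, or
`V log V · 1` if there is none. -/
def IsEmpiricalMultiplier (V : ℝ) (p : Fin M → ℝ) (γ : Fin r → ℝ) : Prop :=
  net.IsDualOptimal V p γ ∨
    ((∀ γ', ¬ net.IsDualOptimal V p γ') ∧ γ = fun _ => V * Real.log V)

open Classical in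
/-- A sample path of the algorithm: states `s`, predictions `pred`, actions `x`, empirical
multipliers `γ`, backlogs `q`. Ties in the two optimization steps are broken arbitrarily. -/
structure IsPLCPath (par : PLCParams) (s : ℕ → Fin M) (pred : ℕ → ℕ → Fin M → ℝ)
    (x : ℕ → X) (γ q : ℕ → Fin r → ℝ) : Prop where
  learning : ∀ t, net.IsEmpiricalMultiplier par.V (adeEstimate par s pred t) (γ t)
  mem_feasible : ∀ t, x t ∈ net.feasible (s t)
  control : ∀ t, IsMaxOn (fun y => -par.V * net.cost (s t) y +
    ∑ j, (q t j + max (γ t j - par.theta) 0) * (net.service (s t) y j - net.traffic (s t) y j))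
    (net.feasible (s t)) (x t)
  init : q 0 = 0
  step : ∀ t, q (t + 1) = if DropsAt par s pred (t + 1) then 0 else
    fun j => max (q t j - net.service (s t) (x t) j + net.traffic (s t) (x t) j) 0

/-- The network run by the algorithm, with states of law `dist t` and predictions whose error
`k` slots ahead is at most `e k`. -/
structure IsPLC (par : PLCParams) (dist : ℕ → Fin M → ℝ) {Ω : Type*} [mΩ : MeasurableSpace Ω]
    (P : Measure Ω) (ℱ : Filtration ℕ mΩ) (S : ℕ → Ω → Fin M) (pred : Ω → ℕ → ℕ → Fin M → ℝ)
    (x : ℕ → Ω → X) (γ q : ℕ → Ω → Fin r → ℝ) : Prop where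
  admissible : net.IsAdmissible dist P ℱ S x
  pred_mem : ∀ ω t, ∀ k ≤ par.w, pred ω t k ∈ stdSimplex ℝ (Fin M)
  pred_error : ∀ ω t, ∀ k ≤ par.w, tvDist (pred ω t k) (dist (t + k)) ≤ par.e k
  path : ∀ ω, net.IsPLCPath par (fun t => S t ω) (pred ω) (fun t => x t ω)
    (fun t => γ t ω) (fun t => q t ω)

end Network

/-! ### Last-in-first-out delay -/

section Lifo

variable (a m : ℕ → ℝ) (drop : ℕ → Prop)

open Classical in
/-- Last-in-first-out queue with arrivals `a t` and service `m t` in slot `t`, emptied at the times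
in `drop`. `lifoLeft t s` is the amount of the traffic that arrived in slot `s` and is still in the
queue at the beginning of slot `t`. In slot `t` the arrivals `a t` are put on top of the stack, and
then the amount `m t` is served from the top. -/
def lifoLeft : ℕ → ℕ → ℝ
  | 0 => fun _ => 0
  | t + 1 => fun s =>
    if drop (t + 1) then 0 else
      let content := Function.update (lifoLeft t) t (a t)
      content s - min (content s) (max (m t - ∑ u ∈ Ioc s t, content u) 0)

/-- The stack in slot `t`, after the arrivals of slot `t`. -/
def lifoContent (t : ℕ) : ℕ → ℝ := Function.update (lifoLeft a m drop t) t (a t)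

/-- The amount of the traffic that arrived in slot `s` which is served in slot `t`; its delay is
`t - s`. -/
def lifoServed (t s : ℕ) : ℝ :=
  min (lifoContent a m drop t s) (max (m t - ∑ u ∈ Ioc s t, lifoContent a m drop t u) 0)

end Lifo

namespace Network

variable {M r : ℕ} {X : Type*} [TopologicalSpace X] (net : Network M r X)

/-- Expected traffic that arrives at the queues in `J` in the first `T` slots. -/
def trafficUpTo {Ω : Type*} [MeasurableSpace Ω] (P : Measure Ω) (S : ℕ → Ω → Fin M)
    (x : ℕ → Ω → X) (J : Finset (Fin r)) (T : ℕ) : ℝ :=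
  ∑ j ∈ J, ∑ s ∈ range T, ∫ ω, net.traffic (S s ω) (x s ω) j ∂P

/-- Expected amount of the traffic that arrives at queue `j` in slot `s` and is served, in
last-in-first-out order, with delay exactly `k`. -/
def servedAfter (par : PLCParams) {Ω : Type*} [MeasurableSpace Ω] (P : Measure Ω)
    (S : ℕ → Ω → Fin M) (pred : Ω → ℕ → ℕ → Fin M → ℝ) (x : ℕ → Ω → X)
    (j : Fin r) (s k : ℕ) : ℝ :=
  ∫ ω, lifoServed (fun t => net.traffic (S t ω) (x t ω) j)
    (fun t => net.service (S t ω) (x t ω) j)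
    (DropsAt par (fun t => S t ω) (pred ω)) (s + k) s ∂P

/-- Expected amount of the traffic that arrives at the queues in `J` in the first `T` slots and is
served with delay at most `K`. -/
def servedWithin (par : PLCParams) {Ω : Type*} [MeasurableSpace Ω] (P : Measure Ω)
    (S : ℕ → Ω → Fin M) (pred : Ω → ℕ → ℕ → Fin M → ℝ) (x : ℕ → Ω → X)
    (J : Finset (Fin r)) (K T : ℕ) : ℝ :=
  ∑ j ∈ J, ∑ s ∈ range T, ∑ k ∈ range (K + 1), net.servedAfter par P S pred x j s k

/-- Expected total delay of the traffic counted in `servedWithin`. -/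
def delayWithin (par : PLCParams) {Ω : Type*} [MeasurableSpace Ω] (P : Measure Ω)
    (S : ℕ → Ω → Fin M) (pred : Ω → ℕ → ℕ → Fin M → ℝ) (x : ℕ → Ω → X)
    (J : Finset (Fin r)) (K T : ℕ) : ℝ :=
  ∑ j ∈ J, ∑ s ∈ range T, ∑ k ∈ range (K + 1), (k : ℝ) * net.servedAfter par P S pred x j s k

end Network

end

/-! Perfect prediction removes the learning problem. If the average error is zero, the learning
length is infinite, so the learning window is never full, queues are never dropped, and the estimate
is the average of the predictions. When the prediction window sees a single law `p`, this average is
`p`. Polyhedrality makes the dual maximizer `γ*` unique, so in such a slot (`IsGuidedSlot`) PLC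
minimizes the Lagrangian at `q + placeholder γ* θ` with the exact `γ*` and `θ = 2 log(V)²`.

Two Lyapunov functions do the work. The drift of `Y = ‖q + placeholder - γ*‖` is governed by `g(q +
placeholder) - g(γ*) ≤ -ρ Y`, so `E exp(κ Y)` contracts geometrically up to a constant independent
of `V` (`exp_drift`, `expLyap_le`). The entries of `γ* - placeholder` are at most `θ`, hence the
backlog is `O(log(V)²)` although `γ*` may be of order `V`. The squared norm of the backlog itself
gives the cost (`quadratic_drift`): the placeholder adds a telescoping term and unused service, and
a queue with positive placeholder wastes service only if `Y ≥ θ - deltaMax`, which after mixing has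
probability `O(1/V)` (`placeholder_mul_unused_le`, `exp_neg_offset_le`). Placeholders sum to `O(V)`,
so the loss in `V f` is bounded per slot. The benchmark is `optimalCost = g(γ*) / V`, by weak
duality and a Hahn–Banach separation (`optimalCost_eq`). Delay follows from the backlog by Little's
argument with delays truncated at a large `K` (`exists_delay_bound`).

In the piecewise system only the last `w` slots of an interval are unguided. The contraction over
the rest outweighs their growth (`contraction`), so the exponential moment of the backlog at change
points is at most `exp(O(log(V)³))` (`expMoment_le`). Transients then cost `O(V log(V)⁶)` in `V f`,
a bounded amount per slot over `V^(1+ε)` slots. -/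

noncomputable section

/-! ### The dual function: separation over states and bounds from slack -/

namespace Network

variable {M r : ℕ} {X : Type*} [TopologicalSpace X] (net : Network M r X)

/-- The Lagrangian of action `y` in state `i`. -/
def lagrangian (V : ℝ) (γ : Fin r → ℝ) (i : Fin M) (y : X) : ℝ :=
  V * net.cost i y + ∑ j, γ j * (net.traffic i y j - net.service i y j)

/-- The dual function of a single state. -/
def stateDual (V : ℝ) (γ : Fin r → ℝ) (i : Fin M) : ℝ :=
  ⨅ y : net.feasible i, net.lagrangian V γ i y

instance (i : Fin M) : Nonempty (net.feasible i) := (net.nonempty_feasible i).to_subtype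

variable {net}

lemma abs_traffic_sub_service_le {i : Fin M} {y : X} (hy : y ∈ net.feasible i) (j : Fin r) :
    |net.traffic i y j - net.service i y j| ≤ net.deltaMax := by
  have h1 := net.traffic_nonneg i y hy j
  have h2 := net.traffic_le i y hy j
  have h3 := net.service_nonneg i y hy j
  have h4 := net.service_le i y hy j
  rw [abs_le]; constructor <;> linarith

lemma abs_sum_mul_le {i : Fin M} {y : X} (hy : y ∈ net.feasible i) (γ : Fin r → ℝ) :
    |∑ j, γ j * (net.traffic i y j - net.service i y j)| ≤ (∑ j, |γ j|) * net.deltaMax := by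
  refine (abs_sum_le_sum_abs _ _).trans ?_
  rw [Finset.sum_mul]
  refine sum_le_sum fun j _ => ?_
  rw [abs_mul]
  exact mul_le_mul_of_nonneg_left (abs_traffic_sub_service_le hy j) (abs_nonneg _)

lemma abs_lagrangian_le {i : Fin M} {y : X} (hy : y ∈ net.feasible i) (V : ℝ) (γ : Fin r → ℝ) :
    |net.lagrangian V γ i y| ≤ (|V| + ∑ j, |γ j|) * net.deltaMax := by
  refine (abs_add_le _ _).trans ?_
  rw [add_mul, abs_mul]
  exact add_le_add (mul_le_mul_of_nonneg_left (net.abs_cost_le i y hy) (abs_nonneg _))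
    (abs_sum_mul_le hy γ)

lemma bddBelow_lagrangian (V : ℝ) (γ : Fin r → ℝ) (i : Fin M) :
    BddBelow (Set.range fun y : net.feasible i => net.lagrangian V γ i y) :=
  ⟨-((|V| + ∑ j, |γ j|) * net.deltaMax), by
    rintro _ ⟨y, rfl⟩
    exact (abs_le.1 (abs_lagrangian_le y.2 V γ)).1⟩

lemma stateDual_le {i : Fin M} {y : X} (hy : y ∈ net.feasible i) (V : ℝ) (γ : Fin r → ℝ) :
    net.stateDual V γ i ≤ net.lagrangian V γ i y :=
  ciInf_le (bddBelow_lagrangian V γ i) (⟨y, hy⟩ : net.feasible i)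

lemma lagrangian_sub (V : ℝ) (γ γ' : Fin r → ℝ) (i : Fin M) (y : X) :
    net.lagrangian V γ i y - net.lagrangian V γ' i y =
      ∑ j, (γ j - γ' j) * (net.traffic i y j - net.service i y j) := by
  simp only [lagrangian, sub_mul, sum_sub_distrib]; ring

lemma abs_stateDual_le (V : ℝ) (γ : Fin r → ℝ) (i : Fin M) :
    |net.stateDual V γ i| ≤ (|V| + ∑ j, |γ j|) * net.deltaMax := by
  rw [abs_le]
  constructor
  · exact le_ciInf fun y => (abs_le.1 (abs_lagrangian_le y.2 V γ)).1
  · obtain ⟨y, hy⟩ := net.nonempty_feasible i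
    exact (stateDual_le hy V γ).trans (abs_le.1 (abs_lagrangian_le hy V γ)).2

/-- The Lagrangian is affine in the multiplier with slopes bounded by `deltaMax`, and an infimum of
such functions keeps the Lipschitz constant. -/
lemma stateDual_le_add (V : ℝ) (γ γ' : Fin r → ℝ) (i : Fin M) :
    net.stateDual V γ i ≤ net.stateDual V γ' i + (∑ j, |γ j - γ' j|) * net.deltaMax := by
  rw [← sub_le_iff_le_add]
  refine le_ciInf fun y => ?_
  have h1 := stateDual_le y.2 V γ
  have h2 := lagrangian_sub V γ γ' i (y : X) (net := net)
  have h3 := (abs_le.1 (abs_sum_mul_le y.2 fun j => γ j - γ' j)).2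
  linarith

lemma abs_stateDual_sub_le (V : ℝ) (γ γ' : Fin r → ℝ) (i : Fin M) :
    |net.stateDual V γ i - net.stateDual V γ' i| ≤ (∑ j, |γ j - γ' j|) * net.deltaMax := by
  have h1 := stateDual_le_add V γ γ' i (net := net)
  have h2 := stateDual_le_add V γ' γ i (net := net)
  simp only [abs_sub_comm (γ' _)] at h2
  rw [abs_le]; constructor <;> linarith

lemma continuous_stateDual (V : ℝ) (i : Fin M) :
    Continuous fun γ : Fin r → ℝ => net.stateDual V γ i := by
  have hK : 0 ≤ r * net.deltaMax := mul_nonneg (Nat.cast_nonneg _) net.deltaMax_pos.le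
  refine (LipschitzWith.of_dist_le_mul (K := (r * net.deltaMax).toNNReal) fun γ γ' => ?_).continuous
  rw [Real.dist_eq]
  refine (abs_stateDual_sub_le V γ γ' i).trans ?_
  have : ∑ j, |γ j - γ' j| ≤ ∑ _j : Fin r, dist γ γ' :=
    sum_le_sum fun j _ => by rw [← Real.dist_eq]; exact dist_le_pi_dist γ γ' j
  rw [sum_const, card_univ, Fintype.card_fin, nsmul_eq_mul] at this
  calc _ ≤ (r * dist γ γ') * net.deltaMax :=
        mul_le_mul_of_nonneg_right this net.deltaMax_pos.le
    _ = _ := by rw [Real.coe_toNNReal _ hK]; ring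

/-- The dual function separates over the states. -/
lemma dual_eq_sum (V : ℝ) (γ : Fin r → ℝ) {p : Fin M → ℝ} (hp : p ∈ stdSimplex ℝ (Fin M)) :
    net.dual V γ p = ∑ i, p i * net.stateDual V γ i := by
  have hlb : ∀ x : (∀ i, net.feasible i), ∑ i, p i * net.stateDual V γ i ≤
      ∑ i, p i * net.lagrangian V γ i (x i) := fun x =>
    sum_le_sum fun i _ => mul_le_mul_of_nonneg_left (stateDual_le (x i).2 V γ) (hp.1 i)
  refine le_antisymm ?_ (le_ciInf hlb)
  refine le_of_forall_pos_le_add fun ε hε => ?_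
  -- Costs and traffic need not be continuous in the action, so the infimum may not be attained;
  -- near-minimizers are chosen state by state.
  have hx : ∀ i, ∃ y : net.feasible i, net.lagrangian V γ i y < net.stateDual V γ i + ε :=
    fun i => exists_lt_of_ciInf_lt (lt_add_of_pos_right _ hε)
  choose x hx using hx
  calc net.dual V γ p ≤ ∑ i, p i * net.lagrangian V γ i (x i) :=
        ciInf_le ⟨_, by rintro _ ⟨x, rfl⟩; exact hlb x⟩ x
    _ ≤ ∑ i, p i * (net.stateDual V γ i + ε) :=
        sum_le_sum fun i _ => mul_le_mul_of_nonneg_left (hx i).le (hp.1 i)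
    _ = _ := by simp only [mul_add, sum_add_distrib, ← Finset.sum_mul, hp.2, one_mul]

lemma abs_dual_zero_le {V : ℝ} (hV : 0 ≤ V) {p : Fin M → ℝ} (hp : p ∈ stdSimplex ℝ (Fin M)) :
    |net.dual V 0 p| ≤ V * net.deltaMax := by
  rw [dual_eq_sum V 0 hp]
  refine (abs_sum_le_sum_abs _ _).trans ?_
  calc _ ≤ ∑ i, p i * (V * net.deltaMax) := sum_le_sum fun i _ => by
        rw [abs_mul, abs_of_nonneg (hp.1 i)]
        refine mul_le_mul_of_nonneg_left ?_ (hp.1 i)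
        simpa [abs_of_nonneg hV] using abs_stateDual_le V 0 i (net := net)
    _ = _ := by rw [← Finset.sum_mul, hp.2, one_mul]

/-- An infimum is at most any average, in particular the one over the slack randomization, where
queue `j` contributes at most `-η γ_j`. This makes the dual coercive; the case `V = 0` is used in
the separation argument. -/
lemma dual_le_of_hasSlack {V : ℝ} (hV : 0 ≤ V) {p : Fin M → ℝ} (hp : p ∈ stdSimplex ℝ (Fin M))
    {ε η : ℝ} (hε : 0 ≤ ε) (hs : net.HasSlack p ε η) {γ : Fin r → ℝ} (hγ : 0 ≤ γ) :
    net.dual V γ p ≤ V * net.deltaMax - η * ∑ j, γ j := by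
  obtain ⟨x, a, hx, ha0, ha, hslack⟩ := hs p hp (by simpa [tvDist] using hε)
  rw [dual_eq_sum V γ hp]
  have key : ∀ i, net.stateDual V γ i ≤ V * net.deltaMax +
      ∑ j, γ j * ∑' z, a i z * (net.traffic i (x i z) j - net.service i (x i z) j) := by
    intro i
    have hsum : ∀ j, Summable fun z =>
        a i z * (net.traffic i (x i z) j - net.service i (x i z) j) := fun j =>
      Summable.of_norm_bounded ((ha i).summable.mul_right net.deltaMax) fun z => by
        rw [Real.norm_eq_abs, abs_mul, abs_of_nonneg (ha0 i z)]
        exact mul_le_mul_of_nonneg_left (abs_traffic_sub_service_le (hx i z) j) (ha0 i z)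
    have h1 : HasSum (fun z => a i z * net.stateDual V γ i) (1 * net.stateDual V γ i) :=
      (ha i).mul_right _
    have h2 : HasSum (fun z => a i z * (V * net.deltaMax) +
        ∑ j, γ j * (a i z * (net.traffic i (x i z) j - net.service i (x i z) j)))
        (1 * (V * net.deltaMax) +
        ∑ j, γ j * ∑' z, a i z * (net.traffic i (x i z) j - net.service i (x i z) j)) :=
      ((ha i).mul_right _).add (hasSum_sum fun j _ => (hsum j).hasSum.mul_left _)
    have := hasSum_le (fun z => ?_) h1 h2
    · simpa using this
    · have h3 : net.lagrangian V γ i (x i z) ≤ V * net.deltaMax +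
          ∑ j, γ j * (net.traffic i (x i z) j - net.service i (x i z) j) :=
        add_le_add (mul_le_mul_of_nonneg_left
          (abs_le.1 (net.abs_cost_le i _ (hx i z))).2 hV) le_rfl
      calc _ ≤ a i z * (V * net.deltaMax +
          ∑ j, γ j * (net.traffic i (x i z) j - net.service i (x i z) j)) :=
            mul_le_mul_of_nonneg_left ((stateDual_le (hx i z) V γ).trans h3) (ha0 i z)
        _ = _ := by
            rw [mul_add, Finset.mul_sum]
            congr 1
            exact sum_congr rfl fun j _ => by ring
  calc _ ≤ ∑ i, p i * (V * net.deltaMax +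
        ∑ j, γ j * ∑' z, a i z * (net.traffic i (x i z) j - net.service i (x i z) j)) :=
        sum_le_sum fun i _ => mul_le_mul_of_nonneg_left (key i) (hp.1 i)
    _ = V * net.deltaMax + ∑ j, γ j * ∑ i, p i *
        ∑' z, a i z * (net.traffic i (x i z) j - net.service i (x i z) j) := by
        simp only [mul_add, sum_add_distrib, ← Finset.sum_mul, hp.2, one_mul, Finset.mul_sum]
        rw [sum_comm]
        congr 1
        exact sum_congr rfl fun j _ => sum_congr rfl fun i _ => by ring
    _ ≤ V * net.deltaMax + ∑ j, γ j * (-η) :=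
        add_le_add le_rfl (sum_le_sum fun j _ => mul_le_mul_of_nonneg_left (hslack j) (hγ j))
    _ = _ := by rw [← Finset.sum_mul]; ring

/-- Coercivity is compared with the value at `γ = 0`. Multipliers are of order `V`, so an event of
probability `1/V` weighted by them costs only a constant. -/
lemma IsDualOptimal.sum_le {V : ℝ} (hV : 0 ≤ V) {p : Fin M → ℝ} (hp : p ∈ stdSimplex ℝ (Fin M))
    {ε η : ℝ} (hε : 0 ≤ ε) (hη : 0 < η) (hs : net.HasSlack p ε η) {γ : Fin r → ℝ}
    (hγ : net.IsDualOptimal V p γ) : ∑ j, γ j ≤ 2 * net.deltaMax / η * V := by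
  have h1 := dual_le_of_hasSlack hV hp hε hs hγ.1
  have h2 := hγ.2 0 le_rfl
  have h3 := (abs_le.1 (abs_dual_zero_le hV hp (net := net))).1
  have h4 : η * ∑ j, γ j ≤ 2 * net.deltaMax * V := by linarith
  rw [div_mul_eq_mul_div, le_div_iff₀ hη]; linarith

lemma IsDualOptimal.abs_dual_le {V : ℝ} (hV : 0 ≤ V) {p : Fin M → ℝ}
    (hp : p ∈ stdSimplex ℝ (Fin M)) {ε η : ℝ} (hε : 0 ≤ ε) (hη : 0 < η)
    (hs : net.HasSlack p ε η) {γ : Fin r → ℝ} (hγ : net.IsDualOptimal V p γ) :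
    |net.dual V γ p| ≤ V * net.deltaMax := by
  have h1 := dual_le_of_hasSlack hV hp hε hs hγ.1
  have h2 := hγ.2 0 le_rfl
  have h3 := (abs_le.1 (abs_dual_zero_le hV hp (net := net))).1
  have h4 : 0 ≤ η * ∑ j, γ j := mul_nonneg hη.le (sum_nonneg fun j _ => hγ.1 j)
  rw [abs_le]; constructor <;> linarith

end Network

/-! ### Fresh randomness, regularity of the backlog and weak duality -/

/-- Averaging over a finite random variable `Z` that is independent of `m`. -/
lemma integral_comp_of_indep {Ω β : Type*} [Fintype β] {m : MeasurableSpace Ω} [mΩ : MeasurableSpace Ω]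
    {P : Measure Ω} [IsProbabilityMeasure P] {Z : Ω → β} {wt : β → ℝ}
    (hset : ∀ i, MeasurableSet (Z ⁻¹' {i})) (hind : Indep (MeasurableSpace.comap Z ⊤) m P)
    (hlaw : ∀ i, P.real (Z ⁻¹' {i}) = wt i) {G : β → Ω → ℝ}
    (hG : ∀ i, Measurable[m] (G i)) (hi : ∀ i, Integrable (G i) P) :
    Integrable (fun ω => G (Z ω) ω) P ∧
      ∫ ω, G (Z ω) ω ∂P = ∫ ω, ∑ i, wt i * G i ω ∂P := by
  classical
  have hrep : (fun ω => G (Z ω) ω) =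
      fun ω => ∑ i, (Z ⁻¹' {i}).indicator 1 ω * G i ω := by
    ext ω
    simp [Set.indicator]
  have hint : ∀ i, Integrable (fun ω => (Z ⁻¹' {i}).indicator 1 ω * G i ω) P := by
    intro i
    have : (fun ω => (Z ⁻¹' {i}).indicator (1 : Ω → ℝ) ω * G i ω) =
        (Z ⁻¹' {i}).indicator (G i) := by
      ext ω; simp [Set.indicator]
    rw [this]; exact (hi i).indicator (hset i)
  refine ⟨by rw [hrep]; exact integrable_finsetSum _ fun i _ => hint i, ?_⟩
  rw [hrep, integral_finsetSum _ fun i _ => hint i,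
    integral_finsetSum _ fun i _ => (hi i).const_mul _]
  refine sum_congr rfl fun i _ => ?_
  have hindi : IndepFun ((Z ⁻¹' {i}).indicator (1 : Ω → ℝ)) (G i) P := by
    rw [IndepFun_iff_Indep]
    refine indep_of_indep_of_le_left (indep_of_indep_of_le_right hind (hG i).comap_le) ?_
    have h1 : Measurable[MeasurableSpace.comap Z ⊤] (1 : Ω → ℝ) := measurable_const
    exact (h1.indicator ⟨{i}, trivial, rfl⟩).comap_le
  rw [hindi.integral_fun_mul_eq_mul_integral
    ((measurable_one.indicator (hset i)).aestronglyMeasurable) (hi i).aestronglyMeasurable,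
    integral_const_mul, integral_indicator_one (hset i), hlaw]

namespace Network

variable {M r : ℕ} {X : Type*} [TopologicalSpace X] {net : Network M r X} {Ω : Type*}

variable (net) in
/-- The backlog in slot `t` on the sample path `ω`. -/
abbrev queue (S : ℕ → Ω → Fin M) (x : ℕ → Ω → X) (t : ℕ) (ω : Ω) : Fin r → ℝ :=
  net.backlog (fun t => S t ω) (fun t => x t ω) t

lemma queue_succ (S : ℕ → Ω → Fin M) (x : ℕ → Ω → X) (t : ℕ) (ω : Ω) (j : Fin r) :
    net.queue S x (t + 1) ω j = max (net.queue S x t ω j - net.service (S t ω) (x t ω) j +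
      net.traffic (S t ω) (x t ω) j) 0 := rfl

lemma queue_nonneg (S : ℕ → Ω → Fin M) (x : ℕ → Ω → X) (t : ℕ) (ω : Ω) (j : Fin r) :
    0 ≤ net.queue S x t ω j := by
  cases t with
  | zero => exact le_rfl
  | succ t => exact le_max_right _ _

variable {dist : ℕ → Fin M → ℝ} [mΩ : MeasurableSpace Ω]
  {P : Measure Ω} {ℱ : Filtration ℕ mΩ} {S : ℕ → Ω → Fin M} {x : ℕ → Ω → X}

namespace IsAdmissible

lemma abs_queue_succ_sub_le (h : net.IsAdmissible dist P ℱ S x) (t : ℕ) (ω : Ω) (j : Fin r) :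
    |net.queue S x (t + 1) ω j - net.queue S x t ω j| ≤ net.deltaMax := by
  have h1 := abs_le.1 (abs_traffic_sub_service_le (h.mem_feasible t ω) j)
  have h2 := queue_nonneg (net := net) S x t ω j
  rw [queue_succ, abs_le]
  constructor
  · have := le_max_left (net.queue S x t ω j - net.service (S t ω) (x t ω) j +
      net.traffic (S t ω) (x t ω) j) 0
    linarith
  · rw [sub_le_iff_le_add]
    apply max_le <;> linarith [net.deltaMax_pos]

lemma queue_le (h : net.IsAdmissible dist P ℱ S x) (t : ℕ) (ω : Ω) (j : Fin r) :
    net.queue S x t ω j ≤ t * net.deltaMax := by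
  induction t with
  | zero => simp [backlog]
  | succ t ih =>
    have := (abs_le.1 (h.abs_queue_succ_sub_le t ω j)).2
    push_cast; linarith

lemma measurable_queue (h : net.IsAdmissible dist P ℱ S x) (t : ℕ) (j : Fin r) :
    Measurable[ℱ t] fun ω => net.queue S x t ω j := by
  induction t with
  | zero => exact measurable_const
  | succ t ih =>
    have ih' : Measurable[ℱ (t + 1)] fun ω => net.queue S x t ω j :=
      ih.mono (ℱ.mono t.le_succ) le_rfl
    exact ((ih'.sub (h.measurable_service t j)).add (h.measurable_traffic t j)).max
      measurable_const

lemma measurable_queue_vec (h : net.IsAdmissible dist P ℱ S x) (t : ℕ) :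
    Measurable[ℱ t] fun ω => net.queue S x t ω :=
  @measurable_pi_lambda _ _ _ (ℱ t) _ _ fun j => h.measurable_queue t j

lemma integrable_of_bound (h : net.IsAdmissible dist P ℱ S x) {f : Ω → ℝ} {m : ℕ}
    (hf : Measurable[ℱ m] f) {C : ℝ} (hC : ∀ ω, |f ω| ≤ C) : Integrable f P :=
  have := h.isProbability
  .of_bound (hf.mono (ℱ.le m) le_rfl).aestronglyMeasurable C (Eventually.of_forall hC)

lemma integrable_queue (h : net.IsAdmissible dist P ℱ S x) (t : ℕ) (j : Fin r) :
    Integrable (fun ω => net.queue S x t ω j) P :=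
  h.integrable_of_bound (h.measurable_queue t j) (C := t * net.deltaMax) fun ω => by
    rw [abs_of_nonneg (queue_nonneg S x t ω j)]; exact h.queue_le t ω j

lemma integrable_cost (h : net.IsAdmissible dist P ℱ S x) (t : ℕ) :
    Integrable (fun ω => net.cost (S t ω) (x t ω)) P :=
  h.integrable_of_bound (h.measurable_cost t) fun ω => net.abs_cost_le _ _ (h.mem_feasible t ω)

lemma integrable_traffic (h : net.IsAdmissible dist P ℱ S x) (t : ℕ) (j : Fin r) :
    Integrable (fun ω => net.traffic (S t ω) (x t ω) j) P :=
  h.integrable_of_bound (h.measurable_traffic t j) (C := net.deltaMax) fun ω => by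
    rw [abs_of_nonneg (net.traffic_nonneg _ _ (h.mem_feasible t ω) j)]
    exact net.traffic_le _ _ (h.mem_feasible t ω) j

lemma integrable_service (h : net.IsAdmissible dist P ℱ S x) (t : ℕ) (j : Fin r) :
    Integrable (fun ω => net.service (S t ω) (x t ω) j) P :=
  h.integrable_of_bound (h.measurable_service t j) (C := net.deltaMax) fun ω => by
    rw [abs_of_nonneg (net.service_nonneg _ _ (h.mem_feasible t ω) j)]
    exact net.service_le _ _ (h.mem_feasible t ω) j

lemma abs_meanCost_le (h : net.IsAdmissible dist P ℱ S x) (t : ℕ) :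
    |net.meanCost P S x t| ≤ net.deltaMax := by
  have := h.isProbability
  have := norm_integral_le_of_norm_le_const (μ := P) (C := net.deltaMax)
    (f := fun ω => net.cost (S t ω) (x t ω))
    (Eventually.of_forall fun ω => net.abs_cost_le _ _ (h.mem_feasible t ω))
  simpa [meanCost] using this

/-- Averaging over the state of slot `t`, which is independent of the past. -/
lemma integral_state (h : net.IsAdmissible dist P ℱ S x) (t : ℕ) {G : Fin M → Ω → ℝ}
    (hG : ∀ i, Measurable[ℱ t] (G i)) (hi : ∀ i, Integrable (G i) P) :
    Integrable (fun ω => G (S t ω) ω) P ∧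
      ∫ ω, G (S t ω) ω ∂P = ∫ ω, ∑ i, dist t i * G i ω ∂P :=
  have := h.isProbability
  have hSm : Measurable (S t) := (h.measurable_state t).mono (ℱ.le _) le_rfl
  integral_comp_of_indep (fun i => hSm (measurableSet_singleton i)) (h.indep t) (h.law t) hG hi

/-- The scheme of all drift bounds. The action map is not assumed measurable, so the slot is first
majorized by a `G` that depends on it only through the state, and the state is then averaged out. -/
lemma integral_le_of_state (h : net.IsAdmissible dist P ℱ S x) (t : ℕ) {F R : Ω → ℝ}
    {G : Fin M → Ω → ℝ} (hG : ∀ i, Measurable[ℱ t] (G i)) (hi : ∀ i, Integrable (G i) P)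
    (hF : Integrable F P) (hR : Integrable R P) (hFG : ∀ ω, F ω ≤ G (S t ω) ω)
    (hGR : ∀ ω, ∑ i, dist t i * G i ω ≤ R ω) : ∫ ω, F ω ∂P ≤ ∫ ω, R ω ∂P := by
  obtain ⟨h1, h2⟩ := h.integral_state t hG hi
  calc _ ≤ ∫ ω, G (S t ω) ω ∂P := integral_mono hF h1 hFG
    _ = _ := h2
    _ ≤ _ := integral_mono (integrable_finsetSum _ fun i _ => (hi i).const_mul _) hR hGR

/-- Weak duality in a single slot. -/
lemma dual_le_slot (h : net.IsAdmissible dist P ℱ S x) (V : ℝ) {γ : Fin r → ℝ} (hγ : 0 ≤ γ)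
    {t : ℕ} (hp : dist t ∈ stdSimplex ℝ (Fin M)) :
    net.dual V γ (dist t) ≤ V * net.meanCost P S x t + ∑ j, γ j *
      (∫ ω, net.queue S x (t + 1) ω j ∂P - ∫ ω, net.queue S x t ω j ∂P) := by
  have := h.isProbability
  have h1 := h.integral_state t (G := fun i _ => net.stateDual V γ i) (fun i => measurable_const)
    (fun i => integrable_const _)
  simp only [← dual_eq_sum V γ hp, integral_const, probReal_univ, one_smul] at h1
  rw [← h1.2, meanCost, ← integral_const_mul]
  simp_rw [← integral_sub (h.integrable_queue (t + 1) _) (h.integrable_queue t _),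
    ← integral_const_mul]
  have hq : ∀ j, Integrable (fun ω => γ j *
      (net.queue S x (t + 1) ω j - net.queue S x t ω j)) P := fun j =>
    ((h.integrable_queue _ j).sub (h.integrable_queue _ j)).const_mul _
  rw [← integral_finsetSum _ fun j _ => hq j,
    ← integral_add ((h.integrable_cost t).const_mul V) (integrable_finsetSum _ fun j _ => hq j)]
  refine integral_mono h1.1 (((h.integrable_cost t).const_mul V).add
    (integrable_finsetSum _ fun j _ => hq j)) fun ω => ?_
  refine (stateDual_le (h.mem_feasible t ω) V γ).trans ?_
  refine add_le_add le_rfl (sum_le_sum fun j _ => mul_le_mul_of_nonneg_left ?_ (hγ j))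
  -- Reflection at zero can only raise the backlog, so its increment dominates the net input.
  have := le_max_left (net.queue S x t ω j - net.service (S t ω) (x t ω) j +
      net.traffic (S t ω) (x t ω) j) 0
  rw [queue_succ]; linarith

/-- Weak duality over a time interval with state distribution `p`. -/
lemma dual_le_sum (h : net.IsAdmissible dist P ℱ S x) (V : ℝ) {γ : Fin r → ℝ} (hγ : 0 ≤ γ)
    {p : Fin M → ℝ} (hp : p ∈ stdSimplex ℝ (Fin M)) {t₀ n : ℕ}
    (hd : ∀ t, t₀ ≤ t → t < t₀ + n → dist t = p) :
    n * net.dual V γ p ≤ V * ∑ t ∈ Ico t₀ (t₀ + n), net.meanCost P S x t + ∑ j, γ j *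
      (∫ ω, net.queue S x (t₀ + n) ω j ∂P - ∫ ω, net.queue S x t₀ ω j ∂P) := by
  induction n with
  | zero => simp
  | succ n ih =>
    have h1 := ih fun t ht ht' => hd t ht (by omega)
    have h2 := h.dual_le_slot V hγ (t := t₀ + n) (by rw [hd _ (by omega) (by omega)]; exact hp)
    rw [hd _ (by omega) (by omega)] at h2
    rw [← add_assoc, sum_Ico_succ_top (by omega)]
    have h3 : ∑ j, γ j * (∫ ω, net.queue S x (t₀ + n + 1) ω j ∂P -
        ∫ ω, net.queue S x t₀ ω j ∂P) =
        ∑ j, γ j * (∫ ω, net.queue S x (t₀ + n) ω j ∂P - ∫ ω, net.queue S x t₀ ω j ∂P) +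
        ∑ j, γ j * (∫ ω, net.queue S x (t₀ + n + 1) ω j ∂P -
          ∫ ω, net.queue S x (t₀ + n) ω j ∂P) := by
      rw [← sum_add_distrib]; exact sum_congr rfl fun j _ => by ring
    rw [h3]; push_cast; linarith

end IsAdmissible

end Network

/-! ### Strong duality: the optimal cost is the dual optimum divided by `V` -/

/-- An i.i.d. sequence with a given law on a finite set. -/
lemma exists_iid {β : Type} [Fintype β] {wt : β → ℝ} (h0 : ∀ b, 0 ≤ wt b) (h1 : ∑ b, wt b = 1) :
    ∃ (Ω : Type) (mΩ : MeasurableSpace Ω) (P : Measure Ω) (ℱ : Filtration ℕ mΩ) (Z : ℕ → Ω → β),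
      IsProbabilityMeasure P ∧ (∀ t, @Measurable _ _ (ℱ (t + 1)) ⊤ (Z t)) ∧
      (∀ t, Indep (MeasurableSpace.comap (Z t) ⊤) (ℱ t) P) ∧
      ∀ t b, P.real (Z t ⁻¹' {b}) = wt b := by
  classical
  let _ : MeasurableSpace β := ⊤
  let pmf : PMF β := PMF.ofFintype (fun b => ENNReal.ofReal (wt b)) (by
    rw [← ENNReal.ofReal_sum_of_nonneg fun b _ => h0 b, h1, ENNReal.ofReal_one])
  let P : Measure (ℕ → β) := Measure.infinitePi fun _ => pmf.toMeasure
  have hle : ∀ s : ℕ, MeasurableSpace.comap (fun ω : ℕ → β => ω s) ⊤ ≤ MeasurableSpace.pi :=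
    fun s => (measurable_pi_apply s).comap_le
  let ℱ : Filtration ℕ (MeasurableSpace.pi : MeasurableSpace (ℕ → β)) :=
    { seq := fun t => ⨆ s ∈ Set.Iio t, MeasurableSpace.comap (fun ω : ℕ → β => ω s) ⊤
      mono' := fun t t' htt => biSup_mono fun s hs => lt_of_lt_of_le hs htt
      le' := fun t => iSup₂_le fun s _ => hle s }
  refine ⟨ℕ → β, MeasurableSpace.pi, P, ℱ, fun t ω => ω t, inferInstance, fun t => ?_,
    fun t => ?_, fun t b => ?_⟩
  · refine measurable_iff_comap_le.2 ?_
    exact le_iSup₂_of_le (f := fun s (_ : s ∈ Set.Iio (t + 1)) =>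
      MeasurableSpace.comap (fun ω : ℕ → β => ω s) ⊤) t (Nat.lt_succ_self t) le_rfl
  · have hi : iIndepFun (fun (s : ℕ) (ω : ℕ → β) => ω s) P :=
      iIndepFun_infinitePi (X := fun _ => id) fun _ => measurable_id
    have := indep_iSup_of_disjoint hle hi (S := {t}) (T := Set.Iio t) (by simp)
    rw [_root_.iSup_singleton] at this
    exact this
  · have hm := (measurePreserving_eval_infinitePi (fun _ : ℕ => pmf.toMeasure) t).measure_preimage
      (measurableSet_singleton b).nullMeasurableSet
    have h2 : P ((fun ω : ℕ → β => ω t) ⁻¹' {b}) = ENNReal.ofReal (wt b) := by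
      refine Eq.trans hm ?_
      rw [pmf.toMeasure_apply_singleton b (measurableSet_singleton b)]
      rfl
    rw [measureReal_def, h2, ENNReal.toReal_ofReal (h0 b)]

namespace Network

variable {M r : ℕ} {X : Type*} [TopologicalSpace X] {net : Network M r X}

/-- Strong duality: some finite mixture of deterministic stationary policies is strictly stable and
has a cost arbitrarily close to the dual optimum. -/
lemma exists_mixed_policy {V : ℝ} (hV : 0 < V) {p : Fin M → ℝ} (hp : p ∈ stdSimplex ℝ (Fin M))
    {ε η : ℝ} (hε : 0 ≤ ε) (hη : 0 < η) (hs : net.HasSlack p ε η) {γ : Fin r → ℝ}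
    (hγ : net.IsDualOptimal V p γ) {δ : ℝ} (hδ : 0 < δ) :
    ∃ (ι : Type) (_ : Fintype ι) (a : ι → ℝ) (y : ι → ∀ i, net.feasible i),
      (∀ z, 0 ≤ a z) ∧ ∑ z, a z = 1 ∧
      ∑ z, a z * ∑ i, p i * net.cost i (y z i) < net.dual V γ p / V + δ ∧
      ∀ j, ∑ z, a z * ∑ i, p i * (net.traffic i (y z i) j - net.service i (y z i) j) < 0 := by
  set A₀ := net.dual V γ p / V + δ with hA
  clear_value A₀
  -- Deterministic policies are points (mean cost, mean net input), mixtures are points of their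
  -- convex hull. If the hull misses the open set of costs below `A₀` and negative inputs, a
  -- separating functional `(u, v)` contradicts the optimality of `γ`.
  let F : (∀ i, net.feasible i) → ℝ × (Fin r → ℝ) := fun y =>
    (∑ i, p i * net.cost i (y i),
      fun j => ∑ i, p i * (net.traffic i (y i) j - net.service i (y i) j))
  let s : Set (ℝ × (Fin r → ℝ)) := Set.Iio A₀ ×ˢ Set.univ.pi fun _ => Set.Iio 0
  by_cases hdisj : Disjoint s (convexHull ℝ (Set.range F))
  swap
  · obtain ⟨v, hv, hv'⟩ := Set.not_disjoint_iff.1 hdisj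
    obtain ⟨ι, hι, a, z, ha0, ha1, hz, rfl⟩ := mem_convexHull_iff_exists_fintype.1 hv'
    choose y hy using hz
    refine ⟨ι, hι, a, y, ha0, ha1, ?_, fun j => ?_⟩
    · have := hv.1
      simpa [← hy, F, Prod.fst_sum] using this
    · have := hv.2 j trivial
      simpa [← hy, F, Prod.snd_sum, Finset.sum_apply] using this
  exfalso
  have hsconv : Convex ℝ s := (convex_Iio A₀).prod (convex_pi fun _ _ => convex_Iio 0)
  have hsopen : IsOpen s := isOpen_Iio.prod (isOpen_set_pi Set.finite_univ fun _ _ => isOpen_Iio)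
  obtain ⟨f, c, hfs, hfK⟩ := geometric_hahn_banach_open hsconv hsopen (convex_convexHull ℝ _) hdisj
  set u := f (1, 0) with hu
  set v : Fin r → ℝ := fun j => f (0, Pi.single j 1) with hv
  have hf : ∀ a b, f (a, b) = u * a + ∑ j, v j * b j := by
    intro a b
    have h1 : (a, b) = a • ((1 : ℝ), (0 : Fin r → ℝ)) +
        ∑ j, b j • ((0 : ℝ), (Pi.single j 1 : Fin r → ℝ)) := by
      refine Prod.ext ?_ ?_
      · simp [Prod.fst_sum]
      · ext k
        simp [Prod.snd_sum, Finset.sum_apply, Pi.single_apply]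
    rw [h1, map_add, map_smul, map_sum]
    simp only [map_smul, smul_eq_mul, ← hu, hv]
    rw [mul_comm]
    congr 1
    exact sum_congr rfl fun j _ => mul_comm _ _
  have hmem : ∀ a (b : Fin r → ℝ), a < A₀ → (∀ j, b j < 0) → u * a + ∑ j, v j * b j < c :=
    fun a b ha hb => by rw [← hf]; exact hfs _ ⟨ha, fun j _ => hb j⟩
  have hclosed : ∀ a (b : Fin r → ℝ), a ≤ A₀ → (∀ j, b j ≤ 0) → u * a + ∑ j, v j * b j ≤ c := by
    intro a b ha hb
    have ht : Tendsto (fun e : ℝ => u * (a - e) + ∑ j, v j * (b j - e)) (nhdsWithin 0 (Set.Ioi 0))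
        (nhds (u * (a - 0) + ∑ j, v j * (b j - 0))) :=
      (Continuous.tendsto (by fun_prop) 0).mono_left nhdsWithin_le_nhds
    simp only [sub_zero] at ht
    refine le_of_tendsto ht ?_
    filter_upwards [self_mem_nhdsWithin] with e he
    have he' : 0 < e := he
    exact (hmem _ _ (by linarith) fun j => by linarith [hb j]).le
  have hupos : 0 ≤ u := by
    by_contra! hneg
    have h1 := hclosed A₀ 0 le_rfl fun _ => le_rfl
    -- With `u < 0` the functional takes the value `c - u > c` at this cost level.
    have h2 := hclosed (A₀ - ((c - u * A₀) / (-u) + 1)) 0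
      (by have : 0 ≤ (c - u * A₀) / (-u) := div_nonneg (by simpa using h1) (by linarith)
          linarith) fun _ => le_rfl
    simp only [Pi.zero_apply, mul_zero, sum_const_zero, add_zero] at h1 h2
    have h3 : u * ((c - u * A₀) / (-u)) = -(c - u * A₀) := by
      rw [div_neg, mul_neg, mul_div_cancel₀ _ hneg.ne]
    nlinarith
  have hvpos : 0 ≤ v := by
    intro k
    by_contra! hneg
    have hneg' : v k < 0 := hneg
    have h1 := hclosed A₀ 0 le_rfl fun _ => le_rfl
    simp only [Pi.zero_apply, mul_zero, sum_const_zero, add_zero] at h1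
    have h0 : 0 ≤ (c - u * A₀) / (-v k) := div_nonneg (by linarith) (by linarith)
    have h2 := hclosed A₀ (Pi.single k (-((c - u * A₀) / (-v k) + 1))) le_rfl fun j => by
      by_cases hj : j = k
      · subst hj; simp only [Pi.single_eq_same]; linarith
      · simp [hj]
    rw [sum_eq_single k (fun j _ hj => by simp [hj]) (by simp)] at h2
    simp only [Pi.single_eq_same] at h2
    have h3 : v k * ((c - u * A₀) / (-v k)) = -(c - u * A₀) := by
      rw [div_neg, mul_neg, mul_div_cancel₀ _ hneg'.ne]
    nlinarith
  have hK : ∀ y : (∀ i, net.feasible i), c ≤ u * ∑ i, p i * net.cost i (y i) +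
      ∑ j, v j * ∑ i, p i * (net.traffic i (y i) j - net.service i (y i) j) := fun y => by
    rw [← hf]; exact hfK _ (subset_convexHull ℝ _ ⟨y, rfl⟩)
  have hc := hclosed A₀ 0 le_rfl fun _ => le_rfl
  simp only [Pi.zero_apply, mul_zero, sum_const_zero, add_zero] at hc
  have hexp : ∀ (V' : ℝ) (γ' : Fin r → ℝ) (y : ∀ i, net.feasible i),
      ∑ i, p i * (V' * net.cost i (y i) +
        ∑ j, γ' j * (net.traffic i (y i) j - net.service i (y i) j)) =
      V' * ∑ i, p i * net.cost i (y i) +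
        ∑ j, γ' j * ∑ i, p i * (net.traffic i (y i) j - net.service i (y i) j) := by
    intro V' γ' y
    simp only [mul_add, sum_add_distrib, Finset.mul_sum]
    rw [sum_comm (s := (univ : Finset (Fin r)))]
    congr 1
    · exact sum_congr rfl fun i _ => by ring
    · exact sum_congr rfl fun i _ => sum_congr rfl fun j _ => by ring
  -- A vertical hyperplane `u = 0` is excluded by slack: `v` would have a nonnegative dual value for
  -- `V = 0`, which forces `v = 0`. If `u > 0`, the multiplier `V v / u` has dual value at least `V
  -- A₀`, above the optimum by `V δ`.
  rcases hupos.eq_or_lt with hu0 | hu0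
  · have h1 : 0 ≤ net.dual 0 v p := le_ciInf fun y => by
      rw [hexp]
      have := hK y
      rw [← hu0] at this hc
      simp only [zero_mul] at this hc ⊢
      linarith
    have h2 := dual_le_of_hasSlack le_rfl hp hε hs hvpos
    have h3 : ∑ j, v j ≤ 0 := by
      by_contra! h
      have := mul_pos hη h
      linarith
    have h4 : ∀ j, v j = 0 := fun j =>
      (sum_eq_zero_iff_of_nonneg fun j _ => hvpos j).1
        (le_antisymm h3 (sum_nonneg fun j _ => hvpos j)) j (mem_univ j)
    have h5 := hmem (A₀ - 1) (fun _ => -1) (by linarith) fun _ => by norm_num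
    have h6 := hK (Classical.arbitrary _)
    simp only [h4, ← hu0, zero_mul, sum_const_zero, add_zero] at h5 h6
    linarith
  · have h1 : V * A₀ ≤ net.dual V (fun j => V / u * v j) p := le_ciInf fun y => by
      rw [hexp]
      have h2 : V / u * (u * A₀) ≤ V / u * (u * ∑ i, p i * net.cost i (y i) +
          ∑ j, v j * ∑ i, p i * (net.traffic i (y i) j - net.service i (y i) j)) :=
        mul_le_mul_of_nonneg_left (hc.trans (hK y)) (div_nonneg hV.le hu0.le)
      rw [mul_add, ← mul_assoc, ← mul_assoc, div_mul_cancel₀ _ hu0.ne',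
        Finset.mul_sum _ _ (V / u)] at h2
      simpa only [mul_assoc] using h2
    have h2 := hγ.2 _ fun j => mul_nonneg (div_nonneg hV.le hu0.le) (hvpos j)
    have h3 : V * A₀ = net.dual V γ p + V * δ := by
      rw [hA]; field_simp
    have := mul_pos hV hδ
    linarith

end Network

namespace Network

variable {M r : ℕ} {X : Type*} [TopologicalSpace X] {net : Network M r X}

section

variable {dist : ℕ → Fin M → ℝ} {Ω : Type*} [mΩ : MeasurableSpace Ω]
  {P : Measure Ω} {ℱ : Filtration ℕ mΩ} {S : ℕ → Ω → Fin M} {x : ℕ → Ω → X}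

namespace IsAdmissible

lemma abs_timeAverage_le (h : net.IsAdmissible dist P ℱ S x) (T : ℕ) :
    |(∑ t ∈ range T, net.meanCost P S x t) / T| ≤ net.deltaMax := by
  rw [abs_div, Nat.abs_cast]
  refine div_le_of_le_mul₀ (Nat.cast_nonneg _) net.deltaMax_pos.le ?_
  refine (abs_sum_le_sum_abs _ _).trans ((sum_le_sum fun t _ => h.abs_meanCost_le t).trans ?_)
  simp [mul_comm]

lemma isBoundedUnder_timeAverage (h : net.IsAdmissible dist P ℱ S x) :
    IsBoundedUnder (· ≤ ·) atTop fun T : ℕ => (∑ t ∈ range T, net.meanCost P S x t) / T :=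
  isBoundedUnder_of ⟨_, fun T => (abs_le.1 (h.abs_timeAverage_le T)).2⟩

lemma isCoboundedUnder_timeAverage (h : net.IsAdmissible dist P ℱ S x) :
    IsCoboundedUnder (· ≤ ·) atTop fun T : ℕ => (∑ t ∈ range T, net.meanCost P S x t) / T :=
  IsBoundedUnder.isCoboundedUnder_le
    (isBoundedUnder_of ⟨_, fun T => (abs_le.1 (h.abs_timeAverage_le T)).1⟩)

/-- Weak duality: no stable policy has a cost below the dual optimum. -/
lemma dual_div_le_avgCost {p : Fin M → ℝ} (h : net.IsAdmissible (fun _ => p) P ℱ S x)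
    (hp : p ∈ stdSimplex ℝ (Fin M)) {V : ℝ} (hV : 0 < V) {γ : Fin r → ℝ} (hγ : 0 ≤ γ)
    (hb : IsBoundedUnder (· ≤ ·) atTop fun T : ℕ => (∑ t ∈ range T, ∑ j,
      ∫ ω, net.queue S x t ω j ∂P) / T) :
    net.dual V γ p / V ≤ net.avgCost P S x := by
  obtain ⟨B, hB⟩ := hb
  rw [eventually_map] at hB
  set E : ℕ → ℝ := fun t => ∑ j, ∫ ω, net.queue S x t ω j ∂P with hE
  have hq0 : ∀ t j, 0 ≤ ∫ ω, net.queue S x t ω j ∂P := fun t j =>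
    integral_nonneg fun ω => queue_nonneg S x t ω j
  have hE0 : ∀ t, 0 ≤ E t := fun t => sum_nonneg fun j _ => hq0 t j
  -- A bounded time average controls the backlog only at infinitely many times; this is enough for a
  -- lower bound on a limsup.
  have hfreq : ∃ᶠ T in atTop, E T ≤ B + 1 := by
    intro hcon
    obtain ⟨N, hN⟩ := eventually_atTop.1 hcon
    obtain ⟨N', hN'⟩ := eventually_atTop.1 hB
    obtain ⟨n, hn⟩ := exists_nat_gt (N * (B + 1))
    set T := N + N' + n + 1
    have h1 : (∑ t ∈ range T, E t) / T ≤ B := hN' T (by omega)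
    have hT : (0 : ℝ) < T := by positivity
    rw [div_le_iff₀ hT] at h1
    have h2 : ∑ t ∈ range T, (B + 1) - ∑ t ∈ range N, (B + 1) ≤ ∑ t ∈ range T, E t := by
      rw [← sum_range_add_sum_Ico (fun _ => B + 1) (show N ≤ T by omega), add_sub_cancel_left]
      rw [← sum_range_add_sum_Ico E (show N ≤ T by omega)]
      have h3 : ∑ t ∈ Ico N T, (B + 1) ≤ ∑ t ∈ Ico N T, E t :=
        sum_le_sum fun t ht => (not_le.1 (hN t (mem_Ico.1 ht).1)).le
      have h4 : 0 ≤ ∑ t ∈ range N, E t := sum_nonneg fun t _ => hE0 t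
      linarith
    simp only [sum_const, card_range, nsmul_eq_mul] at h2
    have h5 : (n : ℝ) ≤ T := by exact_mod_cast (by omega : n ≤ T)
    nlinarith
  refine le_of_forall_pos_sub_le fun ε hε => ?_
  refine le_limsup_of_frequently_le ?_ h.isBoundedUnder_timeAverage
  have hlarge : ∀ᶠ T : ℕ in atTop, (∑ j, γ j) * (B + 1) ≤ V * ε * T :=
    (tendsto_natCast_atTop_atTop.const_mul_atTop (mul_pos hV hε)).eventually_ge_atTop _
  refine (hfreq.and_eventually (hlarge.and (eventually_gt_atTop 0))).mono ?_
  rintro T ⟨h1, h2, h3⟩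
  have hT : (0 : ℝ) < T := by exact_mod_cast h3
  have h4 := h.dual_le_sum V hγ hp (t₀ := 0) (n := T) fun _ _ _ => rfl
  simp only [zero_add, ← range_eq_Ico] at h4
  have h5 : ∑ j, γ j * (∫ ω, net.queue S x T ω j ∂P - ∫ ω, net.queue S x 0 ω j ∂P) ≤
      (∑ j, γ j) * (B + 1) := by
    rw [Finset.sum_mul]
    refine sum_le_sum fun j _ => mul_le_mul_of_nonneg_left ?_ (hγ j)
    have h6 : ∫ ω, net.queue S x T ω j ∂P ≤ E T :=
      single_le_sum (f := fun j => ∫ ω, net.queue S x T ω j ∂P) (fun j _ => hq0 T j) (mem_univ j)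
    linarith [hq0 0 j]
  rw [le_div_iff₀ hT, sub_mul, div_mul_eq_mul_div, sub_le_iff_le_add, div_le_iff₀ hV]
  nlinarith

end IsAdmissible

end

/-- The stationary randomized policy of a finite mixture with strictly negative mean input is
admissible and stable. -/
lemma exists_iid_policy {p : Fin M → ℝ} (hp : p ∈ stdSimplex ℝ (Fin M)) {ι : Type} [Fintype ι]
    {a : ι → ℝ} (y : ι → ∀ i, net.feasible i) (ha0 : ∀ z, 0 ≤ a z) (ha1 : ∑ z, a z = 1)
    (hneg : ∀ j, ∑ z, a z * ∑ i, p i *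
      (net.traffic i (y z i) j - net.service i (y z i) j) < 0) :
    ∃ (Ω : Type) (mΩ : MeasurableSpace Ω) (P : Measure Ω) (ℱ : Filtration ℕ mΩ)
      (S : ℕ → Ω → Fin M) (x : ℕ → Ω → X), net.IsAdmissible (fun _ => p) P ℱ S x ∧
      IsBoundedUnder (· ≤ ·) atTop (fun T : ℕ => (∑ t ∈ range T, ∑ j,
        ∫ ω, net.queue S x t ω j ∂P) / T) ∧
      net.avgCost P S x = ∑ z, a z * ∑ i, p i * net.cost i (y z i) := by
  classical
  have hsum : ∀ f : Fin M × ι → ℝ, ∑ b, p b.1 * a b.2 * f b =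
      ∑ z, a z * ∑ i, p i * f (i, z) := by
    intro f
    rw [Fintype.sum_prod_type, sum_comm]
    refine sum_congr rfl fun z _ => ?_
    rw [Finset.mul_sum]
    exact sum_congr rfl fun i _ => by ring
  -- State and randomization index are drawn together, as one i.i.d. sequence with product weights.
  obtain ⟨Ω, mΩ, P, ℱ, Z, hP, hZ, hind, hlaw⟩ := exists_iid
    (wt := fun b : Fin M × ι => p b.1 * a b.2) (fun b => mul_nonneg (hp.1 _) (ha0 _)) (by
      have := hsum fun _ => 1
      simpa [hp.2, ha1] using this)
  have hmeas : ∀ {γ : Type} [MeasurableSpace γ] (t : ℕ) (g : Fin M × ι → γ),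
      Measurable[ℱ (t + 1)] fun ω => g (Z t ω) := fun t g =>
    (@measurable_from_top _ _ _ g).comp (hZ t)
  have hset : ∀ t b, MeasurableSet (Z t ⁻¹' {b}) := fun t b =>
    ℱ.le (t + 1) _ (hZ t (show MeasurableSet[⊤] _ from trivial))
  let S : ℕ → Ω → Fin M := fun t ω => (Z t ω).1
  let x : ℕ → Ω → X := fun t ω => y (Z t ω).2 (Z t ω).1
  have hexp : ∀ t (f : Fin M × ι → ℝ), ∫ ω, f (Z t ω) ∂P = ∑ z, a z * ∑ i, p i * f (i, z) := by
    intro t f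
    have := (integral_comp_of_indep (hset t) (hind t) (hlaw t) (G := fun b _ => f b)
      (fun b => measurable_const) fun b => integrable_const _).2
    rw [this, ← hsum]; simp
  have hadm : net.IsAdmissible (fun _ => p) P ℱ S x :=
    { isProbability := hP
      measurable_state := fun t => hmeas t Prod.fst
      measurable_cost := fun t => hmeas t fun b => net.cost b.1 (y b.2 b.1)
      measurable_traffic := fun t j => hmeas t fun b => net.traffic b.1 (y b.2 b.1) j
      measurable_service := fun t j => hmeas t fun b => net.service b.1 (y b.2 b.1) j
      indep := fun t => by
        refine indep_of_indep_of_le_left (hind t) ?_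
        rintro _ ⟨s, _, rfl⟩
        exact ⟨Prod.fst ⁻¹' s, trivial, rfl⟩
      law := fun t i => by
        have h1 := hexp t fun b => if b.1 = i then 1 else 0
        have h2 : MeasurableSet (S t ⁻¹' {i}) :=
          ℱ.le (t + 1) _ (hmeas t Prod.fst (measurableSet_singleton i))
        rw [← integral_indicator_one h2]
        have h3 : (S t ⁻¹' {i}).indicator (1 : Ω → ℝ) =
            fun ω => if (Z t ω).1 = i then 1 else 0 := by
          ext ω; simp [Set.indicator, S]
        rw [h3, h1]
        simp [← Finset.sum_mul, ha1]
      mem_feasible := fun t ω => (y _ _).2 }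
  refine ⟨Ω, mΩ, P, ℱ, S, x, hadm, ?_, ?_⟩
  · set Δ : Fin r → Fin M × ι → ℝ := fun j b =>
      net.traffic b.1 (y b.2 b.1) j - net.service b.1 (y b.2 b.1) j with hΔ
    set e : Fin r → ℝ := fun j => ∑ b, p b.1 * a b.2 * Δ j b with he
    have hen : ∀ j, e j < 0 := fun j => by rw [he]; simp only [hsum]; exact hneg j
    have hw1 : ∑ b : Fin M × ι, p b.1 * a b.2 = 1 := by
      have := hsum fun _ => 1
      simpa [hp.2, ha1] using this
    have hΔb : ∀ j b, |Δ j b| ≤ net.deltaMax := fun j b => abs_traffic_sub_service_le (y _ _).2 j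
    have hsq : ∀ t j, Integrable (fun ω => net.queue S x t ω j ^ 2) P := fun t j =>
      hadm.integrable_of_bound ((hadm.measurable_queue t j).pow_const 2)
        (C := (t * net.deltaMax) ^ 2) fun ω => by
        rw [abs_pow, abs_of_nonneg (queue_nonneg S x t ω j)]
        exact pow_le_pow_left₀ (queue_nonneg S x t ω j) (hadm.queue_le t ω j) 2
    -- Each queue has its own quadratic Lyapunov function; the strictly negative mean input `e j`
    -- makes the accumulated backlog at most linear in `T`.
    have hdrift : ∀ j t, ∫ ω, net.queue S x (t + 1) ω j ^ 2 ∂P ≤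
        ∫ ω, net.queue S x t ω j ^ 2 ∂P + 2 * e j * ∫ ω, net.queue S x t ω j ∂P +
          net.deltaMax ^ 2 := by
      intro j t
      have hG : ∀ b, Measurable[ℱ t] fun ω => (net.queue S x t ω j + Δ j b) ^ 2 := fun b =>
        ((hadm.measurable_queue t j).add_const _).pow_const 2
      have hGi : ∀ b, Integrable (fun ω => (net.queue S x t ω j + Δ j b) ^ 2) P := fun b =>
        hadm.integrable_of_bound (hG b) (C := (t * net.deltaMax + net.deltaMax) ^ 2) fun ω => by
          rw [abs_pow]
          refine pow_le_pow_left₀ (abs_nonneg _) ((abs_add_le _ _).trans ?_) 2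
          rw [abs_of_nonneg (queue_nonneg S x t ω j)]
          exact add_le_add (hadm.queue_le t ω j) (hΔb j b)
      obtain ⟨h1, h2⟩ := integral_comp_of_indep (hset t) (hind t) (hlaw t) hG hGi
      have h3 : ∫ ω, net.queue S x (t + 1) ω j ^ 2 ∂P ≤
          ∫ ω, (net.queue S x t ω j + Δ j (Z t ω)) ^ 2 ∂P := by
        refine integral_mono (hsq (t + 1) j) h1 fun ω => ?_
        have h4 : net.queue S x (t + 1) ω j = max (net.queue S x t ω j + Δ j (Z t ω)) 0 := by
          rw [queue_succ]; congr 1; simp only [hΔ, S, x]; ring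
        simp only [h4]
        rcases le_total 0 (net.queue S x t ω j + Δ j (Z t ω)) with h5 | h5
        · rw [max_eq_left h5]
        · rw [max_eq_right h5]; simpa using sq_nonneg _
      refine h3.trans (h2.le.trans ?_)
      have hi1 := hsq t j
      have hi2 := (hadm.integrable_queue t j).const_mul (2 * e j)
      rw [← integral_const_mul, ← integral_add hi1 hi2]
      have h6 : ∫ _ω, net.deltaMax ^ 2 ∂P = net.deltaMax ^ 2 := by simp
      conv_rhs => rw [← h6]
      have h7 : Integrable (fun ω => net.queue S x t ω j ^ 2 +
          2 * e j * net.queue S x t ω j) P := hi1.add hi2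
      rw [← integral_add h7 (integrable_const _)]
      refine integral_mono (integrable_finsetSum _ fun b _ => (hGi b).const_mul _)
        (h7.add (integrable_const _)) fun ω => ?_
      calc ∑ b, p b.1 * a b.2 * (net.queue S x t ω j + Δ j b) ^ 2
          ≤ ∑ b, (p b.1 * a b.2 * net.queue S x t ω j ^ 2 +
            p b.1 * a b.2 * Δ j b * (2 * net.queue S x t ω j) +
            p b.1 * a b.2 * net.deltaMax ^ 2) := by
            refine sum_le_sum fun b _ => ?_
            have h8 : Δ j b ^ 2 ≤ net.deltaMax ^ 2 := sq_le_sq' (abs_le.1 (hΔb j b)).1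
              (abs_le.1 (hΔb j b)).2
            have h9 := mul_le_mul_of_nonneg_left h8 (mul_nonneg (hp.1 b.1) (ha0 b.2))
            nlinarith
        _ = _ := by
            simp only [sum_add_distrib, ← Finset.sum_mul, hw1, one_mul]
            simp only [he]; ring
    have hsumle : ∀ j (T : ℕ), ∫ ω, net.queue S x T ω j ^ 2 ∂P +
        2 * (-e j) * ∑ t ∈ range T, ∫ ω, net.queue S x t ω j ∂P ≤ T * net.deltaMax ^ 2 := by
      intro j T
      induction T with
      | zero => simp [backlog]
      | succ T ih =>
        have := hdrift j T
        rw [sum_range_succ]; push_cast; linarith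
    refine isBoundedUnder_of ⟨∑ j, net.deltaMax ^ 2 / (2 * -e j), fun T => ?_⟩
    refine div_le_of_le_mul₀ (Nat.cast_nonneg _) (sum_nonneg fun j _ => div_nonneg (sq_nonneg _)
      (by linarith [hen j])) ?_
    rw [sum_comm, Finset.sum_mul]
    refine sum_le_sum fun j _ => ?_
    rw [div_mul_eq_mul_div, le_div_iff₀ (by linarith [hen j])]
    have h1 := hsumle j T
    have h2 : 0 ≤ ∫ ω, net.queue S x T ω j ^ 2 ∂P := integral_nonneg fun ω => sq_nonneg _
    linarith
  · have hmc : ∀ t, net.meanCost P S x t = ∑ z, a z * ∑ i, p i * net.cost i (y z i) := fun t =>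
      hexp t fun b => net.cost b.1 (y b.2 b.1)
    unfold avgCost
    simp only [hmc, sum_const, card_range, nsmul_eq_mul]
    refine Tendsto.limsup_eq (tendsto_const_nhds.congr' ?_)
    filter_upwards [eventually_gt_atTop 0] with T hT
    have : (T : ℝ) ≠ 0 := by positivity
    field_simp

/-- The optimal cost is the dual optimum divided by `V`. -/
lemma IsDualOptimal.optimalCost_eq {V : ℝ} (hV : 0 < V) {p : Fin M → ℝ}
    (hp : p ∈ stdSimplex ℝ (Fin M)) {ε η : ℝ} (hε : 0 ≤ ε) (hη : 0 < η)
    (hs : net.HasSlack p ε η) {γ : Fin r → ℝ} (hγ : net.IsDualOptimal V p γ) :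
    net.optimalCost p = net.dual V γ p / V := by
  have hlow : ∀ c ∈ {c | ∃ (Ω : Type) (mΩ : MeasurableSpace Ω) (P : Measure Ω)
      (ℱ : Filtration ℕ mΩ) (S : ℕ → Ω → Fin M) (x : ℕ → Ω → X),
      net.IsAdmissible (fun _ => p) P ℱ S x ∧
      IsBoundedUnder (· ≤ ·) atTop (fun T : ℕ => (∑ t ∈ range T, ∑ j,
        ∫ ω, net.backlog (fun t => S t ω) (fun t => x t ω) t j ∂P) / T) ∧
      c = net.avgCost P S x}, net.dual V γ p / V ≤ c := by
    rintro c ⟨Ω, mΩ, P, ℱ, S, x, hadm, hb, rfl⟩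
    exact hadm.dual_div_le_avgCost hp hV hγ.1 hb
  have hup : ∀ δ > 0, ∃ c ∈ {c | ∃ (Ω : Type) (mΩ : MeasurableSpace Ω) (P : Measure Ω)
      (ℱ : Filtration ℕ mΩ) (S : ℕ → Ω → Fin M) (x : ℕ → Ω → X),
      net.IsAdmissible (fun _ => p) P ℱ S x ∧
      IsBoundedUnder (· ≤ ·) atTop (fun T : ℕ => (∑ t ∈ range T, ∑ j,
        ∫ ω, net.backlog (fun t => S t ω) (fun t => x t ω) t j ∂P) / T) ∧
      c = net.avgCost P S x}, c < net.dual V γ p / V + δ := by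
    intro δ hδ
    obtain ⟨ι, hι, a, y, ha0, ha1, hcost, hneg⟩ := exists_mixed_policy hV hp hε hη hs hγ hδ
    obtain ⟨Ω, mΩ, P, ℱ, S, x, hadm, hb, hc⟩ := exists_iid_policy hp y ha0 ha1 hneg
    exact ⟨_, ⟨Ω, mΩ, P, ℱ, S, x, hadm, hb, rfl⟩, hc ▸ hcost⟩
  refine le_antisymm (le_of_forall_pos_le_add fun δ hδ => ?_) ?_
  · obtain ⟨c, hc, hlt⟩ := hup δ hδ
    exact (csInf_le ⟨_, hlow⟩ hc).trans hlt.le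
  · obtain ⟨c, hc, -⟩ := hup 1 one_pos
    exact le_csInf ⟨c, hc⟩ hlow

end Network

/-! ### Exponential drift towards the multiplier -/

section EuclNorm

variable {r : ℕ}

/-- The Euclidean norm of a vector of multipliers. -/
def euclNorm (v : Fin r → ℝ) : ℝ := ‖WithLp.toLp 2 v‖

lemma euclNorm_nonneg (v : Fin r → ℝ) : 0 ≤ euclNorm v := norm_nonneg _

lemma euclNorm_sq (v : Fin r → ℝ) : euclNorm v ^ 2 = ∑ j, v j ^ 2 := by
  simp [euclNorm, EuclideanSpace.norm_sq_eq]

lemma abs_le_euclNorm (v : Fin r → ℝ) (j : Fin r) : |v j| ≤ euclNorm v := by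
  simpa [euclNorm] using PiLp.norm_apply_le (WithLp.toLp 2 v) j

lemma euclNorm_add_le (v v' : Fin r → ℝ) : euclNorm (v + v') ≤ euclNorm v + euclNorm v' := by
  simpa [euclNorm] using norm_add_le (WithLp.toLp 2 v) (WithLp.toLp 2 v')

lemma euclNorm_neg (v : Fin r → ℝ) : euclNorm (-v) = euclNorm v := by
  simp [euclNorm]

lemma abs_euclNorm_sub_le (v v' : Fin r → ℝ) :
    |euclNorm v - euclNorm v'| ≤ euclNorm (v - v') := by
  simpa [euclNorm] using abs_norm_sub_norm_le (WithLp.toLp 2 v) (WithLp.toLp 2 v')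

lemma euclNorm_le_sum (v : Fin r → ℝ) : euclNorm v ≤ ∑ j, |v j| := by
  refine (sq_le_sq₀ (euclNorm_nonneg v) (sum_nonneg fun j _ => abs_nonneg _)).1 ?_
  rw [euclNorm_sq]
  simpa using sum_sq_le_sq_sum_of_nonneg (s := univ) (f := fun j => |v j|) fun j _ => abs_nonneg _

lemma euclNorm_le_mul {v : Fin r → ℝ} {C : ℝ} (h : ∀ j, |v j| ≤ C) : euclNorm v ≤ r * C := by
  refine (euclNorm_le_sum v).trans ((sum_le_sum fun j _ => h j).trans ?_)
  simp

lemma sum_abs_le_euclNorm (v : Fin r → ℝ) : ∑ j, |v j| ≤ r * euclNorm v := by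
  refine (sum_le_sum fun j _ => abs_le_euclNorm v j).trans ?_
  simp

lemma continuous_euclNorm : Continuous (euclNorm : (Fin r → ℝ) → ℝ) := by
  unfold euclNorm; fun_prop

/-- Reflection at zero does not increase the distance to a point of the orthant. -/
lemma euclNorm_sq_reflect_le {q u d : Fin r → ℝ} (hd : ∀ j, d j ≤ 0) :
    euclNorm ((fun j => max (q j + u j) 0) + d) ^ 2 ≤
      euclNorm (q + d) ^ 2 + 2 * ∑ j, (q j + d j) * u j + ∑ j, u j ^ 2 := by
  rw [euclNorm_sq, euclNorm_sq, Finset.mul_sum, ← sum_add_distrib, ← sum_add_distrib]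
  refine sum_le_sum fun j _ => ?_
  simp only [Pi.add_apply]
  rcases le_total 0 (q j + u j) with h | h
  · rw [max_eq_left h]; exact le_of_eq (by ring)
  -- For a clipped queue `q j + u j + d j ≤ d j ≤ 0`, so clipping moves the coordinate towards the
  -- origin.
  · rw [max_eq_right h]; nlinarith [hd j]

end EuclNorm

/-- One step of the exponential Lyapunov function, far from the minimum of the drift. -/
lemma exp_step_le {κ ρ D Y Y' h s : ℝ} (hκ : 0 < κ) (hρ : 0 < ρ) (hD : 0 < D) (hκD : κ * D ≤ 1)
    (hY : D ^ 2 / ρ ≤ Y) (hsq : Y' ^ 2 ≤ Y ^ 2 + 2 * s + D ^ 2) (hd : |Y' - Y| ≤ D)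
    (hs : s ≤ h) :
    Real.exp (κ * Y') ≤
      Real.exp (κ * Y) * (1 + κ * (ρ / 2 + h / Y) + κ ^ 2 * D ^ 2) := by
  have hYpos : 0 < Y := lt_of_lt_of_le (by positivity) hY
  have hu : |κ * (Y' - Y)| ≤ κ * D := by
    rw [abs_mul, abs_of_pos hκ]; exact mul_le_mul_of_nonneg_left hd hκ.le
  have h1 := (abs_le.1 (Real.abs_exp_sub_one_sub_id_le (hu.trans hκD))).2
  have h2 : (κ * (Y' - Y)) ^ 2 ≤ (κ * D) ^ 2 := sq_le_sq' (abs_le.1 hu).1 (abs_le.1 hu).2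
  -- From `2 Y (Y' - Y) ≤ Y'² - Y²`; the lower bound on `Y` turns `D²/(2Y)` into at most `ρ/2`. The
  -- term `h` stays linear, so that it can be averaged over the state.
  have h3 : Y' - Y ≤ ρ / 2 + h / Y := by
    have h4 : D ^ 2 ≤ ρ * Y := by rw [div_le_iff₀ hρ] at hY; linarith
    have h5 : Y * (Y' - Y) ≤ Y * (ρ / 2 + h / Y) := by
      rw [mul_add, mul_div_cancel₀ _ hYpos.ne']
      nlinarith [sq_nonneg (Y' - Y)]
    exact le_of_mul_le_mul_left h5 hYpos
  have h6 : κ * Y' = κ * Y + κ * (Y' - Y) := by ring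
  rw [h6, Real.exp_add]
  refine mul_le_mul_of_nonneg_left ?_ (Real.exp_pos _).le
  have h7 := mul_le_mul_of_nonneg_left h3 hκ.le
  nlinarith

namespace Network

variable {M r : ℕ} {X : Type*} [TopologicalSpace X] {net : Network M r X}

variable (net) in
/-- A bound for the change of the backlog vector in one slot. -/
def stepBound : ℝ := (r + 1) * net.deltaMax

variable (net) in
/-- Exponent of the Lyapunov function. -/
def lyapExp (ρ : ℝ) : ℝ := min (1 / net.stepBound) (min (ρ / (4 * net.stepBound ^ 2)) (1 / ρ))

variable (net) in
/-- Additive constant of the exponential drift. -/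
def driftConst (ρ : ℝ) : ℝ :=
  Real.exp (net.lyapExp ρ * (net.stepBound ^ 2 / ρ + net.stepBound))

/-- The factor `r + 1` in place of `r` keeps this true for a network without queues. -/
lemma stepBound_pos : 0 < net.stepBound := mul_pos (by positivity) net.deltaMax_pos

lemma lyapExp_pos {ρ : ℝ} (hρ : 0 < ρ) : 0 < net.lyapExp ρ := by
  have := net.stepBound_pos
  unfold lyapExp; positivity

/-- The three terms of the minimum give, in turn, the second-order expansion of `exp` over one step,
a quadratic remainder `κ²D² ≤ κρ/4`, and a contraction factor `1 - κρ/4` that is not negative. -/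
lemma lyapExp_mul_stepBound (ρ : ℝ) : net.lyapExp ρ * net.stepBound ≤ 1 := by
  rw [← le_div_iff₀ net.stepBound_pos]; exact min_le_left _ _

lemma lyapExp_mul_stepBound_sq (ρ : ℝ) : net.lyapExp ρ * net.stepBound ^ 2 ≤ ρ / 4 := by
  have h : 0 < net.stepBound ^ 2 := pow_pos net.stepBound_pos 2
  have h1 : net.lyapExp ρ ≤ ρ / (4 * net.stepBound ^ 2) :=
    (min_le_right _ _).trans (min_le_left _ _)
  rw [le_div_iff₀ (by positivity)] at h1
  linarith

lemma lyapExp_mul_le {ρ : ℝ} (hρ : 0 < ρ) : net.lyapExp ρ * ρ ≤ 1 := by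
  rw [← le_div_iff₀ hρ]; exact (min_le_right _ _).trans (min_le_right _ _)

lemma driftConst_pos (ρ : ℝ) : 0 < net.driftConst ρ := Real.exp_pos _

lemma mul_deltaMax_le_stepBound : r * net.deltaMax ≤ net.stepBound := by
  unfold stepBound; nlinarith [net.deltaMax_pos]

variable {dist : ℕ → Fin M → ℝ} {Ω : Type*} [mΩ : MeasurableSpace Ω]
  {P : Measure Ω} {ℱ : Filtration ℕ mΩ} {S : ℕ → Ω → Fin M} {x : ℕ → Ω → X}

namespace IsAdmissible

lemma integrable_comp_queue (h : net.IsAdmissible dist P ℱ S x) (t : ℕ)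
    {φ : (Fin r → ℝ) → ℝ} (hφ : Measurable φ) {C : ℝ}
    (hC : ∀ v : Fin r → ℝ, (∀ j, 0 ≤ v j ∧ v j ≤ t * net.deltaMax) → |φ v| ≤ C) :
    Integrable (fun ω => φ (net.queue S x t ω)) P :=
  h.integrable_of_bound (hφ.comp (h.measurable_queue_vec t)) fun ω =>
    hC _ fun j => ⟨queue_nonneg S x t ω j, h.queue_le t ω j⟩

lemma integrable_continuous_comp_queue (h : net.IsAdmissible dist P ℱ S x) (t : ℕ)
    {φ : (Fin r → ℝ) → ℝ} (hφ : Continuous φ) :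
    Integrable (fun ω => φ (net.queue S x t ω)) P := by
  have hK : IsCompact (Set.Icc (0 : Fin r → ℝ) fun _ => t * net.deltaMax) := isCompact_Icc
  obtain ⟨C, hC⟩ := hK.exists_bound_of_continuousOn hφ.continuousOn
  exact h.integrable_comp_queue t hφ.measurable (C := C) fun v hv =>
    hC v ⟨fun j => (hv j).1, fun j => (hv j).2⟩

/-- Exponential drift towards the optimal multiplier under a polyhedral dual function. -/
lemma exp_drift (h : net.IsAdmissible dist P ℱ S x) {t : ℕ} {V ρ : ℝ} (hρ : 0 < ρ)
    (hp : dist t ∈ stdSimplex ℝ (Fin M)) {γs wv : Fin r → ℝ} (hwv : 0 ≤ wv) (hle : wv ≤ γs)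
    (hpoly : ∀ γ, 0 ≤ γ → net.dual V γ (dist t) + ρ * euclNorm (γs - γ) ≤
      net.dual V γs (dist t))
    (hctl : ∀ ω, net.lagrangian V (net.queue S x t ω + wv) (S t ω) (x t ω) ≤
      net.stateDual V (net.queue S x t ω + wv) (S t ω)) :
    ∫ ω, Real.exp (net.lyapExp ρ * euclNorm (net.queue S x (t + 1) ω + (wv - γs))) ∂P ≤
      (1 - net.lyapExp ρ * ρ / 4) *
        ∫ ω, Real.exp (net.lyapExp ρ * euclNorm (net.queue S x t ω + (wv - γs))) ∂P +
      net.driftConst ρ := by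
  have := h.isProbability
  set κ := net.lyapExp ρ with hκdef
  set D := net.stepBound with hDdef
  have hκ : 0 < κ := lyapExp_pos hρ
  have hD : 0 < D := stepBound_pos
  set d : Fin r → ℝ := wv - γs with hddef
  have hd : ∀ j, d j ≤ 0 := fun j => sub_nonpos.2 (hle j)
  have hcY : Continuous fun v : Fin r → ℝ => euclNorm (v + d) :=
    continuous_euclNorm.comp (continuous_id.add continuous_const)
  have hcE : Continuous fun v : Fin r → ℝ => Real.exp (κ * euclNorm (v + d)) :=
    Real.continuous_exp.comp (continuous_const.mul hcY)
  -- Majorant of the next exponential: linearized drift where `Y ≥ D²/ρ`, a constant nearer to the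
  -- target. By the Lipschitz bound `hsub` the quotient by `Y` stays bounded, which integrability
  -- needs.
  set Ψ : Fin M → (Fin r → ℝ) → ℝ := fun i v =>
    if D ^ 2 / ρ ≤ euclNorm (v + d) then
      Real.exp (κ * euclNorm (v + d)) * (1 + κ * (ρ / 2 +
        (net.stateDual V (v + wv) i - net.stateDual V γs i) / euclNorm (v + d)) + κ ^ 2 * D ^ 2)
    else net.driftConst ρ with hΨ
  have hΨm : ∀ i, Measurable (Ψ i) := by
    intro i
    have h1 : Continuous fun v : Fin r → ℝ => net.stateDual V (v + wv) i :=
      (continuous_stateDual V i).comp (continuous_id.add continuous_const)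
    refine Measurable.ite (measurableSet_le measurable_const hcY.measurable) ?_ measurable_const
    exact hcE.measurable.mul (((((h1.measurable.sub_const _).div hcY.measurable).const_add _
      |>.const_mul _).const_add _).add_const _)
  have hsub : ∀ v : Fin r → ℝ, ∀ i, |net.stateDual V (v + wv) i - net.stateDual V γs i| ≤
      r * euclNorm (v + d) * net.deltaMax := by
    intro v i
    refine (abs_stateDual_sub_le V _ _ i).trans ?_
    refine mul_le_mul_of_nonneg_right ?_ net.deltaMax_pos.le
    have : ∀ j, (v + wv) j - γs j = (v + d) j := fun j => by simp [d]; ring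
    simp only [this]
    exact sum_abs_le_euclNorm _
  have hy0 : 0 < D ^ 2 / ρ := by positivity
  have hΨi : ∀ i, Integrable (fun ω => Ψ i (net.queue S x t ω)) P := by
    intro i
    have hK : IsCompact (Set.Icc (0 : Fin r → ℝ) fun _ => t * net.deltaMax) := isCompact_Icc
    obtain ⟨C, hC⟩ := hK.exists_bound_of_continuousOn hcE.continuousOn
    refine h.integrable_comp_queue t (hΨm i)
      (C := C * (1 + κ * (ρ / 2 + r * net.deltaMax) + κ ^ 2 * D ^ 2) + net.driftConst ρ)
      fun v hv => ?_
    have h1 := hC v ⟨fun j => (hv j).1, fun j => (hv j).2⟩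
    rw [Real.norm_eq_abs, abs_of_pos (Real.exp_pos _)] at h1
    have hC0 : 0 ≤ C := (Real.exp_pos _).le.trans h1
    have hrd : 0 ≤ r * net.deltaMax := mul_nonneg (Nat.cast_nonneg _) net.deltaMax_pos.le
    have hDC := net.driftConst_pos ρ
    simp only [hΨ]
    split_ifs with hY
    · have hYp := hy0.trans_le hY
      have h2 : |(net.stateDual V (v + wv) i - net.stateDual V γs i) / euclNorm (v + d)| ≤
          r * net.deltaMax := by
        rw [abs_div, abs_of_pos hYp, div_le_iff₀ hYp]
        refine (hsub v i).trans (le_of_eq (by ring))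
      have h3 := abs_le.1 h2
      rw [abs_mul, abs_of_pos (Real.exp_pos _)]
      have h4 : |1 + κ * (ρ / 2 + (net.stateDual V (v + wv) i - net.stateDual V γs i) /
          euclNorm (v + d)) + κ ^ 2 * D ^ 2| ≤
          1 + κ * (ρ / 2 + r * net.deltaMax) + κ ^ 2 * D ^ 2 := by
        have h5 := mul_le_mul_of_nonneg_left h3.1 hκ.le
        have h6 := mul_le_mul_of_nonneg_left h3.2 hκ.le
        have h7 : 0 ≤ κ ^ 2 * D ^ 2 := by positivity
        have h8 : 0 ≤ κ * (ρ / 2) := by positivity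
        rw [abs_le]; constructor <;> nlinarith
      have := mul_le_mul h1 h4 (abs_nonneg _) hC0
      linarith
    · rw [abs_of_pos hDC]
      have : 0 ≤ C * (1 + κ * (ρ / 2 + r * net.deltaMax) + κ ^ 2 * D ^ 2) := by positivity
      linarith
  have hZ : ∀ s, Integrable (fun ω => Real.exp (κ * euclNorm (net.queue S x s ω + d))) P :=
    fun s => h.integrable_continuous_comp_queue s hcE
  have hα := lyapExp_mul_le hρ (net := net)
  have key := h.integral_le_of_state t (G := fun i ω => Ψ i (net.queue S x t ω))
    (F := fun ω => Real.exp (κ * euclNorm (net.queue S x (t + 1) ω + d)))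
    (R := fun ω => (1 - κ * ρ / 4) * Real.exp (κ * euclNorm (net.queue S x t ω + d)) +
      net.driftConst ρ)
    (fun i => (hΨm i).comp (h.measurable_queue_vec t)) hΨi (hZ (t + 1))
    (((hZ t).const_mul _).add (integrable_const _)) ?_ ?_
  · rw [integral_add ((hZ t).const_mul _) (integrable_const _), integral_const_mul] at key
    simpa using key
  · intro ω
    set q := net.queue S x t ω
    set u : Fin r → ℝ := fun j =>
      net.traffic (S t ω) (x t ω) j - net.service (S t ω) (x t ω) j with hu
    have hub : ∀ j, |u j| ≤ net.deltaMax := abs_traffic_sub_service_le (h.mem_feasible t ω)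
    have hsucc : net.queue S x (t + 1) ω = fun j => max (q j + u j) 0 := by
      ext j; rw [queue_succ]; congr 1; simp only [hu, q]; ring
    have hdiff : |euclNorm (net.queue S x (t + 1) ω + d) - euclNorm (q + d)| ≤ D := by
      refine (abs_euclNorm_sub_le _ _).trans ?_
      rw [add_sub_add_right_eq_sub]
      exact (euclNorm_le_mul fun j => h.abs_queue_succ_sub_le t ω j).trans
        mul_deltaMax_le_stepBound
    simp only [hΨ]
    split_ifs with hY
    · refine exp_step_le hκ hρ hD (lyapExp_mul_stepBound ρ) hY (s := ∑ j, (q j + d j) * u j)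
        ?_ hdiff ?_
      · have h1 := euclNorm_sq_reflect_le (q := q) (u := u) hd
        have h2 : ∑ j, u j ^ 2 ≤ D ^ 2 := by
          rw [← euclNorm_sq]
          exact pow_le_pow_left₀ (euclNorm_nonneg _)
            ((euclNorm_le_mul hub).trans mul_deltaMax_le_stepBound) 2
        rw [hsucc]; linarith
      -- `q + d` is the difference of the multipliers `q + wv` and `γs`, so its product with the net
      -- input is a difference of Lagrangians. The action minimizes the first; the second is at
      -- least its infimum.
      · have h1 := lagrangian_sub V (q + wv) γs (S t ω) (x t ω) (net := net)
        have h2 := stateDual_le (h.mem_feasible t ω) V γs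
        have h3 := hctl ω
        have h4 : ∑ j, (q j + d j) * u j = ∑ j, ((q + wv) j - γs j) *
            (net.traffic (S t ω) (x t ω) j - net.service (S t ω) (x t ω) j) :=
          sum_congr rfl fun j _ => by simp only [d, hu, Pi.add_apply, Pi.sub_apply]; ring
        rw [h4]; linarith
    -- From inside the ball one step reaches at most `D²/ρ + D`, the radius in `driftConst`.
    · have h1 := (abs_le.1 hdiff).2
      refine Real.exp_le_exp.2 (mul_le_mul_of_nonneg_left ?_ hκ.le)
      linarith
  · intro ω
    set q := net.queue S x t ω
    have hq : 0 ≤ q := fun j => queue_nonneg S x t ω j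
    have hE := Real.exp_pos (κ * euclNorm (q + d))
    have hDC := net.driftConst_pos ρ
    simp only [hΨ]
    split_ifs with hY
    · have hYp := hy0.trans_le hY
      have h1 := hpoly (q + wv) (add_nonneg hq hwv)
      have h2 : euclNorm (γs - (q + wv)) = euclNorm (q + d) := by
        rw [← euclNorm_neg]; congr 1; simp only [d]; abel
      rw [h2, dual_eq_sum V _ hp, dual_eq_sum V _ hp] at h1
      have h3 : ∑ i, dist t i * (Real.exp (κ * euclNorm (q + d)) * (1 + κ * (ρ / 2 +
          (net.stateDual V (q + wv) i - net.stateDual V γs i) / euclNorm (q + d)) +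
          κ ^ 2 * D ^ 2)) = Real.exp (κ * euclNorm (q + d)) * ((∑ i, dist t i) *
          (1 + κ * (ρ / 2) + κ ^ 2 * D ^ 2) + κ * ((∑ i, dist t i * net.stateDual V (q + wv) i -
            ∑ i, dist t i * net.stateDual V γs i) / euclNorm (q + d))) := by
        rw [← sum_sub_distrib, Finset.sum_mul, Finset.sum_div, Finset.mul_sum, ← sum_add_distrib,
          Finset.mul_sum]
        exact sum_congr rfl fun i _ => by ring
      rw [h3, hp.2, one_mul]
      -- Polyhedrality enters after averaging over the state; the relative drift becomes at most
      -- `κ(ρ/2 - ρ) + κρ/4 = -κρ/4`.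
      have h4 : (∑ i, dist t i * net.stateDual V (q + wv) i -
            ∑ i, dist t i * net.stateDual V γs i) / euclNorm (q + d) ≤ -ρ := by
        rw [div_le_iff₀ hYp]; linarith
      have h5 := mul_le_mul_of_nonneg_left h4 hκ.le
      have h6 : κ ^ 2 * D ^ 2 ≤ κ * (ρ / 4) := by
        have := mul_le_mul_of_nonneg_left (lyapExp_mul_stepBound_sq ρ (net := net)) hκ.le
        calc κ ^ 2 * D ^ 2 = κ * (κ * D ^ 2) := by ring
          _ ≤ _ := this
      nlinarith
    · rw [← Finset.sum_mul, hp.2, one_mul]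
      have : 0 ≤ (1 - κ * ρ / 4) * Real.exp (κ * euclNorm (q + d)) :=
        mul_nonneg (by linarith) hE.le
      linarith

end IsAdmissible

end Network

/-! ### Guided slots: concentration of the backlog and cost -/

lemma affine_recursion_le {u : ℕ → ℝ} {α b : ℝ} (hα : 0 < α) (hα1 : α ≤ 1) (hb : 0 ≤ b) {n : ℕ}
    (h : ∀ m < n, u (m + 1) ≤ (1 - α) * u m + b) {m : ℕ} (hm : m ≤ n) :
    u m ≤ (1 - α) ^ m * u 0 + b / α := by
  induction m with
  | zero => simpa using div_nonneg hb hα.le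
  | succ m ih =>
    have h1 := h m hm
    have h2 := mul_le_mul_of_nonneg_left (ih (by omega)) (sub_nonneg.2 hα1)
    have h3 : (1 - α) * (b / α) + b = b / α := by field_simp; ring
    calc u (m + 1) ≤ (1 - α) * ((1 - α) ^ m * u 0 + b / α) + b := by linarith
      _ = _ := by rw [mul_add, add_assoc, h3, pow_succ]; ring

/-- The placeholder backlog `(γ - θ)⁺`. -/
def placeholder {r : ℕ} (γ : Fin r → ℝ) (θ : ℝ) : Fin r → ℝ := fun j => max (γ j - θ) 0

lemma placeholder_nonneg {r : ℕ} (γ : Fin r → ℝ) (θ : ℝ) : 0 ≤ placeholder γ θ :=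
  fun _ => le_max_right _ _

lemma placeholder_le {r : ℕ} {γ : Fin r → ℝ} (hγ : 0 ≤ γ) {θ : ℝ} (hθ : 0 ≤ θ) :
    placeholder γ θ ≤ γ := fun j => max_le (by linarith) (hγ j)

/-- The backlog is attracted to `γ - placeholder γ θ`, whose entries are at most `θ` whatever the
size of `γ`. This is the source of the logarithmic backlog. -/
lemma abs_placeholder_sub_le {r : ℕ} {γ : Fin r → ℝ} (hγ : 0 ≤ γ) {θ : ℝ} (hθ : 0 ≤ θ)
    (j : Fin r) : |(placeholder γ θ - γ) j| ≤ θ := by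
  have h1 := placeholder_le hγ hθ j
  have h2 : γ j - θ ≤ placeholder γ θ j := le_max_left _ _
  rw [Pi.sub_apply, abs_le]; constructor <;> linarith

namespace Network

variable {M r : ℕ} {X : Type*} [TopologicalSpace X] {net : Network M r X}
  {dist : ℕ → Fin M → ℝ} {Ω : Type*} [mΩ : MeasurableSpace Ω]
  {P : Measure Ω} {ℱ : Filtration ℕ mΩ} {S : ℕ → Ω → Fin M} {x : ℕ → Ω → X}

variable (net) in
/-- Expected exponential Lyapunov function around the multiplier `γ`. -/
def expLyap (P : Measure Ω) (S : ℕ → Ω → Fin M) (x : ℕ → Ω → X) (ρ θ : ℝ) (γ : Fin r → ℝ)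
    (t : ℕ) : ℝ :=
  ∫ ω, Real.exp (net.lyapExp ρ * euclNorm (net.queue S x t ω + (placeholder γ θ - γ))) ∂P

variable (net) in
/-- Expected squared Euclidean norm of the backlog. -/
def sqLyap (P : Measure Ω) (S : ℕ → Ω → Fin M) (x : ℕ → Ω → X) (t : ℕ) : ℝ :=
  ∫ ω, euclNorm (net.queue S x t ω) ^ 2 ∂P

variable (net) in
/-- `γ` is a dual maximizer with polyhedrality constant `ρ`. -/
def IsPolyhedralMultiplier (V ρ : ℝ) (p : Fin M → ℝ) (γ : Fin r → ℝ) : Prop :=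
  0 ≤ γ ∧ ∀ γ', 0 ≤ γ' → net.dual V γ' p + ρ * euclNorm (γ - γ') ≤ net.dual V γ p

lemma IsPolyhedralMultiplier.isDualOptimal {V ρ : ℝ} (hρ : 0 < ρ) {p : Fin M → ℝ}
    {γ : Fin r → ℝ} (h : net.IsPolyhedralMultiplier V ρ p γ) : net.IsDualOptimal V p γ :=
  ⟨h.1, fun γ' hγ' => by
    have := h.2 γ' hγ'
    have := mul_nonneg hρ.le (euclNorm_nonneg (γ - γ'))
    linarith⟩

/-- The linear gap leaves no room for a second maximizer, so ties in the learning step cannot arise.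
-/
lemma IsPolyhedralMultiplier.eq_of_isDualOptimal {V ρ : ℝ} (hρ : 0 < ρ) {p : Fin M → ℝ}
    {γ γ' : Fin r → ℝ} (h : net.IsPolyhedralMultiplier V ρ p γ) (h' : net.IsDualOptimal V p γ') :
    γ' = γ := by
  have h1 := h.2 γ' h'.1
  have h2 := h'.2 γ h.1
  have h3 : euclNorm (γ - γ') ≤ 0 := by
    by_contra! hpos
    have := mul_pos hρ hpos
    linarith
  ext j
  have h4 := (abs_le_euclNorm (γ - γ') j).trans h3
  rw [abs_nonpos_iff, Pi.sub_apply] at h4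
  linarith

variable (net) in
/-- In slot `t` the state has law `p`, and the action minimizes the Lagrangian at the backlog
shifted by the placeholder of `γ`. -/
def IsGuidedSlot (dist : ℕ → Fin M → ℝ) (S : ℕ → Ω → Fin M) (x : ℕ → Ω → X) (V θ : ℝ)
    (p : Fin M → ℝ) (γ : Fin r → ℝ) (t : ℕ) : Prop :=
  dist t = p ∧ ∀ ω, net.lagrangian V (net.queue S x t ω + placeholder γ θ) (S t ω) (x t ω) ≤
    net.stateDual V (net.queue S x t ω + placeholder γ θ) (S t ω)

lemma expLyap_nonneg (ρ θ : ℝ) (γ : Fin r → ℝ) (t : ℕ) : 0 ≤ net.expLyap P S x ρ θ γ t :=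
  integral_nonneg fun _ => (Real.exp_pos _).le

lemma sqLyap_nonneg (t : ℕ) : 0 ≤ net.sqLyap P S x t := integral_nonneg fun _ => sq_nonneg _

namespace IsAdmissible

lemma integrable_expLyap (h : net.IsAdmissible dist P ℱ S x) (ρ θ : ℝ) (γ : Fin r → ℝ) (t : ℕ) :
    Integrable (fun ω => Real.exp (net.lyapExp ρ *
      euclNorm (net.queue S x t ω + (placeholder γ θ - γ)))) P :=
  h.integrable_continuous_comp_queue t (φ := fun v => Real.exp (net.lyapExp ρ *
    euclNorm (v + (placeholder γ θ - γ))))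
    (Real.continuous_exp.comp (continuous_const.mul
      (continuous_euclNorm.comp (continuous_id.add continuous_const))))

lemma integrable_sqLyap (h : net.IsAdmissible dist P ℱ S x) (t : ℕ) :
    Integrable (fun ω => euclNorm (net.queue S x t ω) ^ 2) P :=
  h.integrable_continuous_comp_queue t (φ := fun v => euclNorm v ^ 2) (continuous_euclNorm.pow 2)

/-- Drift-plus-penalty inequality. -/
lemma quadratic_drift (h : net.IsAdmissible dist P ℱ S x) {t : ℕ} {V θ : ℝ} {p : Fin M → ℝ}
    (hp : p ∈ stdSimplex ℝ (Fin M)) {γ : Fin r → ℝ} (hγ : net.IsDualOptimal V p γ)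
    (hg : net.IsGuidedSlot dist S x V θ p γ t) :
    V * net.meanCost P S x t + net.sqLyap P S x (t + 1) / 2 ≤
      net.stepBound ^ 2 / 2 + net.dual V γ p + net.sqLyap P S x t / 2 + ∑ j, placeholder γ θ j *
        ∫ ω, (net.service (S t ω) (x t ω) j - net.traffic (S t ω) (x t ω) j) ∂P := by
  have := h.isProbability
  obtain ⟨hdist, hctl⟩ := hg
  set wv := placeholder γ θ with hwv
  have hcS : ∀ i, Continuous fun v : Fin r → ℝ =>
      euclNorm v ^ 2 / 2 + net.stepBound ^ 2 / 2 + net.stateDual V (v + wv) i := fun i =>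
    (((continuous_euclNorm.pow 2).div_const 2).add continuous_const).add
      ((continuous_stateDual V i).comp (continuous_id.add continuous_const))
  have hst : ∀ j, Integrable (fun ω => wv j * (net.service (S t ω) (x t ω) j -
      net.traffic (S t ω) (x t ω) j)) P := fun j =>
    ((h.integrable_service t j).sub (h.integrable_traffic t j)).const_mul _
  have hi1 := (h.integrable_cost t).const_mul V
  have hi2 := (h.integrable_sqLyap (t + 1)).div_const 2
  have hi3 : Integrable (fun ω => ∑ j, wv j * (net.service (S t ω) (x t ω) j -
      net.traffic (S t ω) (x t ω) j)) P := integrable_finsetSum _ fun j _ => hst j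
  have hi4 := (h.integrable_sqLyap t).div_const 2
  have hi12 : Integrable (fun ω => V * net.cost (S t ω) (x t ω) +
    euclNorm (net.queue S x (t + 1) ω) ^ 2 / 2) P := hi1.add hi2
  have key := h.integral_le_of_state t
    (F := fun ω => V * net.cost (S t ω) (x t ω) + euclNorm (net.queue S x (t + 1) ω) ^ 2 / 2 -
      ∑ j, wv j * (net.service (S t ω) (x t ω) j - net.traffic (S t ω) (x t ω) j))
    (G := fun i ω => euclNorm (net.queue S x t ω) ^ 2 / 2 + net.stepBound ^ 2 / 2 +
      net.stateDual V (net.queue S x t ω + wv) i)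
    (R := fun ω => euclNorm (net.queue S x t ω) ^ 2 / 2 +
      (net.stepBound ^ 2 / 2 + net.dual V γ p))
    (fun i => (hcS i).measurable.comp (h.measurable_queue_vec t))
    (fun i => h.integrable_continuous_comp_queue t (hcS i)) (hi12.sub hi3)
    (hi4.add (integrable_const _)) ?_ ?_
  · rw [integral_sub hi12 hi3, integral_add hi1 hi2, integral_add hi4 (integrable_const _),
      integral_const_mul, integral_div, integral_div, integral_finsetSum _ fun j _ => hst j] at key
    simp only [integral_const_mul, integral_const, probReal_univ, one_smul] at key
    simp only [meanCost, sqLyap]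
    linarith
  · intro ω
    set q := net.queue S x t ω
    set u : Fin r → ℝ := fun j =>
      net.traffic (S t ω) (x t ω) j - net.service (S t ω) (x t ω) j with hu
    have hub : ∀ j, |u j| ≤ net.deltaMax := abs_traffic_sub_service_le (h.mem_feasible t ω)
    have hsucc : net.queue S x (t + 1) ω = fun j => max (q j + u j) 0 := by
      ext j; rw [queue_succ]; congr 1; simp only [hu, q]; ring
    have h1 := euclNorm_sq_reflect_le (q := q) (u := u) (d := 0) fun j => le_rfl
    have h2 : ∑ j, u j ^ 2 ≤ net.stepBound ^ 2 := by
      rw [← euclNorm_sq]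
      exact pow_le_pow_left₀ (euclNorm_nonneg _)
        ((euclNorm_le_mul hub).trans mul_deltaMax_le_stepBound) 2
    simp only [add_zero, Pi.zero_apply] at h1
    rw [← hsucc] at h1
    have h3 := hctl ω
    have h4 : net.lagrangian V (q + wv) (S t ω) (x t ω) = V * net.cost (S t ω) (x t ω) +
        ∑ j, q j * u j - ∑ j, wv j * (net.service (S t ω) (x t ω) j -
          net.traffic (S t ω) (x t ω) j) := by
      rw [lagrangian, add_sub_assoc, ← sum_sub_distrib]
      congr 1
      exact sum_congr rfl fun j _ => by simp only [hu, Pi.add_apply]; ring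
    rw [h4] at h3
    linarith
  · intro ω
    simp only [mul_add, sum_add_distrib, ← Finset.sum_mul, hdist, hp.2, one_mul]
    rw [← dual_eq_sum V _ hp, add_assoc]
    have := hγ.2 _ (add_nonneg (fun j => queue_nonneg S x t ω j) (placeholder_nonneg γ θ) :
      0 ≤ net.queue S x t ω + wv)
    linarith

/-- Unused service at a queue with a positive placeholder is rare. -/
lemma placeholder_mul_unused_le (h : net.IsAdmissible dist P ℱ S x) (t : ℕ) {ρ θ : ℝ}
    (hρ : 0 < ρ) (γ : Fin r → ℝ) (j : Fin r) :
    placeholder γ θ j * ∫ ω, (net.service (S t ω) (x t ω) j - net.traffic (S t ω) (x t ω) j) ∂P ≤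
      placeholder γ θ j * (∫ ω, net.queue S x t ω j ∂P - ∫ ω, net.queue S x (t + 1) ω j ∂P +
        net.deltaMax * min 1 (Real.exp (-(net.lyapExp ρ * (θ - net.deltaMax))) *
          net.expLyap P S x ρ θ γ t)) := by
  have := h.isProbability
  have hκ := net.lyapExp_pos hρ
  rcases (placeholder_nonneg γ θ j).eq_or_lt with h0 | h0
  · rw [← h0]; simp
  refine mul_le_mul_of_nonneg_left ?_ h0.le
  rw [mul_min_of_nonneg _ _ net.deltaMax_pos.le, ← min_add_add_left]
  have hq : Integrable (fun ω => net.queue S x t ω j - net.queue S x (t + 1) ω j) P :=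
    (h.integrable_queue t j).sub (h.integrable_queue (t + 1) j)
  have hst := (h.integrable_service t j).sub (h.integrable_traffic t j)
  -- With at least `deltaMax` in the queue nothing is clipped and service minus traffic is exactly
  -- the decrease of the backlog; otherwise at most `deltaMax` of service is wasted.
  have hpt : ∀ ω, net.service (S t ω) (x t ω) j - net.traffic (S t ω) (x t ω) j ≤
      net.queue S x t ω j - net.queue S x (t + 1) ω j + net.deltaMax ∧
      (net.deltaMax ≤ net.queue S x t ω j →
        net.service (S t ω) (x t ω) j - net.traffic (S t ω) (x t ω) j ≤
          net.queue S x t ω j - net.queue S x (t + 1) ω j) := by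
    intro ω
    have h1 := abs_le.1 (abs_traffic_sub_service_le (h.mem_feasible t ω) j)
    have h2 := queue_nonneg (net := net) S x t ω j
    rw [queue_succ]
    constructor
    · have := max_le (a := net.queue S x t ω j - net.service (S t ω) (x t ω) j +
        net.traffic (S t ω) (x t ω) j) (b := 0) (c := net.queue S x t ω j -
          net.service (S t ω) (x t ω) j + net.traffic (S t ω) (x t ω) j + net.deltaMax)
        (by linarith [net.deltaMax_pos]) (by linarith)
      linarith
    · intro h3
      rw [max_eq_left (by linarith)]
      linarith
  refine le_min ?_ ?_
  · rw [mul_one, ← integral_sub (h.integrable_queue t j) (h.integrable_queue (t + 1) j)]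
    have h1 : ∫ _ω, net.deltaMax ∂P = net.deltaMax := by simp
    conv_rhs => rw [← h1]
    rw [← integral_add hq (integrable_const _)]
    exact integral_mono hst (hq.add (integrable_const _)) fun ω => (hpt ω).1
  · have hZ := h.integrable_expLyap ρ θ γ t
    rw [expLyap, ← integral_sub (h.integrable_queue t j) (h.integrable_queue (t + 1) j),
      ← integral_const_mul, ← integral_const_mul,
      ← integral_add hq ((hZ.const_mul _).const_mul _)]
    refine integral_mono hst (hq.add ((hZ.const_mul _).const_mul _)) fun ω => ?_
    beta_reduce
    rw [← Real.exp_add]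
    rcases le_total net.deltaMax (net.queue S x t ω j) with h1 | h1
    · refine ((hpt ω).2 h1).trans (le_add_of_nonneg_right ?_)
      exact mul_nonneg net.deltaMax_pos.le (Real.exp_pos _).le
    · refine (hpt ω).1.trans (add_le_add le_rfl ?_)
      refine le_mul_of_one_le_right net.deltaMax_pos.le (Real.one_le_exp ?_)
      have h2 : placeholder γ θ j = γ j - θ := by
        unfold placeholder at h0 ⊢
        exact max_eq_left (by by_contra! hneg; rw [max_eq_right hneg.le] at h0; exact h0.false)
      have h3 := (neg_le_abs _).trans
        (abs_le_euclNorm (net.queue S x t ω + (placeholder γ θ - γ)) j)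
      simp only [Pi.add_apply, Pi.sub_apply, h2] at h3
      have h4 : θ - net.deltaMax ≤ euclNorm (net.queue S x t ω + (placeholder γ θ - γ)) := by
        linarith
      have := mul_le_mul_of_nonneg_left h4 hκ.le
      linarith

/-- Geometric convergence of the exponential Lyapunov function during guided slots. -/
lemma expLyap_le (h : net.IsAdmissible dist P ℱ S x) {V ρ θ : ℝ} (hρ : 0 < ρ) (hθ : 0 ≤ θ)
    {p : Fin M → ℝ} (hp : p ∈ stdSimplex ℝ (Fin M)) {γ : Fin r → ℝ}
    (hγ : net.IsPolyhedralMultiplier V ρ p γ) {t₀ n : ℕ}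
    (hg : ∀ t, t₀ ≤ t → t < t₀ + n → net.IsGuidedSlot dist S x V θ p γ t) {m : ℕ} (hm : m ≤ n) :
    net.expLyap P S x ρ θ γ (t₀ + m) ≤
      (1 - net.lyapExp ρ * ρ / 4) ^ m * net.expLyap P S x ρ θ γ t₀ +
        net.driftConst ρ / (net.lyapExp ρ * ρ / 4) := by
  have hκ := net.lyapExp_pos hρ
  have hκρ := net.lyapExp_mul_le hρ
  refine affine_recursion_le (u := fun m => net.expLyap P S x ρ θ γ (t₀ + m)) (by positivity)
    (by linarith) (net.driftConst_pos ρ).le (n := n) (fun m hm => ?_) hm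
  obtain ⟨h1, h2⟩ := hg (t₀ + m) (by omega) (by omega)
  exact h.exp_drift hρ (h1 ▸ hp) (placeholder_nonneg γ θ) (placeholder_le hγ.1 hθ)
    (h1 ▸ hγ.2) h2

/-- Expected total cost during `n` guided slots. -/
lemma sum_meanCost_le (h : net.IsAdmissible dist P ℱ S x) {V ρ θ : ℝ} (hρ : 0 < ρ) (hθ : 0 ≤ θ)
    {p : Fin M → ℝ} (hp : p ∈ stdSimplex ℝ (Fin M)) {γ : Fin r → ℝ}
    (hγ : net.IsPolyhedralMultiplier V ρ p γ) {t₀ n : ℕ}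
    (hg : ∀ t, t₀ ≤ t → t < t₀ + n → net.IsGuidedSlot dist S x V θ p γ t) {n₀ : ℕ}
    (hn₀ : (1 - net.lyapExp ρ * ρ / 4) ^ n₀ * net.expLyap P S x ρ θ γ t₀ ≤ 1) :
    V * ∑ t ∈ Ico t₀ (t₀ + n), net.meanCost P S x t ≤
      n * (net.stepBound ^ 2 / 2 + net.dual V γ p) + net.sqLyap P S x t₀ / 2 +
      ∑ j, placeholder γ θ j * ∫ ω, net.queue S x t₀ ω j ∂P +
      (∑ j, placeholder γ θ j) * net.deltaMax * (n₀ + n *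
        (Real.exp (-(net.lyapExp ρ * (θ - net.deltaMax))) *
          (1 + net.driftConst ρ / (net.lyapExp ρ * ρ / 4)))) := by
  have hκ := net.lyapExp_pos hρ
  have hκρ := net.lyapExp_mul_le hρ
  set ε₁ := Real.exp (-(net.lyapExp ρ * (θ - net.deltaMax)))
  set β := net.driftConst ρ / (net.lyapExp ρ * ρ / 4)
  have hβ : 0 ≤ β := div_nonneg (net.driftConst_pos ρ).le (by positivity)
  have hε₁ : 0 ≤ ε₁ := (Real.exp_pos _).le
  have hW : 0 ≤ ∑ j, placeholder γ θ j := sum_nonneg fun j _ => placeholder_nonneg γ θ j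
  -- Bound for the frequency of wasted service. The cap at 1 covers the first `n₀` slots, before the
  -- Lyapunov function has mixed.
  set rare : ℕ → ℝ := fun m => min 1 (ε₁ * net.expLyap P S x ρ θ γ (t₀ + m)) with hrare
  have hstep : ∀ m ≤ n, V * ∑ t ∈ Ico t₀ (t₀ + m), net.meanCost P S x t +
      net.sqLyap P S x (t₀ + m) / 2 + ∑ j, placeholder γ θ j *
        ∫ ω, net.queue S x (t₀ + m) ω j ∂P ≤
      m * (net.stepBound ^ 2 / 2 + net.dual V γ p) + net.sqLyap P S x t₀ / 2 +
      ∑ j, placeholder γ θ j * ∫ ω, net.queue S x t₀ ω j ∂P +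
      (∑ j, placeholder γ θ j) * net.deltaMax * ∑ k ∈ range m, rare k := by
    intro m hm
    induction m with
    | zero => simp
    | succ m ih =>
      have h1 := ih (by omega)
      have h2 := h.quadratic_drift hp (hγ.isDualOptimal hρ) (hg (t₀ + m) (by omega) (by omega))
      have h3 := sum_le_sum fun j (_ : j ∈ univ) =>
        h.placeholder_mul_unused_le (t₀ + m) hρ γ j (θ := θ)
      have h4 : ∑ j, placeholder γ θ j * (∫ ω, net.queue S x (t₀ + m) ω j ∂P -
          ∫ ω, net.queue S x (t₀ + m + 1) ω j ∂P + net.deltaMax * rare m) =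
          ∑ j, placeholder γ θ j * ∫ ω, net.queue S x (t₀ + m) ω j ∂P -
          ∑ j, placeholder γ θ j * ∫ ω, net.queue S x (t₀ + m + 1) ω j ∂P +
          (∑ j, placeholder γ θ j) * net.deltaMax * rare m := by
        rw [← sum_sub_distrib, mul_assoc, Finset.sum_mul, ← sum_add_distrib]
        exact sum_congr rfl fun j _ => by ring
      rw [h4] at h3
      rw [sum_range_succ, ← add_assoc, sum_Ico_succ_top (by omega)]
      push_cast
      linarith
  have hrare_le : ∀ m ≤ n, ∑ k ∈ range m, rare k ≤ n₀ + m * (ε₁ * (1 + β)) := by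
    intro m hm
    induction m with
    | zero => simp
    | succ m ih =>
      rcases lt_or_ge m n₀ with hlt | hge
      · have h1 : ∑ k ∈ range (m + 1), rare k ≤ ∑ _k ∈ range (m + 1), (1 : ℝ) :=
          sum_le_sum fun k _ => min_le_left _ _
        simp only [sum_const, card_range, nsmul_eq_mul, mul_one] at h1
        have h2 : ((m + 1 : ℕ) : ℝ) ≤ n₀ := by exact_mod_cast hlt
        refine h1.trans (h2.trans (le_add_of_nonneg_right ?_))
        positivity
      · have h1 := ih (by omega)
        have h2 := h.expLyap_le hρ hθ hp hγ hg (m := m) (by omega)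
        change _ ≤ _ + β at h2
        have h3 : (1 - net.lyapExp ρ * ρ / 4) ^ m ≤ (1 - net.lyapExp ρ * ρ / 4) ^ n₀ :=
          pow_le_pow_of_le_one (by linarith) (by linarith [mul_pos hκ hρ]) hge
        have h4 := mul_le_mul_of_nonneg_right h3 (expLyap_nonneg (net := net) (P := P) (S := S)
          (x := x) ρ θ γ t₀)
        have h5 : rare m ≤ ε₁ * (1 + β) :=
          (min_le_right _ _).trans (mul_le_mul_of_nonneg_left (by linarith) hε₁)
        rw [sum_range_succ]; push_cast; linarith
  have h1 := hstep n le_rfl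
  have h2 := mul_le_mul_of_nonneg_left (hrare_le n le_rfl)
    (mul_nonneg hW net.deltaMax_pos.le)
  have h3 := sqLyap_nonneg (net := net) (P := P) (S := S) (x := x) (t₀ + n)
  have h4 : 0 ≤ ∑ j, placeholder γ θ j * ∫ ω, net.queue S x (t₀ + n) ω j ∂P :=
    sum_nonneg fun j _ => mul_nonneg (placeholder_nonneg γ θ j)
      (integral_nonneg fun ω => queue_nonneg S x _ ω j)
  linarith

end IsAdmissible

end Network

/-! ### Last-in-first-out stacks and Little's argument -/

section Lifo

variable {a m : ℕ → ℝ}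

/-- The drop predicate is constantly false from here on: with zero average error the queues are
never emptied. -/
lemma lifoLeft_succ (t s : ℕ) : lifoLeft a m (fun _ => False) (t + 1) s =
    lifoContent a m (fun _ => False) t s - lifoServed a m (fun _ => False) t s := by
  simp [lifoLeft, lifoServed, lifoContent]

lemma lifoContent_self (t : ℕ) : lifoContent a m (fun _ => False) t t = a t := by
  simp [lifoContent]

lemma lifoContent_of_ne {t s : ℕ} (h : s ≠ t) :
    lifoContent a m (fun _ => False) t s = lifoLeft a m (fun _ => False) t s := by
  simp [lifoContent, h]

lemma lifoServed_nonneg_of {t s : ℕ} (h : 0 ≤ lifoContent a m (fun _ => False) t s) :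
    0 ≤ lifoServed a m (fun _ => False) t s := le_min h (le_max_right _ _)

lemma lifoServed_le_content (t s : ℕ) :
    lifoServed a m (fun _ => False) t s ≤ lifoContent a m (fun _ => False) t s := min_le_left _ _

lemma lifoLeft_nonneg (t s : ℕ) : 0 ≤ lifoLeft a m (fun _ => False) t s := by
  cases t with
  | zero => simp [lifoLeft]
  | succ t => rw [lifoLeft_succ]; exact sub_nonneg.2 (lifoServed_le_content t s)

lemma lifoContent_nonneg (ha : ∀ t, 0 ≤ a t) (t s : ℕ) :
    0 ≤ lifoContent a m (fun _ => False) t s := by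
  rcases eq_or_ne s t with rfl | h
  · rw [lifoContent_self]; exact ha s
  · rw [lifoContent_of_ne h]; exact lifoLeft_nonneg t s

lemma lifoServed_nonneg (ha : ∀ t, 0 ≤ a t) (t s : ℕ) :
    0 ≤ lifoServed a m (fun _ => False) t s := lifoServed_nonneg_of (lifoContent_nonneg ha t s)

lemma lifoLeft_eq_zero {t s : ℕ} (h : t ≤ s) : lifoLeft a m (fun _ => False) t s = 0 := by
  induction t with
  | zero => simp [lifoLeft]
  | succ t ih =>
    have h1 := ih (by omega)
    rw [lifoLeft_succ, lifoServed, lifoContent_of_ne (by omega), h1,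
      min_eq_left (le_max_right _ _), sub_zero]

/-- Total service in a slot, accumulated from the top of the stack. -/
lemma sum_lifoServed (ha : ∀ t, 0 ≤ a t) (hm : ∀ t, 0 ≤ m t) (t : ℕ) {k : ℕ} (hk : k ≤ t + 1) :
    ∑ s ∈ Ico k (t + 1), lifoServed a m (fun _ => False) t s =
      min (∑ s ∈ Ico k (t + 1), lifoContent a m (fun _ => False) t s) (m t) := by
  -- Arrival slots are added from the top of the stack downwards, in the order in which they are
  -- served.
  induction hk using Nat.decreasingInduction with
  | self => simpa using (hm t)
  | of_succ k hk ih =>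
    rw [sum_eq_sum_Ico_succ_bot hk, sum_eq_sum_Ico_succ_bot hk (lifoContent a m _ t), ih]
    have h1 : Ioc k t = Ico (k + 1) (t + 1) := by ext; simp
    have h2 := lifoContent_nonneg (m := m) ha t k
    rw [lifoServed, h1]
    set c := lifoContent a m (fun _ => False) t k
    set C := ∑ s ∈ Ico (k + 1) (t + 1), lifoContent a m (fun _ => False) t s
    rcases le_total (m t - C) 0 with h3 | h3
    · rw [max_eq_right h3, min_eq_right h2, min_eq_right (by linarith), min_eq_right (by linarith),
        zero_add]
    · rw [max_eq_left h3, min_eq_left (show C ≤ m t by linarith)]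
      rcases le_total c (m t - C) with h4 | h4
      · rw [min_eq_left h4, min_eq_left (by linarith)]
      · rw [min_eq_right h4, min_eq_right (by linarith)]; ring

/-- The stack contains the whole backlog. -/
lemma sum_lifoLeft (ha : ∀ t, 0 ≤ a t) (hm : ∀ t, 0 ≤ m t) {q : ℕ → ℝ} (hq0 : q 0 = 0)
    (hq : ∀ t, q (t + 1) = max (q t - m t + a t) 0) (t : ℕ) :
    ∑ s ∈ range t, lifoLeft a m (fun _ => False) t s = q t := by
  induction t with
  | zero => simp [hq0]
  | succ t ih =>
    have h1 := sum_lifoServed ha hm t (Nat.zero_le (t + 1))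
    have h2 : ∑ s ∈ range (t + 1), lifoContent a m (fun _ => False) t s = q t + a t := by
      rw [sum_range_succ, lifoContent_self, ← ih]
      congr 1
      exact sum_congr rfl fun s hs => lifoContent_of_ne (mem_range.1 hs).ne
    rw [← range_eq_Ico, h2] at h1
    simp only [lifoLeft_succ]
    rw [sum_sub_distrib, h1, h2, hq]
    rcases le_total (q t + a t) (m t) with h3 | h3
    · rw [min_eq_left h3, max_eq_right (by linarith), sub_self]
    · rw [min_eq_right h3, max_eq_left (by linarith)]; ring

lemma sum_lifoLeft_le (ha : ∀ t, 0 ≤ a t) (hm : ∀ t, 0 ≤ m t) {q : ℕ → ℝ} (hq0 : q 0 = 0)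
    (hq : ∀ t, q (t + 1) = max (q t - m t + a t) 0) (t T : ℕ) :
    ∑ s ∈ range T, lifoLeft a m (fun _ => False) t s ≤ q t := by
  rw [← sum_lifoLeft ha hm hq0 hq t]
  rcases le_total T t with h | h
  · exact sum_le_sum_of_subset_of_nonneg (range_subset_range.2 h) fun s _ _ => lifoLeft_nonneg t s
  · rw [← sum_range_add_sum_Ico _ h, sum_eq_zero fun s hs => lifoLeft_eq_zero (mem_Ico.1 hs).1,
      add_zero]

lemma sum_lifoServed_delay (s K : ℕ) :
    ∑ k ∈ range (K + 1), lifoServed a m (fun _ => False) (s + k) s =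
      a s - lifoLeft a m (fun _ => False) (s + K + 1) s := by
  induction K with
  | zero => simp [lifoLeft_succ, lifoContent_self]
  | succ K ih =>
    rw [sum_range_succ, ih, lifoLeft_succ (s + (K + 1)) s, lifoContent_of_ne (by omega)]
    rw [← add_assoc]; ring

/-- Summation by parts: traffic of delay `k ≤ K` is present at the start of `k` of the slots `s + 1,
…, s + K`, and traffic not served by then at the start of all `K`. -/
lemma sum_delay_mul_lifoServed (s K : ℕ) :
    ∑ k ∈ range (K + 1), (k : ℝ) * lifoServed a m (fun _ => False) (s + k) s +
      K * (a s - ∑ k ∈ range (K + 1), lifoServed a m (fun _ => False) (s + k) s) =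
      ∑ k ∈ range K, lifoLeft a m (fun _ => False) (s + k + 1) s := by
  induction K with
  | zero => simp
  | succ K ih =>
    rw [sum_range_succ _ (K + 1),
      sum_range_succ (fun k => lifoLeft a m (fun _ => False) (s + k + 1) s) K, ← ih,
      sum_range_succ (fun k => lifoServed a m (fun _ => False) (s + k) s) (K + 1)]
    have h1 := sum_lifoServed_delay (a := a) (m := m) s K
    push_cast
    linear_combination -h1

/-- Little's argument: delays are paid for by backlog. -/
lemma sum_delay_le_sum_backlog (ha : ∀ t, 0 ≤ a t) (hm : ∀ t, 0 ≤ m t) {q : ℕ → ℝ}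
    (hq0 : q 0 = 0) (hq : ∀ t, q (t + 1) = max (q t - m t + a t) 0) (K T : ℕ) :
    ∑ s ∈ range T, (∑ k ∈ range (K + 1), (k : ℝ) * lifoServed a m (fun _ => False) (s + k) s +
      K * (a s - ∑ k ∈ range (K + 1), lifoServed a m (fun _ => False) (s + k) s)) ≤
      ∑ t ∈ range (T + K), q t := by
  calc _ = ∑ s ∈ range T, ∑ k ∈ range K, lifoLeft a m (fun _ => False) (s + k + 1) s :=
        sum_congr rfl fun s _ => sum_delay_mul_lifoServed s K
    _ ≤ ∑ s ∈ range T, ∑ t ∈ range (T + K), lifoLeft a m (fun _ => False) t s := by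
        refine sum_le_sum fun s hs => ?_
        have h1 : ∑ k ∈ range K, lifoLeft a m (fun _ => False) (s + k + 1) s =
            ∑ t ∈ Ico (s + 1) (s + 1 + K), lifoLeft a m (fun _ => False) t s := by
          rw [sum_Ico_eq_sum_range, Nat.add_sub_cancel_left]
          exact sum_congr rfl fun k _ => by rw [add_right_comm]
        rw [h1]
        refine sum_le_sum_of_subset_of_nonneg (fun t ht => ?_) fun t _ _ => lifoLeft_nonneg t s
        have := mem_Ico.1 ht
        have := mem_range.1 hs
        exact mem_range.2 (by omega)
    _ = ∑ t ∈ range (T + K), ∑ s ∈ range T, lifoLeft a m (fun _ => False) t s := sum_comm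
    _ ≤ _ := sum_le_sum fun t _ => sum_lifoLeft_le ha hm hq0 hq t T

variable {Ω : Type*} [MeasurableSpace Ω] {A B : ℕ → Ω → ℝ}

lemma measurable_lifoContent_of {t : ℕ} (hA : ∀ t, Measurable (A t))
    (h : ∀ s, Measurable fun ω => lifoLeft (fun t => A t ω) (fun t => B t ω) (fun _ => False) t s)
    (s : ℕ) : Measurable fun ω =>
      lifoContent (fun t => A t ω) (fun t => B t ω) (fun _ => False) t s := by
  rcases eq_or_ne s t with rfl | hs
  · simpa only [lifoContent_self] using hA s
  · simpa only [lifoContent_of_ne hs] using h s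

lemma measurable_lifoServed_of {t : ℕ} (hB : ∀ t, Measurable (B t))
    (h : ∀ s, Measurable fun ω =>
      lifoContent (fun t => A t ω) (fun t => B t ω) (fun _ => False) t s)
    (s : ℕ) : Measurable fun ω =>
      lifoServed (fun t => A t ω) (fun t => B t ω) (fun _ => False) t s :=
  (h s).min (((hB t).sub (Finset.measurable_sum _ fun u _ => h u)).max measurable_const)

lemma measurable_lifoLeft (hA : ∀ t, Measurable (A t)) (hB : ∀ t, Measurable (B t)) (t s : ℕ) :
    Measurable fun ω => lifoLeft (fun t => A t ω) (fun t => B t ω) (fun _ => False) t s := by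
  induction t generalizing s with
  | zero => exact measurable_const
  | succ t ih =>
    simp only [lifoLeft_succ]
    have h1 := measurable_lifoContent_of hA ih
    exact (h1 s).sub (measurable_lifoServed_of hB h1 s)

lemma measurable_lifoServed (hA : ∀ t, Measurable (A t)) (hB : ∀ t, Measurable (B t)) (t s : ℕ) :
    Measurable fun ω => lifoServed (fun t => A t ω) (fun t => B t ω) (fun _ => False) t s :=
  measurable_lifoServed_of hB (measurable_lifoContent_of hA fun s => measurable_lifoLeft hA hB t s)
    s

end Lifo

/-! ### Perfect prediction: reduction to guided slots -/

section PerfectPrediction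

variable {V c epsd : ℝ} {w : ℕ} {e : ℕ → ℝ}

lemma learningLength_eq_top (h : avgError w e = 0) : (plcParams V c epsd w e).Tl = ⊤ := by
  simp [plcParams, learningLength, h]

lemma plcParams_theta (h : avgError w e = 0) :
    (plcParams V c epsd w e).theta = 2 * Real.log V ^ 2 := by
  simp [plcParams, offset, learningLength, h]

/-- A drop requires a learning window with `T_l = ⊤` elements, but the window is finite. -/
lemma dropsAt_eq_false {M : ℕ} (h : avgError w e = 0) (s : ℕ → Fin M)
    (pred : ℕ → ℕ → Fin M → ℝ) : DropsAt (plcParams V c epsd w e) s pred = fun _ => False := by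
  ext n
  simp [DropsAt, learningLength_eq_top h]

/-- For the same reason the window pointers, and with them the change tests, do not affect the
estimate. -/
lemma adeEstimate_eq {M : ℕ} (h : avgError w e = 0) (s : ℕ → Fin M)
    (pred : ℕ → ℕ → Fin M → ℝ) (t : ℕ) : adeEstimate (plcParams V c epsd w e) s pred t =
      fun i => (∑ k ∈ range (w + 1), pred t k i) / (w + 1) := by
  rw [adeEstimate, learningLength_eq_top h, if_neg (by simp)]
  rfl

lemma eq_of_tvDist_le_zero {M : ℕ} {p p' : Fin M → ℝ} (h : tvDist p p' ≤ 0) : p = p' := by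
  have h1 := (sum_eq_zero_iff_of_nonneg fun i _ => abs_nonneg (p i - p' i)).1
    (le_antisymm h (sum_nonneg fun i _ => abs_nonneg _))
  ext i
  have := abs_eq_zero.1 (h1 i (mem_univ i))
  linarith

end PerfectPrediction

namespace Network

variable {M r : ℕ} {X : Type*} [TopologicalSpace X] {net : Network M r X}
  {dist : ℕ → Fin M → ℝ} {Ω : Type*} [mΩ : MeasurableSpace Ω]
  {P : Measure Ω} {ℱ : Filtration ℕ mΩ} {S : ℕ → Ω → Fin M}
  {pred : Ω → ℕ → ℕ → Fin M → ℝ} {x : ℕ → Ω → X} {γ q : ℕ → Ω → Fin r → ℝ}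
  {V c epsd : ℝ} {w : ℕ} {e : ℕ → ℝ}

namespace IsPLC

lemma backlog_eq (h : net.IsPLC (plcParams V c epsd w e) dist P ℱ S pred x γ q)
    (he : avgError w e = 0) (t : ℕ) (ω : Ω) : q t ω = net.queue S x t ω := by
  induction t with
  | zero => exact (h.path ω).init
  | succ t ih =>
    have h1 := (h.path ω).step t
    rw [dropsAt_eq_false he, if_neg not_false] at h1
    rw [h1, ih]; rfl

/-- Up to lag `w` the error bounds are nonnegative because they bound distances, so a vanishing
average makes each of them vanish. -/
lemma pred_eq (h : net.IsPLC (plcParams V c epsd w e) dist P ℱ S pred x γ q)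
    (he : avgError w e = 0) (ω : Ω) (t : ℕ) {k : ℕ} (hk : k ≤ w) :
    pred ω t k = dist (t + k) := by
  have hpos : ∀ k ≤ w, 0 ≤ e k := fun k hk =>
    (sum_nonneg fun i _ => abs_nonneg _ : 0 ≤ tvDist (pred ω t k) (dist (t + k))).trans
      (h.pred_error ω t k hk)
  have h1 : ∑ k ∈ range (w + 1), e k = 0 := by
    have : (w : ℝ) + 1 ≠ 0 := by positivity
    rw [avgError, div_eq_zero_iff] at he
    exact he.resolve_right this
  have h2 := (sum_eq_zero_iff_of_nonneg fun k hk =>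
    hpos k (Nat.lt_succ_iff.1 (mem_range.1 hk))).1 h1 k (mem_range.2 (Nat.lt_succ_of_le hk))
  exact eq_of_tvDist_le_zero ((h.pred_error ω t k hk).trans h2.le)

/-- The whole prediction window must lie under one law. The estimate is then `p`, its only maximizer
is `γs`, and the control step is minimization of the Lagrangian with the sign reversed. -/
lemma isGuidedSlot (h : net.IsPLC (plcParams V c epsd w e) dist P ℱ S pred x γ q)
    (he : avgError w e = 0) {ρ : ℝ} (hρ : 0 < ρ) {p : Fin M → ℝ} {γs : Fin r → ℝ}
    (hγs : net.IsPolyhedralMultiplier V ρ p γs) {t : ℕ} (hd : ∀ k ≤ w, dist (t + k) = p) :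
    net.IsGuidedSlot dist S x V (2 * Real.log V ^ 2) p γs t := by
  refine ⟨by simpa using hd 0 (Nat.zero_le _), fun ω => ?_⟩
  have hest : adeEstimate (plcParams V c epsd w e) (fun t => S t ω) (pred ω) t = p := by
    rw [adeEstimate_eq he]
    ext i
    have h1 : ∑ k ∈ range (w + 1), pred ω t k i = ∑ _k ∈ range (w + 1), p i :=
      sum_congr rfl fun k hk => by
        have hk' := Nat.lt_succ_iff.1 (mem_range.1 hk)
        rw [h.pred_eq he ω t hk', hd k hk']
    rw [h1, sum_const, card_range, nsmul_eq_mul]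
    have : (w : ℝ) + 1 ≠ 0 := by positivity
    push_cast
    field_simp
  have hγ : γ t ω = γs := by
    have h1 := (h.path ω).learning t
    rw [hest] at h1
    rcases h1 with h1 | ⟨h1, -⟩
    · exact hγs.eq_of_isDualOptimal hρ h1
    · exact absurd (hγs.isDualOptimal hρ) (h1 γs)
  have hctl := (h.path ω).control t
  refine le_ciInf fun y => ?_
  have h1 := hctl y.2
  simp only [Set.mem_ofPred_eq] at h1
  rw [hγ, h.backlog_eq he, plcParams_theta he] at h1
  have h2 : ∀ y : X, net.lagrangian V (net.queue S x t ω + placeholder γs (2 * Real.log V ^ 2))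
      (S t ω) y = -(-V * net.cost (S t ω) y + ∑ j, (net.queue S x t ω j +
        max (γs j - 2 * Real.log V ^ 2) 0) * (net.service (S t ω) y j -
          net.traffic (S t ω) y j)) := by
    intro y
    rw [lagrangian, neg_add, ← sum_neg_distrib]
    congr 1
    · ring
    · exact sum_congr rfl fun j _ => by simp only [placeholder, Pi.add_apply]; ring
  rw [h2, h2]
  exact neg_le_neg h1

/-- Little's argument in expectation. -/
lemma delayWithin_add_le (h : net.IsPLC (plcParams V c epsd w e) dist P ℱ S pred x γ q)
    (he : avgError w e = 0) (J : Finset (Fin r)) (K T : ℕ) :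
    net.delayWithin (plcParams V c epsd w e) P S pred x J K T + K * (net.trafficUpTo P S x J T -
      net.servedWithin (plcParams V c epsd w e) P S pred x J K T) ≤
        ∑ t ∈ range (T + K), ∑ j, ∫ ω, net.queue S x t ω j ∂P ∧
    0 ≤ net.delayWithin (plcParams V c epsd w e) P S pred x J K T ∧
    net.servedWithin (plcParams V c epsd w e) P S pred x J K T ≤ net.trafficUpTo P S x J T := by
  have hadm := h.admissible
  have := hadm.isProbability
  set A : Fin r → ℕ → Ω → ℝ := fun j t ω => net.traffic (S t ω) (x t ω) j with hA
  set B : Fin r → ℕ → Ω → ℝ := fun j t ω => net.service (S t ω) (x t ω) j with hB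
  have hA0 : ∀ j ω t, 0 ≤ A j t ω := fun j ω t => net.traffic_nonneg _ _ (hadm.mem_feasible t ω) j
  have hB0 : ∀ j ω t, 0 ≤ B j t ω := fun j ω t => net.service_nonneg _ _ (hadm.mem_feasible t ω) j
  have hAm : ∀ j t, Measurable (A j t) := fun j t =>
    (hadm.measurable_traffic t j).mono (ℱ.le _) le_rfl
  have hBm : ∀ j t, Measurable (B j t) := fun j t =>
    (hadm.measurable_service t j).mono (ℱ.le _) le_rfl
  have hAi : ∀ j t, Integrable (A j t) P := fun j t => hadm.integrable_traffic t j
  set L : Fin r → ℕ → ℕ → Ω → ℝ := fun j s k ω =>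
    lifoServed (fun t => A j t ω) (fun t => B j t ω) (fun _ => False) (s + k) s with hL
  have hserved : ∀ j s k, net.servedAfter (plcParams V c epsd w e) P S pred x j s k =
      ∫ ω, L j s k ω ∂P := by
    intro j s k
    simp only [servedAfter, dropsAt_eq_false he]
    rfl
  have hL0 : ∀ j s k ω, 0 ≤ L j s k ω := fun j s k ω => lifoServed_nonneg (hA0 j ω) _ _
  have hLsum : ∀ j s K ω, ∑ k ∈ range (K + 1), L j s k ω ≤ A j s ω := by
    intro j s K ω
    simp only [hL]
    rw [sum_lifoServed_delay]
    exact sub_le_self _ (lifoLeft_nonneg _ _)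
  have hLi : ∀ j s k, Integrable (L j s k) P := fun j s k =>
    (hAi j s).mono' (measurable_lifoServed (hAm j) (hBm j) _ _).aestronglyMeasurable
      (Eventually.of_forall fun ω => by
        rw [Real.norm_eq_abs, abs_of_nonneg (hL0 j s k ω)]
        exact (single_le_sum (f := fun k => L j s k ω) (fun k _ => hL0 j s k ω)
          (mem_range.2 (Nat.lt_succ_self k))).trans (hLsum j s k ω))
  have hLK : ∀ j s, Integrable (fun ω => ∑ k ∈ range (K + 1), L j s k ω) P := fun j s =>
    integrable_finsetSum _ fun k _ => hLi j s k
  refine ⟨?_, ?_, ?_⟩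
  · have hpath : ∀ j, ∑ s ∈ range T, (∑ k ∈ range (K + 1), (k : ℝ) * ∫ ω, L j s k ω ∂P +
        K * (∫ ω, A j s ω ∂P - ∑ k ∈ range (K + 1), ∫ ω, L j s k ω ∂P)) ≤
        ∑ t ∈ range (T + K), ∫ ω, net.queue S x t ω j ∂P := by
      intro j
      have hi1 : ∀ s, Integrable (fun ω => ∑ k ∈ range (K + 1), (k : ℝ) * L j s k ω) P := fun s =>
        integrable_finsetSum _ fun k _ => (hLi j s k).const_mul _
      have hi2 : ∀ s, Integrable (fun ω => A j s ω - ∑ k ∈ range (K + 1), L j s k ω) P := fun s =>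
        (hAi j s).sub (hLK j s)
      have hi3 : ∀ s, Integrable (fun ω => ∑ k ∈ range (K + 1), (k : ℝ) * L j s k ω +
          K * (A j s ω - ∑ k ∈ range (K + 1), L j s k ω)) P := fun s =>
        (hi1 s).add ((hi2 s).const_mul _)
      have h1 : ∀ s, ∑ k ∈ range (K + 1), (k : ℝ) * ∫ ω, L j s k ω ∂P +
          K * (∫ ω, A j s ω ∂P - ∑ k ∈ range (K + 1), ∫ ω, L j s k ω ∂P) =
          ∫ ω, (∑ k ∈ range (K + 1), (k : ℝ) * L j s k ω +
            K * (A j s ω - ∑ k ∈ range (K + 1), L j s k ω)) ∂P := by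
        intro s
        rw [integral_add (hi1 s) ((hi2 s).const_mul _), integral_const_mul,
          integral_sub (hAi j s) (hLK j s), integral_finsetSum _ fun k _ => hLi j s k,
          integral_finsetSum _ fun k _ => (hLi j s k).const_mul _]
        simp only [integral_const_mul]
      simp only [h1]
      rw [← integral_finsetSum _ fun s _ => hi3 s,
        ← integral_finsetSum _ fun t _ => hadm.integrable_queue t j]
      refine integral_mono (integrable_finsetSum _ fun s _ => hi3 s)
        (integrable_finsetSum _ fun t _ => hadm.integrable_queue t j) fun ω => ?_
      exact sum_delay_le_sum_backlog (hA0 j ω) (hB0 j ω) (q := fun t => net.queue S x t ω j) rfl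
        (fun t => queue_succ S x t ω j) K T
    simp only [delayWithin, trafficUpTo, servedWithin, hserved]
    calc _ = ∑ j ∈ J, ∑ s ∈ range T, (∑ k ∈ range (K + 1), (k : ℝ) * ∫ ω, L j s k ω ∂P +
          K * (∫ ω, A j s ω ∂P - ∑ k ∈ range (K + 1), ∫ ω, L j s k ω ∂P)) := by
          simp only [sum_add_distrib, ← Finset.mul_sum, sum_sub_distrib, hA]
      _ ≤ ∑ j ∈ J, ∑ t ∈ range (T + K), ∫ ω, net.queue S x t ω j ∂P :=
          sum_le_sum fun j _ => hpath j
      _ ≤ ∑ j, ∑ t ∈ range (T + K), ∫ ω, net.queue S x t ω j ∂P :=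
          sum_le_sum_of_subset_of_nonneg (subset_univ J) fun j _ _ =>
            sum_nonneg fun t _ => integral_nonneg fun ω => queue_nonneg S x t ω j
      _ = _ := sum_comm
  · simp only [delayWithin, hserved]
    exact sum_nonneg fun j _ => sum_nonneg fun s _ => sum_nonneg fun k _ =>
      mul_nonneg (Nat.cast_nonneg _) (integral_nonneg fun ω => hL0 j s k ω)
  · simp only [trafficUpTo, servedWithin, hserved]
    refine sum_le_sum fun j _ => sum_le_sum fun s _ => ?_
    rw [← integral_finsetSum _ fun k _ => hLi j s k]
    exact integral_mono (hLK j s) (hAi j s) fun ω => hLsum j s K ω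

end IsPLC

end Network

/-! ### The stationary system -/

namespace Network

variable {M r : ℕ} {X : Type*} [TopologicalSpace X] {net : Network M r X}

lemma IsPolyhedral.exists_multiplier {V ρ : ℝ} {p : Fin M → ℝ} (h : net.IsPolyhedral V p ρ) :
    ∃ γ, net.IsPolyhedralMultiplier V ρ p γ := by
  obtain ⟨γ, hγ, hpoly⟩ := h
  exact ⟨γ, hγ.1, hpoly⟩

variable (net) in
/-- Stationary bound for the exponential Lyapunov function. -/
def lyapBound (ρ : ℝ) : ℝ := net.driftConst ρ / (net.lyapExp ρ * ρ / 4)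

variable (net) in
/-- Constant of the logarithmic backlog bound. -/
def backlogConst (ρ : ℝ) : ℝ := r / net.lyapExp ρ * (2 + net.lyapBound ρ) + 2 * r

variable (net) in
/-- Constant of the cost bound. -/
def costConst (ρ η : ℝ) : ℝ := net.stepBound ^ 2 / 2 + 2 * net.deltaMax ^ 2 / η *
  (1 + Real.exp (net.lyapExp ρ * net.deltaMax) * (1 + net.lyapBound ρ))

lemma lyapBound_pos {ρ : ℝ} (hρ : 0 < ρ) : 0 < net.lyapBound ρ :=
  div_pos (net.driftConst_pos ρ) (by have := net.lyapExp_pos hρ; positivity)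

lemma backlogConst_nonneg {ρ : ℝ} (hρ : 0 < ρ) : 0 ≤ net.backlogConst ρ := by
  have := net.lyapExp_pos hρ
  have := net.lyapBound_pos hρ
  unfold backlogConst; positivity

lemma costConst_pos {ρ η : ℝ} (hρ : 0 < ρ) (hη : 0 < η) : 0 < net.costConst ρ η := by
  have := net.lyapExp_pos hρ
  have := net.lyapBound_pos hρ
  have := net.stepBound_pos
  unfold costConst; positivity

/-- Unused service has superpolynomially small probability. -/
lemma exp_neg_offset_le {V κ δ : ℝ} (hV : 0 < V) (hL : 1 ≤ Real.log V)
    (hκL : 1 ≤ 2 * κ * Real.log V) :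
    Real.exp (-(κ * (2 * Real.log V ^ 2 - δ))) ≤ Real.exp (κ * δ) / V := by
  have h1 : Real.exp (κ * δ) / V = Real.exp (κ * δ - Real.log V) := by
    rw [Real.exp_sub, Real.exp_log hV]
  rw [h1]
  refine Real.exp_le_exp.2 ?_
  -- The square in `θ` is what beats the fixed exponent `κ`: multiplying by `log V` gives `κ θ ≥ log
  -- V`.
  have := mul_le_mul_of_nonneg_right hκL (by linarith : 0 ≤ Real.log V)
  nlinarith

lemma exists_pow_mul_le_one {a Z : ℝ} (ha1 : a < 1) (hZ : 0 ≤ Z) :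
    ∃ n : ℕ, a ^ n * Z ≤ 1 := by
  obtain ⟨n, hn⟩ := exists_pow_lt_of_lt_one (show 0 < 1 / (Z + 1) by positivity) ha1
  refine ⟨n, ?_⟩
  have h1 := mul_le_mul_of_nonneg_right hn.le hZ
  have h2 : 1 / (Z + 1) * Z ≤ 1 := by
    rw [div_mul_eq_mul_div, one_mul, div_le_one (by linarith)]; linarith
  linarith

variable {dist : ℕ → Fin M → ℝ} {Ω : Type*} [mΩ : MeasurableSpace Ω]
  {P : Measure Ω} {ℱ : Filtration ℕ mΩ} {S : ℕ → Ω → Fin M}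
  {pred : Ω → ℕ → ℕ → Fin M → ℝ} {x : ℕ → Ω → X} {γ q : ℕ → Ω → Fin r → ℝ}
  {V c epsd : ℝ} {w : ℕ} {e : ℕ → ℝ}

lemma sum_placeholder_le {p : Fin M → ℝ} (hV : 0 ≤ V) (hp : p ∈ stdSimplex ℝ (Fin M))
    {ε η : ℝ} (hε : 0 ≤ ε) (hη : 0 < η) (hs : net.HasSlack p ε η) {γs : Fin r → ℝ}
    (hγ : net.IsDualOptimal V p γs) {θ : ℝ} (hθ : 0 ≤ θ) :
    ∑ j, placeholder γs θ j ≤ 2 * net.deltaMax / η * V :=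
  (sum_le_sum fun j _ => placeholder_le hγ.1 hθ j).trans (hγ.sum_le hV hp hε hη hs)

/-- A backlog exceeds its coordinate of the shifted vector by at most `θ`, and `y ≤ exp(κ y) / κ`
trades the norm for the Lyapunov function. -/
lemma IsAdmissible.sum_queue_le (h : net.IsAdmissible dist P ℱ S x) {ρ θ : ℝ} (hρ : 0 < ρ)
    (hθ : 0 ≤ θ) {γs : Fin r → ℝ} (hγ : 0 ≤ γs) (t : ℕ) :
    ∑ j, ∫ ω, net.queue S x t ω j ∂P ≤
      r / net.lyapExp ρ * net.expLyap P S x ρ θ γs t + r * θ := by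
  have := h.isProbability
  have hκ := net.lyapExp_pos hρ
  have hZ := (h.integrable_expLyap ρ θ γs t).const_mul (r / net.lyapExp ρ)
  have h1 : ∫ _ω, r * θ ∂P = r * θ := by simp
  rw [expLyap, ← integral_const_mul, ← integral_finsetSum _ fun j _ => h.integrable_queue t j]
  conv_rhs => rw [← h1]
  rw [← integral_add hZ (integrable_const _)]
  refine integral_mono (integrable_finsetSum _ fun j _ => h.integrable_queue t j)
    (hZ.add (integrable_const _)) fun ω => ?_
  set Y := euclNorm (net.queue S x t ω + (placeholder γs θ - γs)) with hY
  have h2 : ∑ j, net.queue S x t ω j ≤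
      ∑ j, (|(net.queue S x t ω + (placeholder γs θ - γs)) j| + θ) := by
    refine sum_le_sum fun j _ => ?_
    have h3 := (abs_le.1 (abs_placeholder_sub_le hγ hθ j)).1
    have h4 := le_abs_self ((net.queue S x t ω + (placeholder γs θ - γs)) j)
    rw [Pi.add_apply] at h4 ⊢
    linarith
  rw [sum_add_distrib] at h2
  have h3 := sum_abs_le_euclNorm (net.queue S x t ω + (placeholder γs θ - γs))
  have h4 : Y ≤ Real.exp (net.lyapExp ρ * Y) / net.lyapExp ρ := by
    rw [le_div_iff₀ hκ]
    linarith [Real.add_one_le_exp (net.lyapExp ρ * Y)]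
  have h5 := mul_le_mul_of_nonneg_left h4 (Nat.cast_nonneg r : (0 : ℝ) ≤ r)
  have h6 : (r : ℝ) * (Real.exp (net.lyapExp ρ * Y) / net.lyapExp ρ) =
      r / net.lyapExp ρ * Real.exp (net.lyapExp ρ * Y) := by ring
  simp only [sum_const, card_univ, Fintype.card_fin, nsmul_eq_mul] at h2
  linarith

namespace IsPLC

variable {p : Fin M → ℝ} {ρ η ε : ℝ} {γs : Fin r → ℝ}

/-- Time-average backlog in a stationary system. -/
lemma eventually_sum_queue_le
    (h : net.IsPLC (plcParams V c epsd w e) (fun _ => p) P ℱ S pred x γ q)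
    (he : avgError w e = 0) (hρ : 0 < ρ) (hp : p ∈ stdSimplex ℝ (Fin M))
    (hγs : net.IsPolyhedralMultiplier V ρ p γs) (hL : 1 ≤ Real.log V) :
    ∀ᶠ T : ℕ in atTop, ∑ t ∈ range T, ∑ j, ∫ ω, net.queue S x t ω j ∂P ≤
      net.backlogConst ρ * Real.log V ^ 2 * T := by
  have hadm := h.admissible
  have hκ := net.lyapExp_pos hρ
  have hκρ := net.lyapExp_mul_le hρ
  have hβ := net.lyapBound_pos hρ
  set θ := 2 * Real.log V ^ 2 with hθdef
  have hθ : 0 ≤ θ := by positivity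
  set Z := fun t => net.expLyap P S x ρ θ γs t
  have hZ0 : ∀ t, 0 ≤ Z t := fun t => expLyap_nonneg ρ θ γs t
  have hZ : ∀ t, Z t ≤ (1 - net.lyapExp ρ * ρ / 4) ^ t * Z 0 + net.lyapBound ρ := by
    intro t
    have := hadm.expLyap_le hρ hθ hp hγs (t₀ := 0) (n := t)
      (fun t _ _ => h.isGuidedSlot he hρ hγs fun _ _ => rfl) le_rfl
    rw [zero_add] at this
    exact this
  have ha0 : 0 ≤ 1 - net.lyapExp ρ * ρ / 4 := by linarith
  have ha1 : 1 - net.lyapExp ρ * ρ / 4 < 1 := by linarith [mul_pos hκ hρ]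
  -- The initial value may grow with `V`: the `n₀` slots of mixing affect only the time from which
  -- the bound holds.
  obtain ⟨n₀, hn₀⟩ := exists_pow_mul_le_one ha1 (hZ0 0)
  have hsumZ : ∀ T : ℕ, ∑ t ∈ range T, Z t ≤ n₀ * Z 0 + T * (1 + net.lyapBound ρ) := by
    intro T
    induction T with
    | zero => simpa using mul_nonneg (Nat.cast_nonneg n₀) (hZ0 0)
    | succ T ih =>
      rcases lt_or_ge T n₀ with hlt | hge
      · have h1 : ∑ t ∈ range (T + 1), Z t ≤ ∑ t ∈ range (T + 1), (Z 0 + net.lyapBound ρ) :=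
          sum_le_sum fun t _ => (hZ t).trans (add_le_add
            (mul_le_of_le_one_left (hZ0 0) (pow_le_one₀ ha0 ha1.le)) le_rfl)
        simp only [sum_const, card_range, nsmul_eq_mul] at h1
        have h2 : ((T + 1 : ℕ) : ℝ) ≤ n₀ := by exact_mod_cast hlt
        have h3 := mul_le_mul_of_nonneg_right h2 (hZ0 0)
        have h4 : (0 : ℝ) ≤ ((T + 1 : ℕ) : ℝ) := Nat.cast_nonneg _
        linarith
      · have h1 := hZ T
        have h2 := mul_le_mul_of_nonneg_right (pow_le_pow_of_le_one ha0 ha1.le hge) (hZ0 0)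
        rw [sum_range_succ]; push_cast; linarith
  have hlarge : ∀ᶠ T : ℕ in atTop, n₀ * Z 0 ≤ T :=
    tendsto_natCast_atTop_atTop.eventually_ge_atTop _
  filter_upwards [hlarge] with T hT
  have h1 : ∑ t ∈ range T, ∑ j, ∫ ω, net.queue S x t ω j ∂P ≤
      ∑ t ∈ range T, (r / net.lyapExp ρ * Z t + r * θ) :=
    sum_le_sum fun t _ => hadm.sum_queue_le hρ hθ hγs.1 t
  rw [sum_add_distrib, ← Finset.mul_sum, sum_const, card_range, nsmul_eq_mul] at h1
  have hrκ : 0 ≤ r / net.lyapExp ρ := by positivity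
  have h2 := mul_le_mul_of_nonneg_left ((hsumZ T).trans (add_le_add_left hT _)) hrκ
  have h3 : 1 ≤ Real.log V ^ 2 := one_le_pow₀ hL
  have h4 : r / net.lyapExp ρ * (2 + net.lyapBound ρ) * T ≤
      r / net.lyapExp ρ * (2 + net.lyapBound ρ) * T * Real.log V ^ 2 :=
    le_mul_of_one_le_right (by positivity) h3
  calc _ ≤ r / net.lyapExp ρ * (2 + net.lyapBound ρ) * T + T * (r * θ) := by linarith
    _ ≤ r / net.lyapExp ρ * (2 + net.lyapBound ρ) * T * Real.log V ^ 2 + T * (r * θ) := by linarith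
    _ = _ := by rw [hθdef, backlogConst]; ring

/-- Below, weak duality applies because the backlog bound certifies stability. Above, wasted service
of frequency `O(1/V)` is weighted by placeholders of total `O(V)`, a constant per slot before
division by `V`. -/
lemma abs_avgCost_sub_le
    (h : net.IsPLC (plcParams V c epsd w e) (fun _ => p) P ℱ S pred x γ q)
    (he : avgError w e = 0) (hρ : 0 < ρ) (hp : p ∈ stdSimplex ℝ (Fin M))
    (hγs : net.IsPolyhedralMultiplier V ρ p γs) (hε : 0 ≤ ε) (hη : 0 < η)
    (hs : net.HasSlack p ε η) (hV : 0 < V) (hL : 1 ≤ Real.log V)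
    (hκL : 1 ≤ 2 * net.lyapExp ρ * Real.log V) :
    |net.avgCost P S x - net.optimalCost p| ≤ net.costConst ρ η / V := by
  have hadm := h.admissible
  have hopt := hγs.isDualOptimal hρ
  have hκ := net.lyapExp_pos hρ
  have hκρ := net.lyapExp_mul_le hρ
  have hβ := net.lyapBound_pos hρ
  have hδ := net.deltaMax_pos
  rw [hopt.optimalCost_eq hV hp hε hη hs]
  have hlow : net.dual V γs p / V ≤ net.avgCost P S x := by
    refine hadm.dual_div_le_avgCost hp hV hγs.1
      ⟨net.backlogConst ρ * Real.log V ^ 2, eventually_map.2 ?_⟩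
    filter_upwards [h.eventually_sum_queue_le he hρ hp hγs hL, eventually_gt_atTop 0] with T hT hT0
    have : (0 : ℝ) < T := by exact_mod_cast hT0
    rwa [div_le_iff₀ this]
  have hup : net.avgCost P S x ≤ net.dual V γs p / V + net.costConst ρ η / V := by
    refine limsup_le_of_le hadm.isCoboundedUnder_timeAverage ?_
    have hθ : 0 ≤ 2 * Real.log V ^ 2 := by positivity
    obtain ⟨n₀, hn₀⟩ := exists_pow_mul_le_one (a := 1 - net.lyapExp ρ * ρ / 4)
      (by linarith [mul_pos hκ hρ]) (expLyap_nonneg (net := net) (P := P) (S := S) (x := x)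
        ρ (2 * Real.log V ^ 2) γs 0)
    -- From this time on the mixing slots are at most a fraction `1/V` of all slots.
    have hlarge : ∀ᶠ T : ℕ in atTop, V * n₀ ≤ T :=
      tendsto_natCast_atTop_atTop.eventually_ge_atTop _
    filter_upwards [hlarge, eventually_gt_atTop 0] with T hT hT0
    have hTpos : (0 : ℝ) < T := by exact_mod_cast hT0
    have h1 := hadm.sum_meanCost_le hρ hθ hp hγs (t₀ := 0) (n := T)
      (fun t _ _ => h.isGuidedSlot he hρ hγs fun _ _ => rfl) hn₀
    have hsq0 : net.sqLyap P S x 0 = 0 := by simp [sqLyap, backlog, euclNorm]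
    have hq0 : ∀ j, ∫ ω, net.queue S x 0 ω j ∂P = 0 := by simp [backlog]
    simp only [zero_add, ← range_eq_Ico, hsq0, hq0, mul_zero, sum_const_zero, zero_div,
      add_zero] at h1
    change _ ≤ _ + _ * (_ + _ * (_ * (1 + net.lyapBound ρ))) at h1
    have h2 := sum_placeholder_le hV.le hp hε hη hs hopt hθ
    have h3 := exp_neg_offset_le (δ := net.deltaMax) hV hL hκL
    set ε₁ := Real.exp (-(net.lyapExp ρ * (2 * Real.log V ^ 2 - net.deltaMax)))
    set E := Real.exp (net.lyapExp ρ * net.deltaMax)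
    have hn₀T : (n₀ : ℝ) ≤ T / V := by rw [le_div_iff₀ hV]; linarith
    have h4 : n₀ + T * (ε₁ * (1 + net.lyapBound ρ)) ≤
        T / V * (1 + E * (1 + net.lyapBound ρ)) := by
      have h5 := mul_le_mul_of_nonneg_left (mul_le_mul_of_nonneg_right h3
        (by linarith : 0 ≤ 1 + net.lyapBound ρ)) hTpos.le
      calc _ ≤ T / V + T * (E / V * (1 + net.lyapBound ρ)) := add_le_add hn₀T h5
        _ = _ := by ring
    have h6 : (∑ j, placeholder γs (2 * Real.log V ^ 2) j) * net.deltaMax *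
        (n₀ + T * (ε₁ * (1 + net.lyapBound ρ))) ≤ 2 * net.deltaMax / η * V * net.deltaMax *
          (T / V * (1 + E * (1 + net.lyapBound ρ))) := by
      refine mul_le_mul (mul_le_mul_of_nonneg_right h2 hδ.le) h4 ?_ (by positivity)
      positivity
    have h7 : 2 * net.deltaMax / η * V * net.deltaMax *
          (T / V * (1 + E * (1 + net.lyapBound ρ))) =
        T * (2 * net.deltaMax ^ 2 / η * (1 + E * (1 + net.lyapBound ρ))) := by
      field_simp
    rw [← add_div, div_le_div_iff₀ hTpos hV]
    unfold costConst
    linarith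
  rw [abs_le]
  have := div_pos (net.costConst_pos hρ hη) hV
  constructor <;> linarith

lemma exists_delay_bound
    (h : net.IsPLC (plcParams V c epsd w e) (fun _ => p) P ℱ S pred x γ q)
    (he : avgError w e = 0) (hρ : 0 < ρ) (hp : p ∈ stdSimplex ℝ (Fin M))
    (hγs : net.IsPolyhedralMultiplier V ρ p γs) (hV : 0 < V) (hL : 1 ≤ Real.log V) {C : ℝ}
    (hC : 4 * net.backlogConst ρ ≤ C) (hCpos : 0 < C)
    (J : Finset (Fin r)) {lam : ℝ} (hlam : 0 < lam)
    (hT : ∀ᶠ T : ℕ in atTop, lam * T ≤ net.trafficUpTo P S x J T) :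
    ∃ K : ℕ, ∀ᶠ T : ℕ in atTop,
      net.trafficUpTo P S x J T -
          net.servedWithin (plcParams V c epsd w e) P S pred x J K T ≤
        C / (lam * V) * net.trafficUpTo P S x J T ∧
      net.delayWithin (plcParams V c epsd w e) P S pred x J K T ≤
        C / lam * Real.log V ^ 2 *
          net.servedWithin (plcParams V c epsd w e) P S pred x J K T := by
  have hB := net.backlogConst_nonneg hρ
  have hL2 : 0 < Real.log V ^ 2 := by positivity
  set L2 := Real.log V ^ 2
  -- The first bound makes the traffic slower than `K` a fraction `O(1/(lam V))`. The second ensures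
  -- that at least `lam T / 2` is served in time, so that the total delay can be charged to served
  -- traffic.
  obtain ⟨K, hK⟩ := exists_nat_ge (max (V * L2) (C * L2 / lam))
  have hK1 : V * L2 ≤ K := (le_max_left _ _).trans hK
  have hK2 : C * L2 / lam ≤ K := (le_max_right _ _).trans hK
  rw [div_le_iff₀ hlam] at hK2
  have hKpos : (0 : ℝ) < K := lt_of_lt_of_le (by positivity) hK1
  refine ⟨K, ?_⟩
  filter_upwards [hT, (tendsto_add_atTop_nat K).eventually
    (h.eventually_sum_queue_le he hρ hp hγs hL), eventually_ge_atTop K] with T hT1 hT2 hT3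
  obtain ⟨h1, h2, h3⟩ := h.delayWithin_add_le he J K T
  set tr := net.trafficUpTo P S x J T
  set se := net.servedWithin (plcParams V c epsd w e) P S pred x J K T
  set de := net.delayWithin (plcParams V c epsd w e) P S pred x J K T
  have hT3' : (K : ℝ) ≤ T := by exact_mod_cast hT3
  have hTpos : (0 : ℝ) < T := lt_of_lt_of_le hKpos hT3'
  have h4 : de + K * (tr - se) ≤ C / 2 * L2 * T := by
    refine h1.trans (hT2.trans ?_)
    push_cast
    have h5 : net.backlogConst ρ * L2 * (T + K) ≤ net.backlogConst ρ * L2 * (2 * T) :=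
      mul_le_mul_of_nonneg_left (by linarith) (by positivity)
    have h6 : net.backlogConst ρ * L2 * (2 * T) ≤ C / 4 * L2 * (2 * T) :=
      mul_le_mul_of_nonneg_right (mul_le_mul_of_nonneg_right (by linarith) hL2.le)
        (by linarith)
    linarith
  have h5 : K * (tr - se) ≤ C / 2 * L2 * T := by linarith
  have h6 : de ≤ C / 2 * L2 * T := by
    have := mul_nonneg hKpos.le (sub_nonneg.2 h3)
    linarith
  have htr : 0 < tr := lt_of_lt_of_le (mul_pos hlam hTpos) hT1
  constructor
  · have h7 : V * L2 * (tr - se) ≤ C / 2 * L2 * T :=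
      (mul_le_mul_of_nonneg_right hK1 (sub_nonneg.2 h3)).trans h5
    have h8 : V * (tr - se) ≤ C / 2 * T := by
      refine le_of_mul_le_mul_left ?_ hL2
      linarith
    rw [div_mul_eq_mul_div, le_div_iff₀ (by positivity)]
    have h9 := mul_le_mul_of_nonneg_left h8 hlam.le
    have h10 := mul_le_mul_of_nonneg_left hT1 hCpos.le
    have h11 := mul_pos hCpos (mul_pos hlam hTpos)
    linarith
  · have h7 : C * L2 * (tr - se) ≤ C * L2 * (lam * T / 2) := by
      have := mul_le_mul_of_nonneg_right hK2 (sub_nonneg.2 h3)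
      have := mul_le_mul_of_nonneg_right h5 hlam.le
      linarith
    have h8 : tr - se ≤ lam * T / 2 := le_of_mul_le_mul_left h7 (by positivity)
    have h9 : lam * T / 2 ≤ se := by linarith
    refine h6.trans ?_
    have h10 := mul_le_mul_of_nonneg_left h9 (show 0 ≤ C / lam * L2 by positivity)
    have h11 : C / lam * L2 * (lam * T / 2) = C / 2 * L2 * T := by field_simp
    linarith

end IsPLC

end Network

/-! ### Exponential moments of the backlog across change points -/

namespace Network

variable {M r : ℕ} {X : Type*} [TopologicalSpace X] {net : Network M r X}
  {dist : ℕ → Fin M → ℝ} {Ω : Type*} [mΩ : MeasurableSpace Ω]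
  {P : Measure Ω} {ℱ : Filtration ℕ mΩ} {S : ℕ → Ω → Fin M}
  {pred : Ω → ℕ → ℕ → Fin M → ℝ} {x : ℕ → Ω → X} {γ q : ℕ → Ω → Fin r → ℝ}
  {V c epsd ρ : ℝ} {w : ℕ} {e : ℕ → ℝ}

variable (net) in
/-- Exponential moment of the backlog. -/
def expMoment (P : Measure Ω) (S : ℕ → Ω → Fin M) (x : ℕ → Ω → X) (ρ : ℝ) (t : ℕ) : ℝ :=
  ∫ ω, Real.exp (net.lyapExp ρ * euclNorm (net.queue S x t ω)) ∂P

lemma euclNorm_placeholder_sub_le {γs : Fin r → ℝ} (hγ : 0 ≤ γs) {θ : ℝ} (hθ : 0 ≤ θ) :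
    euclNorm (placeholder γs θ - γs) ≤ r * θ :=
  euclNorm_le_mul fun j => abs_placeholder_sub_le hγ hθ j

namespace IsAdmissible

lemma integrable_expMoment (h : net.IsAdmissible dist P ℱ S x) (ρ : ℝ) (t : ℕ) :
    Integrable (fun ω => Real.exp (net.lyapExp ρ * euclNorm (net.queue S x t ω))) P :=
  h.integrable_continuous_comp_queue t (φ := fun v => Real.exp (net.lyapExp ρ * euclNorm v))
    (Real.continuous_exp.comp (continuous_const.mul continuous_euclNorm))

lemma integrable_euclNorm (h : net.IsAdmissible dist P ℱ S x) (t : ℕ) :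
    Integrable (fun ω => euclNorm (net.queue S x t ω)) P :=
  h.integrable_continuous_comp_queue t continuous_euclNorm

lemma euclNorm_queue_add_le (h : net.IsAdmissible dist P ℱ S x) (t w : ℕ) (ω : Ω) :
    euclNorm (net.queue S x (t + w) ω) ≤ euclNorm (net.queue S x t ω) + w * net.stepBound := by
  induction w with
  | zero => simp
  | succ w ih =>
    have h1 : euclNorm (net.queue S x (t + w + 1) ω - net.queue S x (t + w) ω) ≤ net.stepBound :=
      (euclNorm_le_mul fun j => h.abs_queue_succ_sub_le (t + w) ω j).trans
        mul_deltaMax_le_stepBound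
    have h2 := (le_abs_self _).trans
      (abs_euclNorm_sub_le (net.queue S x (t + w + 1) ω) (net.queue S x (t + w) ω))
    rw [← add_assoc]; push_cast; linarith

/-- The Lyapunov function of any multiplier is centred within `r θ` of the origin. Passing through
the multiplier-free `expMoment` thus compares two intervals at a cost independent of how far their
multipliers are apart. -/
lemma expLyap_le_expMoment (h : net.IsAdmissible dist P ℱ S x) (hρ : 0 < ρ) {θ : ℝ} (hθ : 0 ≤ θ)
    {γs : Fin r → ℝ} (hγ : 0 ≤ γs) (t : ℕ) : net.expLyap P S x ρ θ γs t ≤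
      Real.exp (net.lyapExp ρ * (r * θ)) * net.expMoment P S x ρ t := by
  have hκ := net.lyapExp_pos hρ
  rw [expLyap, expMoment, ← integral_const_mul]
  refine integral_mono (h.integrable_expLyap ρ θ γs t) ((h.integrable_expMoment ρ t).const_mul _)
    fun ω => ?_
  beta_reduce
  rw [← Real.exp_add, ← mul_add]
  refine Real.exp_le_exp.2 (mul_le_mul_of_nonneg_left ?_ hκ.le)
  have h1 := euclNorm_add_le (net.queue S x t ω) (placeholder γs θ - γs)
  have h2 := euclNorm_placeholder_sub_le hγ hθ
  linarith

/-- The extra `w` slots are meant for the end of an interval, where predictions mix two laws and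
only the bounded step size is available. -/
lemma expMoment_le_expLyap (h : net.IsAdmissible dist P ℱ S x) (hρ : 0 < ρ) {θ : ℝ} (hθ : 0 ≤ θ)
    {γs : Fin r → ℝ} (hγ : 0 ≤ γs) (t w : ℕ) : net.expMoment P S x ρ (t + w) ≤
      Real.exp (net.lyapExp ρ * (r * θ + w * net.stepBound)) * net.expLyap P S x ρ θ γs t := by
  have hκ := net.lyapExp_pos hρ
  rw [expLyap, expMoment, ← integral_const_mul]
  refine integral_mono (h.integrable_expMoment ρ (t + w))
    ((h.integrable_expLyap ρ θ γs t).const_mul _) fun ω => ?_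
  beta_reduce
  rw [← Real.exp_add, ← mul_add]
  refine Real.exp_le_exp.2 (mul_le_mul_of_nonneg_left ?_ hκ.le)
  have h1 := h.euclNorm_queue_add_le t w ω
  have h2 := euclNorm_placeholder_sub_le hγ hθ
  have h3 := euclNorm_add_le (net.queue S x t ω + (placeholder γs θ - γs))
    (-(placeholder γs θ - γs))
  rw [add_neg_cancel_right, euclNorm_neg] at h3
  linarith

/-- Moment bounds from an exponential moment. -/
lemma moments_of_expMoment_le (h : net.IsAdmissible dist P ℱ S x) (hρ : 0 < ρ) {t : ℕ} {l : ℝ}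
    (hl : 0 ≤ l) (hN : net.expMoment P S x ρ t ≤ Real.exp l) :
    ∫ ω, euclNorm (net.queue S x t ω) ∂P ≤ l / net.lyapExp ρ ∧
      net.sqLyap P S x t ≤ (2 * l ^ 2 + 4) / net.lyapExp ρ ^ 2 := by
  have := h.isProbability
  have hκ := net.lyapExp_pos hρ
  have hE := (h.integrable_expMoment ρ t).const_mul (Real.exp (-l))
  have hE1 : ∫ ω, Real.exp (-l) * Real.exp (net.lyapExp ρ * euclNorm (net.queue S x t ω)) ∂P ≤
      1 := by
    rw [integral_const_mul]
    have := mul_le_mul_of_nonneg_left hN (Real.exp_pos (-l)).le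
    rwa [← Real.exp_add, neg_add_cancel, Real.exp_zero] at this
  constructor
  · rw [le_div_iff₀ hκ, mul_comm, ← integral_const_mul]
    -- Jensen's inequality in tangent-line form, `y ≤ l - 1 + exp(y - l)`.
    have h1 : ∫ ω, net.lyapExp ρ * euclNorm (net.queue S x t ω) ∂P ≤
        ∫ ω, (l - 1 + Real.exp (-l) *
          Real.exp (net.lyapExp ρ * euclNorm (net.queue S x t ω))) ∂P := by
      refine integral_mono ((h.integrable_euclNorm t).const_mul _)
        ((integrable_const _).add hE) fun ω => ?_
      beta_reduce
      rw [← Real.exp_add]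
      linarith [Real.add_one_le_exp (-l + net.lyapExp ρ * euclNorm (net.queue S x t ω))]
    rw [integral_add (integrable_const _) hE] at h1
    simp only [integral_const, probReal_univ, one_smul] at h1
    linarith
  · rw [le_div_iff₀ (pow_pos hκ 2), mul_comm, sqLyap]
    have h1 : ∫ ω, net.lyapExp ρ ^ 2 * euclNorm (net.queue S x t ω) ^ 2 ∂P ≤
        ∫ ω, (2 * l ^ 2 + 4 * (Real.exp (-l) *
          Real.exp (net.lyapExp ρ * euclNorm (net.queue S x t ω)))) ∂P := by
      refine integral_mono ((h.integrable_sqLyap t).const_mul _)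
        ((integrable_const _).add (hE.const_mul 4)) fun ω => ?_
      beta_reduce
      rw [← Real.exp_add, ← mul_pow]
      have hy : 0 ≤ net.lyapExp ρ * euclNorm (net.queue S x t ω) :=
        mul_nonneg hκ.le (euclNorm_nonneg _)
      set y := net.lyapExp ρ * euclNorm (net.queue S x t ω)
      have hpos := Real.exp_pos (-l + y)
      rcases le_total y l with h2 | h2
      · nlinarith
      · have h3 := Real.quadratic_le_exp_of_nonneg (show 0 ≤ -l + y by linarith)
        nlinarith [sq_nonneg (y - 2 * l)]
    rw [integral_add (integrable_const _) (hE.const_mul 4), integral_const_mul,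
      integral_const_mul 4] at h1
    simp only [integral_const, probReal_univ, one_smul] at h1
    linarith

lemma integral_queue_le_integral_euclNorm (h : net.IsAdmissible dist P ℱ S x) (t : ℕ) (j : Fin r) :
    ∫ ω, net.queue S x t ω j ∂P ≤ ∫ ω, euclNorm (net.queue S x t ω) ∂P :=
  integral_mono (h.integrable_queue t j) (h.integrable_euclNorm t) fun _ =>
    (le_abs_self _).trans (abs_le_euclNorm _ j)

end IsAdmissible

variable (net) in
/-- `V` is large enough for the piecewise stationary analysis. -/
structure IsLarge (ρ epsd ε V : ℝ) : Prop where
  one_le : 1 ≤ V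
  one_le_log : 1 ≤ Real.log V
  log_exp : 1 ≤ 2 * net.lyapExp ρ * Real.log V
  two_le : 2 ≤ Real.log V ^ 2
  step : 4 * net.lyapExp ρ * net.stepBound ≤ net.lyapExp ρ * ρ / 4 * Real.log V ^ 2
  detect : 4 * net.lyapExp ρ * r + 1 ≤ net.lyapExp ρ * ρ / 4 / 4 * (Real.log V ^ 3 / epsd ^ 2)
  growth : Real.log V ^ 6 ≤ V ^ ε

lemma eventually_isLarge (hρ : 0 < ρ) {epsd ε : ℝ} (hepsd : 0 < epsd) (hε : 0 < ε) :
    ∀ᶠ V in atTop, net.IsLarge ρ epsd ε V := by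
  have hκ := net.lyapExp_pos hρ
  have hlog := Real.tendsto_log_atTop
  have hpow : ∀ n : ℕ, n ≠ 0 → Tendsto (fun V => Real.log V ^ n) atTop atTop := fun n hn =>
    (tendsto_pow_atTop hn).comp hlog
  have h6 : ∀ᶠ V : ℝ in atTop, Real.log V ^ 6 ≤ V ^ ε := by
    have := (isLittleO_log_rpow_rpow_atTop (s := ε) 6 hε).bound one_pos
    filter_upwards [this, eventually_gt_atTop 1] with V hV hV1
    have h1 : 0 ≤ Real.log V := Real.log_nonneg hV1.le
    have h2 : 0 ≤ V ^ ε := Real.rpow_nonneg (by linarith) _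
    rw [one_mul, Real.norm_eq_abs, Real.norm_eq_abs, abs_of_nonneg h2,
      abs_of_nonneg (Real.rpow_nonneg h1 _)] at hV
    rw [← Real.rpow_natCast]
    exact_mod_cast hV
  filter_upwards [eventually_ge_atTop 1, hlog.eventually_ge_atTop 1,
    (hlog.const_mul_atTop (show 0 < 2 * net.lyapExp ρ by positivity)).eventually_ge_atTop 1,
    (hpow 2 two_ne_zero).eventually_ge_atTop 2,
    ((hpow 2 two_ne_zero).const_mul_atTop
      (show 0 < net.lyapExp ρ * ρ / 4 by positivity)).eventually_ge_atTop
      (4 * net.lyapExp ρ * net.stepBound),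
    (((hpow 3 three_ne_zero).atTop_div_const (pow_pos hepsd 2)).const_mul_atTop
      (show 0 < net.lyapExp ρ * ρ / 4 / 4 by positivity)).eventually_ge_atTop
      (4 * net.lyapExp ρ * r + 1), h6] with V h1 h2 h3 h4 h5 h7 h8
  exact ⟨h1, h2, h3, h4, h5, h7, h8⟩

variable (net) in
/-- Constant of the exponential moment bound at the change points. -/
def momentConst (ρ epsd : ℝ) : ℝ := Real.log (2 * (net.lyapBound ρ + 1)) +
  net.lyapExp ρ * (2 * r + (1 / epsd ^ 2 + 1) * net.stepBound)

lemma momentConst_nonneg (hρ : 0 < ρ) : 0 ≤ net.momentConst ρ epsd := by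
  have h1 := net.lyapBound_pos hρ
  have h2 := net.lyapExp_pos hρ
  have h3 := net.stepBound_pos
  have : 0 ≤ Real.log (2 * (net.lyapBound ρ + 1)) := Real.log_nonneg (by linarith)
  unfold momentConst; positivity

namespace IsLarge

variable {ε : ℝ}

lemma d_le (hV : net.IsLarge ρ epsd ε V) :
    ((plcParams V c epsd w e).d : ℝ) ≤ (1 / epsd ^ 2 + 1) * Real.log V ^ 3 := by
  have h1 : 1 ≤ Real.log V ^ 3 := one_le_pow₀ hV.one_le_log
  have h2 := (Nat.ceil_lt_add_one (show 0 ≤ Real.log V ^ 3 / epsd ^ 2 by positivity)).le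
  have h3 : Real.log V ^ 3 / epsd ^ 2 = 1 / epsd ^ 2 * Real.log V ^ 3 := by ring
  change ((⌈Real.log V ^ 3 / epsd ^ 2⌉₊ : ℕ) : ℝ) ≤ _
  linarith

/-- During a stationary interval the Lyapunov function contracts by more than the growth of the
backlog in its last slots. -/
lemma contraction (hV : net.IsLarge ρ epsd ε V) (hρ : 0 < ρ) {n : ℕ}
    (hw : w + 1 ≤ (plcParams V c epsd w e).d)
    (hn : ((plcParams V c epsd w e).d : ℝ) * Real.log V ^ 2 ≤ n + w) :
    Real.exp (net.lyapExp ρ * (r * (2 * Real.log V ^ 2) + w * net.stepBound)) *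
      ((1 - net.lyapExp ρ * ρ / 4) ^ n * Real.exp (net.lyapExp ρ * (r * (2 * Real.log V ^ 2)))) ≤
      1 / 2 := by
  have hκ := net.lyapExp_pos hρ
  have hκρ := net.lyapExp_mul_le hρ
  have hD := net.stepBound_pos
  set κ := net.lyapExp ρ
  set D := net.stepBound
  set α := κ * ρ / 4 with hαdef
  have hα : 0 < α := by positivity
  set L := Real.log V
  have hL : 1 ≤ L := hV.one_le_log
  have hd : L ^ 3 / epsd ^ 2 ≤ ((plcParams V c epsd w e).d : ℝ) := Nat.le_ceil _
  have hwd : (w : ℝ) + 1 ≤ ((plcParams V c epsd w e).d : ℝ) := by exact_mod_cast hw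
  set d : ℝ := ((plcParams V c epsd w e).d : ℝ)
  have h1 : (1 - α) ^ n ≤ Real.exp (-(α * n)) := by
    have := pow_le_pow_left₀ (by linarith) (Real.one_sub_le_exp_neg α) n
    rwa [← Real.exp_nat_mul, mul_neg, mul_comm] at this
  -- Since `w < d`, the guided slots number at least `d (L² - 1) ≥ d L² / 2`. Of the resulting
  -- exponent, one half pays through `step` for the growth in `w` slots, the other through `detect`
  -- for the two changes of centre and the final `-1`.
  have h2 : κ * (r * (2 * L ^ 2) + w * D) + (-(α * n) + κ * (r * (2 * L ^ 2))) ≤ -1 := by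
    have hd0 : 0 ≤ d := by have := Nat.cast_nonneg (α := ℝ) w; linarith
    have hL2 : 1 ≤ L ^ 2 := one_le_pow₀ hL
    have h3 : d * (L ^ 2 - 1) ≤ n := by linarith
    have h4 : α * (d * (L ^ 2 - 1)) ≤ α * n := mul_le_mul_of_nonneg_left h3 hα.le
    have h5 : κ * (w * D) ≤ κ * D * d := by
      have := mul_le_mul_of_nonneg_left (show (w : ℝ) ≤ d by linarith) (mul_pos hκ hD).le
      linarith
    have h6 : d * (4 * κ * D) ≤ d * (α * L ^ 2) := mul_le_mul_of_nonneg_left hV.step hd0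
    have h7 : (4 * κ * r + 1) * L ^ 2 ≤ α / 4 * (L ^ 3 / epsd ^ 2) * L ^ 2 :=
      mul_le_mul_of_nonneg_right hV.detect (by linarith)
    have h8 : α / 4 * (L ^ 3 / epsd ^ 2) * L ^ 2 ≤ α / 4 * d * L ^ 2 :=
      mul_le_mul_of_nonneg_right (mul_le_mul_of_nonneg_left hd (by positivity)) (by linarith)
    have h9 : α * d * (L ^ 2 / 2) ≤ α * d * (L ^ 2 - 1) :=
      mul_le_mul_of_nonneg_left (by linarith [hV.two_le]) (by positivity)
    nlinarith
  calc _ ≤ Real.exp (κ * (r * (2 * L ^ 2) + w * D)) *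
        (Real.exp (-(α * n)) * Real.exp (κ * (r * (2 * L ^ 2)))) := by gcongr
    _ = Real.exp (κ * (r * (2 * L ^ 2) + w * D) + (-(α * n) + κ * (r * (2 * L ^ 2)))) := by
        rw [Real.exp_add, Real.exp_add]
    _ ≤ Real.exp (-1) := Real.exp_le_exp.2 h2
    _ ≤ 1 / 2 := by
        rw [Real.exp_neg, one_div]
        exact inv_anti₀ two_pos (by linarith [Real.add_one_le_exp (1 : ℝ)])

/-- The third power of the logarithm is that of `d > w`, which limits the growth in unguided slots;
the offset contributes only the second power. -/
lemma exp_momentConst (hV : net.IsLarge ρ epsd ε V) (hρ : 0 < ρ)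
    (hw : w + 1 ≤ (plcParams V c epsd w e).d) :
    2 * (net.lyapBound ρ + 1) *
      Real.exp (net.lyapExp ρ * (r * (2 * Real.log V ^ 2) + w * net.stepBound)) ≤
      Real.exp (net.momentConst ρ epsd * Real.log V ^ 3) := by
  have hκ := net.lyapExp_pos hρ
  have hD := net.stepBound_pos
  have hβ := net.lyapBound_pos hρ
  have hL := hV.one_le_log
  have hwd : (w : ℝ) + 1 ≤ ((plcParams V c epsd w e).d : ℝ) := by exact_mod_cast hw
  have hd := hV.d_le (c := c) (w := w) (e := e)
  rw [← Real.exp_log (show 0 < 2 * (net.lyapBound ρ + 1) by linarith), ← Real.exp_add]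
  refine Real.exp_le_exp.2 ?_
  have h1 : 1 ≤ Real.log V ^ 3 := one_le_pow₀ hL
  have h2 : Real.log V ^ 2 ≤ Real.log V ^ 3 := pow_le_pow_right₀ hL (by norm_num)
  have h3 : 0 ≤ Real.log (2 * (net.lyapBound ρ + 1)) := Real.log_nonneg (by linarith)
  have h4 : r * (2 * Real.log V ^ 2) + w * net.stepBound ≤
      (2 * r + (1 / epsd ^ 2 + 1) * net.stepBound) * Real.log V ^ 3 := by
    have h5 := mul_le_mul_of_nonneg_left h2 (show (0 : ℝ) ≤ 2 * r by positivity)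
    have h6 := mul_le_mul_of_nonneg_right (show (w : ℝ) ≤ (1 / epsd ^ 2 + 1) * Real.log V ^ 3 by
      linarith) hD.le
    linarith
  have h5 := mul_le_mul_of_nonneg_left h4 hκ.le
  have h6 := le_mul_of_one_le_right h3 h1
  rw [momentConst, add_mul]
  linarith

end IsLarge

end Network

/-! ### The piecewise stationary system -/

namespace Network

variable {M r : ℕ} {X : Type*} [TopologicalSpace X] {net : Network M r X}
  {dist : ℕ → Fin M → ℝ} {Ω : Type*} [mΩ : MeasurableSpace Ω]
  {P : Measure Ω} {ℱ : Filtration ℕ mΩ} {S : ℕ → Ω → Fin M}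
  {pred : Ω → ℕ → ℕ → Fin M → ℝ} {x : ℕ → Ω → X} {γ q : ℕ → Ω → Fin r → ℝ}
  {V c epsd ρ η ε : ℝ} {w : ℕ} {e : ℕ → ℝ} {p : ℕ → Fin M → ℝ} {τ : ℕ → ℕ}

variable (net) in
/-- The state distribution is constant on long intervals, with polyhedral, slack distributions. -/
structure IsPiecewiseStationary (par : PLCParams) (ρ η : ℝ) (p : ℕ → Fin M → ℝ) (τ : ℕ → ℕ)
    (dist : ℕ → Fin M → ℝ) : Prop where
  zero : τ 0 = 0
  length : ∀ k, (par.d : ℝ) * Real.log par.V ^ 2 ≤ (τ (k + 1) : ℝ) - τ k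
  dist_eq : ∀ k t, τ k ≤ t → t < τ (k + 1) → dist t = p k
  mem : ∀ k, p k ∈ stdSimplex ℝ (Fin M)
  slack : ∀ k, ∃ ε' > 0, net.HasSlack (p k) ε' η
  polyhedral : ∀ k, net.IsPolyhedral par.V (p k) ρ

namespace IsPiecewiseStationary

/-- The interval is split into `n` guided slots, whose prediction windows stay inside it, and `w`
final slots; `w + 1 ≤ d` leaves room for the latter. -/
lemma exists_length (hs : net.IsPiecewiseStationary (plcParams V c epsd w e) ρ η p τ dist)
    (hL : 1 ≤ Real.log V) (hw : w + 1 ≤ (plcParams V c epsd w e).d) (k : ℕ) :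
    ∃ n : ℕ, τ (k + 1) = τ k + n + w ∧
      ((plcParams V c epsd w e).d : ℝ) * Real.log V ^ 2 ≤ n + w := by
  have h1 := hs.length k
  change _ * Real.log V ^ 2 ≤ _ at h1
  have h2 : ((plcParams V c epsd w e).d : ℝ) ≤
      ((plcParams V c epsd w e).d : ℝ) * Real.log V ^ 2 :=
    le_mul_of_one_le_right (Nat.cast_nonneg _) (one_le_pow₀ hL)
  have h3 : (w : ℝ) + 1 ≤ ((plcParams V c epsd w e).d : ℝ) := by exact_mod_cast hw
  have h4 : ((τ k + w : ℕ) : ℝ) ≤ τ (k + 1) := by push_cast; linarith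
  have h5 : τ k + w ≤ τ (k + 1) := by exact_mod_cast h4
  refine ⟨τ (k + 1) - (τ k + w), by omega, ?_⟩
  rw [Nat.cast_sub h5]
  push_cast
  linarith

lemma guided (hs : net.IsPiecewiseStationary (plcParams V c epsd w e) ρ η p τ dist)
    (h : net.IsPLC (plcParams V c epsd w e) dist P ℱ S pred x γ q)
    (he : avgError w e = 0) (hρ : 0 < ρ) {k n : ℕ} (hn : τ (k + 1) = τ k + n + w)
    {γs : Fin r → ℝ} (hγs : net.IsPolyhedralMultiplier V ρ (p k) γs) :
    ∀ t, τ k ≤ t → t < τ k + n →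
      net.IsGuidedSlot dist S x V (2 * Real.log V ^ 2) (p k) γs t := fun t h1 h2 =>
  h.isGuidedSlot he hρ hγs fun j hj => hs.dist_eq k (t + j) (by omega) (by omega)

/-- Exponential moment of the backlog at the change points. -/
lemma expMoment_le (hs : net.IsPiecewiseStationary (plcParams V c epsd w e) ρ η p τ dist)
    (h : net.IsPLC (plcParams V c epsd w e) dist P ℱ S pred x γ q)
    (he : avgError w e = 0) (hρ : 0 < ρ) (hV : net.IsLarge ρ epsd ε V)
    (hw : w + 1 ≤ (plcParams V c epsd w e).d) (k : ℕ) :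
    net.expMoment P S x ρ (τ k) ≤ Real.exp (net.momentConst ρ epsd * Real.log V ^ 3) := by
  have hadm := h.admissible
  have := hadm.isProbability
  have hβ := net.lyapBound_pos hρ
  have hκρ := net.lyapExp_mul_le hρ
  have hκ := net.lyapExp_pos hρ
  set θ := 2 * Real.log V ^ 2 with hθdef
  have hθ : 0 ≤ θ := by positivity
  set G := Real.exp (net.lyapExp ρ * (r * θ + w * net.stepBound)) with hG
  have hGpos : 0 < G := Real.exp_pos _
  -- With `β = lyapBound`, an interval acts on the moment as `N ↦ N/2 + G β`, which preserves the
  -- bound `2 (β + 1) G`.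
  refine le_trans ?_ (hV.exp_momentConst hρ hw)
  rw [← hG]
  induction k with
  | zero =>
    have h1 : net.expMoment P S x ρ (τ 0) = 1 := by
      rw [hs.zero]; simp [expMoment, backlog, euclNorm]
    have h2 : 1 ≤ G := Real.one_le_exp (by
      have := net.stepBound_pos
      positivity)
    rw [h1]
    nlinarith
  | succ k ih =>
    obtain ⟨n, hn, hlen⟩ := hs.exists_length hV.one_le_log hw k
    obtain ⟨γs, hγs⟩ := (hs.polyhedral k).exists_multiplier
    have h1 := hadm.expLyap_le hρ hθ (hs.mem k) hγs (hs.guided h he hρ hn hγs) le_rfl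
    change _ ≤ _ + net.lyapBound ρ at h1
    have h2 := hadm.expLyap_le_expMoment hρ hθ hγs.1 (τ k)
    have h3 := hadm.expMoment_le_expLyap hρ hθ hγs.1 (τ k + n) w
    rw [← hn, ← hG] at h3
    have h4 := hV.contraction hρ hw hlen
    rw [← hθdef, ← hG] at h4
    set a := (1 - net.lyapExp ρ * ρ / 4) ^ n
    have ha : 0 ≤ a := pow_nonneg (by linarith) _
    have hN : 0 ≤ net.expMoment P S x ρ (τ k) := integral_nonneg fun _ => (Real.exp_pos _).le
    calc _ ≤ G * (a * (Real.exp (net.lyapExp ρ * (r * θ)) * net.expMoment P S x ρ (τ k)) +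
          net.lyapBound ρ) :=
          h3.trans (mul_le_mul_of_nonneg_left
            (h1.trans (add_le_add_left (mul_le_mul_of_nonneg_left h2 ha) _)) hGpos.le)
      _ = G * (a * Real.exp (net.lyapExp ρ * (r * θ))) * net.expMoment P S x ρ (τ k) +
          G * net.lyapBound ρ := by ring
      _ ≤ 1 / 2 * net.expMoment P S x ρ (τ k) + G * net.lyapBound ρ :=
          add_le_add_left (mul_le_mul_of_nonneg_right h4 hN) _
      _ ≤ _ := by linarith

lemma sum_queue_le (hs : net.IsPiecewiseStationary (plcParams V c epsd w e) ρ η p τ dist)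
    (h : net.IsPLC (plcParams V c epsd w e) dist P ℱ S pred x γ q)
    (he : avgError w e = 0) (hρ : 0 < ρ) (hV : net.IsLarge ρ epsd ε V)
    (hw : w + 1 ≤ (plcParams V c epsd w e).d) (k : ℕ) :
    ∑ j, ∫ ω, net.queue S x (τ k) ω j ∂P ≤
      r * (net.momentConst ρ epsd / net.lyapExp ρ) * Real.log V ^ 4 := by
  have hadm := h.admissible
  have hκ := net.lyapExp_pos hρ
  have hA := net.momentConst_nonneg (epsd := epsd) hρ
  have hL := hV.one_le_log
  have h1 := (hadm.moments_of_expMoment_le hρ (by positivity)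
    (hs.expMoment_le h he hρ hV hw k)).1
  have h2 : Real.log V ^ 3 ≤ Real.log V ^ 4 := pow_le_pow_right₀ hL (by norm_num)
  have h3 := sum_le_sum fun j (_ : j ∈ univ) =>
    (hadm.integral_queue_le_integral_euclNorm (τ k) j).trans h1
  simp only [sum_const, card_univ, Fintype.card_fin, nsmul_eq_mul] at h3
  refine h3.trans ?_
  calc _ = r * (net.momentConst ρ epsd / net.lyapExp ρ) * Real.log V ^ 3 := by ring
    _ ≤ _ := mul_le_mul_of_nonneg_left h2 (by positivity)

end IsPiecewiseStationary

variable (net) in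
/-- Constant of the transient costs in an interval. -/
def transientConst (ρ η epsd : ℝ) : ℝ :=
  (net.momentConst ρ epsd ^ 2 + 2) / net.lyapExp ρ ^ 2 +
  2 * net.deltaMax / η * (net.momentConst ρ epsd / net.lyapExp ρ) +
  2 * net.deltaMax / η * net.deltaMax *
    ((4 * net.lyapExp ρ * r + net.momentConst ρ epsd) / (net.lyapExp ρ * ρ / 4) + 1) +
  2 * net.deltaMax * (1 / epsd ^ 2 + 1)

namespace IsPiecewiseStationary

/-- The cost of a long interval exceeds the dual optimum by a bounded amount per slot. -/
lemma sum_meanCost_le (hs : net.IsPiecewiseStationary (plcParams V c epsd w e) ρ η p τ dist)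
    (h : net.IsPLC (plcParams V c epsd w e) dist P ℱ S pred x γ q)
    (he : avgError w e = 0) (hρ : 0 < ρ) (hη : 0 < η) (hV : net.IsLarge ρ epsd ε V)
    (hw : w + 1 ≤ (plcParams V c epsd w e).d) {k : ℕ} {γs : Fin r → ℝ}
    (hγs : net.IsPolyhedralMultiplier V ρ (p k) γs) :
    V * ∑ t ∈ Ico (τ k) (τ (k + 1)), net.meanCost P S x t ≤
      ((τ (k + 1) : ℝ) - τ k) * (net.costConst ρ η + net.dual V γs (p k)) +
        net.transientConst ρ η epsd * (V * Real.log V ^ 6) := by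
  have hadm := h.admissible
  have hκ := net.lyapExp_pos hρ
  have hκρ := net.lyapExp_mul_le hρ
  have hβ := net.lyapBound_pos hρ
  have hδ := net.deltaMax_pos
  have hA := net.momentConst_nonneg (epsd := epsd) hρ
  have hL := hV.one_le_log
  have hV1 := hV.one_le
  have hVpos : 0 < V := by linarith
  obtain ⟨n, hn, hlen⟩ := hs.exists_length hL hw k
  obtain ⟨ε', hε', hslack⟩ := hs.slack k
  have hopt := hγs.isDualOptimal hρ
  have hθ : 0 ≤ 2 * Real.log V ^ 2 := by positivity
  have hguided := hs.guided h he hρ hn hγs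
  have hmom := hs.expMoment_le h he hρ hV hw k
  obtain ⟨hm1, hm2⟩ := hadm.moments_of_expMoment_le hρ (by positivity) hmom
  set κ := net.lyapExp ρ
  set α := κ * ρ / 4 with hα
  have hαpos : 0 < α := by positivity
  set A := net.momentConst ρ epsd
  set L := Real.log V
  -- Mixing time: `α n₀` has to exceed the logarithm of the initial Lyapunov value, at most `2 κ r
  -- L² + A L³`. It is allowed to be longer than the interval.
  set n₀ := ⌈(4 * κ * r + A) * L ^ 3 / α⌉₊ with hn₀
  have hL3 : 1 ≤ L ^ 3 := one_le_pow₀ hL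
  have hL23 : L ^ 2 ≤ L ^ 3 := pow_le_pow_right₀ hL (by norm_num)
  have hL36 : L ^ 3 ≤ L ^ 6 := pow_le_pow_right₀ hL (by norm_num)
  have hn₀le : (n₀ : ℝ) ≤ ((4 * κ * r + A) / α + 1) * L ^ 3 := by
    have h1 := (Nat.ceil_lt_add_one (show 0 ≤ (4 * κ * r + A) * L ^ 3 / α by positivity)).le
    have h2 : (4 * κ * r + A) * L ^ 3 / α = (4 * κ * r + A) / α * L ^ 3 := by ring
    rw [← hn₀] at h1
    linarith
  have hmix : (1 - α) ^ n₀ * net.expLyap P S x ρ (2 * L ^ 2) γs (τ k) ≤ 1 := by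
    have h1 : (1 - α) ^ n₀ ≤ Real.exp (-(α * n₀)) := by
      have := pow_le_pow_left₀ (by linarith) (Real.one_sub_le_exp_neg α) n₀
      rwa [← Real.exp_nat_mul, mul_neg, mul_comm] at this
    have h2 := (hadm.expLyap_le_expMoment hρ hθ hγs.1 (τ k)).trans
      (mul_le_mul_of_nonneg_left hmom (Real.exp_pos _).le)
    have h3 : (4 * κ * r + A) * L ^ 3 ≤ α * n₀ := by
      have := Nat.le_ceil ((4 * κ * r + A) * L ^ 3 / α)
      rw [div_le_iff₀ hαpos, ← hn₀] at this
      linarith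
    calc _ ≤ Real.exp (-(α * n₀)) * (Real.exp (κ * (r * (2 * L ^ 2))) * Real.exp (A * L ^ 3)) :=
          mul_le_mul h1 h2 (expLyap_nonneg _ _ _ _) (Real.exp_pos _).le
      _ = Real.exp (-(α * n₀) + (κ * (r * (2 * L ^ 2)) + A * L ^ 3)) := by
          rw [Real.exp_add, Real.exp_add]
      _ ≤ 1 := by
          rw [Real.exp_le_one_iff]
          have h4 : κ * r * L ^ 2 ≤ κ * r * L ^ 3 := mul_le_mul_of_nonneg_left hL23 (by positivity)
          have h5 : 0 ≤ κ * r * L ^ 3 := by positivity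
          linarith
  have hmain := hadm.sum_meanCost_le hρ hθ (hs.mem k) hγs hguided hmix
  change _ ≤ _ + _ * (_ + _ * (_ * (1 + net.lyapBound ρ))) at hmain
  have hW := sum_placeholder_le hVpos.le (hs.mem k) hε'.le hη hslack hopt hθ
  have hW0 : 0 ≤ ∑ j, placeholder γs (2 * L ^ 2) j := sum_nonneg fun j _ => placeholder_nonneg _ _ j
  have hq : ∑ j, placeholder γs (2 * L ^ 2) j * ∫ ω, net.queue S x (τ k) ω j ∂P ≤
      2 * net.deltaMax / η * (A / κ) * (V * L ^ 3) := by
    calc _ ≤ ∑ j, placeholder γs (2 * L ^ 2) j * (A * L ^ 3 / κ) :=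
          sum_le_sum fun j _ => mul_le_mul_of_nonneg_left
            ((hadm.integral_queue_le_integral_euclNorm (τ k) j).trans hm1)
            (placeholder_nonneg _ _ j)
      _ = (∑ j, placeholder γs (2 * L ^ 2) j) * (A * L ^ 3 / κ) := by rw [Finset.sum_mul]
      _ ≤ 2 * net.deltaMax / η * V * (A * L ^ 3 / κ) :=
          mul_le_mul_of_nonneg_right hW (by positivity)
      _ = _ := by ring
  have hrare := exp_neg_offset_le (κ := κ) (δ := net.deltaMax) hVpos hL hV.log_exp
  set ε₁ := Real.exp (-(κ * (2 * L ^ 2 - net.deltaMax)))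
  set E := Real.exp (κ * net.deltaMax) with hE
  have hEpos : 0 < E := Real.exp_pos _
  have hidle : (∑ j, placeholder γs (2 * L ^ 2) j) * net.deltaMax *
      (n₀ + n * (ε₁ * (1 + net.lyapBound ρ))) ≤
      2 * net.deltaMax / η * net.deltaMax * ((4 * κ * r + A) / α + 1) * (V * L ^ 3) +
        n * (2 * net.deltaMax ^ 2 / η * (E * (1 + net.lyapBound ρ))) := by
    have h1 : n₀ + n * (ε₁ * (1 + net.lyapBound ρ)) ≤
        ((4 * κ * r + A) / α + 1) * L ^ 3 + n * (E / V * (1 + net.lyapBound ρ)) :=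
      add_le_add hn₀le (mul_le_mul_of_nonneg_left (mul_le_mul_of_nonneg_right hrare
        (by linarith)) (Nat.cast_nonneg n))
    calc _ ≤ 2 * net.deltaMax / η * V * net.deltaMax *
          (((4 * κ * r + A) / α + 1) * L ^ 3 + n * (E / V * (1 + net.lyapBound ρ))) := by
          refine mul_le_mul (mul_le_mul_of_nonneg_right hW hδ.le) h1 ?_ (by positivity)
          have : 0 < ε₁ := Real.exp_pos _
          positivity
      _ = _ := by field_simp
  -- No drift is available here; each slot loses at most `2 V deltaMax` against the dual, and `w =
  -- O(log(V)³)`.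
  have hlast : V * ∑ t ∈ Ico (τ k + n) (τ (k + 1)), net.meanCost P S x t ≤
      w * net.dual V γs (p k) + 2 * net.deltaMax * (1 / epsd ^ 2 + 1) * (V * L ^ 3) := by
    have h1 : ∑ t ∈ Ico (τ k + n) (τ (k + 1)), net.meanCost P S x t ≤ w * net.deltaMax := by
      refine (sum_le_sum fun t _ => (abs_le.1 (hadm.abs_meanCost_le t)).2).trans ?_
      rw [sum_const, Nat.card_Ico, hn, Nat.add_sub_cancel_left, nsmul_eq_mul]
    have h2 := (abs_le.1 (hopt.abs_dual_le hVpos.le (hs.mem k) hε'.le hη hslack)).1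
    have h3 := mul_le_mul_of_nonneg_left h2 (Nat.cast_nonneg (α := ℝ) w)
    have h4 := mul_le_mul_of_nonneg_left h1 hVpos.le
    have h5 : (w : ℝ) ≤ (1 / epsd ^ 2 + 1) * L ^ 3 := by
      have h6 : (w : ℝ) + 1 ≤ ((plcParams V c epsd w e).d : ℝ) := by exact_mod_cast hw
      have := hV.d_le (c := c) (w := w) (e := e)
      linarith
    have h6 := mul_le_mul_of_nonneg_left h5 (show 0 ≤ 2 * V * net.deltaMax by positivity)
    linarith
  have hsplit : ∑ t ∈ Ico (τ k) (τ (k + 1)), net.meanCost P S x t =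
      ∑ t ∈ Ico (τ k) (τ k + n), net.meanCost P S x t +
        ∑ t ∈ Ico (τ k + n) (τ (k + 1)), net.meanCost P S x t :=
    (sum_Ico_consecutive _ (by omega) (by omega)).symm
  have hdk : (τ (k + 1) : ℝ) - τ k = n + w := by rw [hn]; push_cast; ring
  have hVL3 : V * L ^ 3 ≤ V * L ^ 6 := mul_le_mul_of_nonneg_left hL36 hVpos.le
  -- The sixth power of the logarithm comes from the second moment of a backlog of order `log(V)³`.
  have hsq : net.sqLyap P S x (τ k) / 2 ≤ (A ^ 2 + 2) / κ ^ 2 * (V * L ^ 6) := by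
    have h1 : (2 * (A * L ^ 3) ^ 2 + 4) / κ ^ 2 / 2 = (A ^ 2 * L ^ 6 + 2) / κ ^ 2 := by
      field_simp; ring
    have h2 : 1 ≤ V * L ^ 6 := one_le_mul_of_one_le_of_one_le hV1 (one_le_pow₀ hL)
    have h3 : L ^ 6 ≤ V * L ^ 6 := le_mul_of_one_le_left (by positivity) hV1
    have h4 : A ^ 2 * L ^ 6 + 2 ≤ (A ^ 2 + 2) * (V * L ^ 6) := by
      have := mul_le_mul_of_nonneg_left h3 (sq_nonneg A)
      linarith
    have h5 := div_le_div_of_nonneg_right h4 (sq_nonneg κ)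
    rw [div_mul_eq_mul_div]
    linarith
  rw [hsplit, mul_add, hdk]
  have hcost : net.costConst ρ η = net.stepBound ^ 2 / 2 + 2 * net.deltaMax ^ 2 / η *
      (1 + E * (1 + net.lyapBound ρ)) := rfl
  have hcc : (n : ℝ) * (2 * net.deltaMax ^ 2 / η * (E * (1 + net.lyapBound ρ))) +
      n * (net.stepBound ^ 2 / 2) ≤ (n + w) * net.costConst ρ η := by
    have h1 := (net.costConst_pos hρ hη).le
    have h2 : 0 ≤ (w : ℝ) * net.costConst ρ η := by positivity
    have h3 : 0 ≤ (n : ℝ) * (2 * net.deltaMax ^ 2 / η) := by positivity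
    rw [hcost] at h2 ⊢
    linarith
  have ht : net.transientConst ρ η epsd * (V * L ^ 6) = (A ^ 2 + 2) / κ ^ 2 * (V * L ^ 6) +
      2 * net.deltaMax / η * (A / κ) * (V * L ^ 6) +
      2 * net.deltaMax / η * net.deltaMax * ((4 * κ * r + A) / α + 1) * (V * L ^ 6) +
      2 * net.deltaMax * (1 / epsd ^ 2 + 1) * (V * L ^ 6) := by
    rw [transientConst]; ring
  have hc1 : 0 ≤ 2 * net.deltaMax / η * (A / κ) := by positivity
  have hc2 : 0 ≤ 2 * net.deltaMax / η * net.deltaMax * ((4 * κ * r + A) / α + 1) := by positivity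
  have hc3 : 0 ≤ 2 * net.deltaMax * (1 / epsd ^ 2 + 1) := by positivity
  have h1 := mul_le_mul_of_nonneg_left hVL3 hc1
  have h2 := mul_le_mul_of_nonneg_left hVL3 hc2
  have h3 := mul_le_mul_of_nonneg_left hVL3 hc3
  rw [ht]
  linarith

/-- Utility in a long interval. -/
lemma abs_average_sub_le (hs : net.IsPiecewiseStationary (plcParams V c epsd w e) ρ η p τ dist)
    (h : net.IsPLC (plcParams V c epsd w e) dist P ℱ S pred x γ q)
    (he : avgError w e = 0) (hρ : 0 < ρ) (hη : 0 < η) (hV : net.IsLarge ρ epsd ε V)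
    (hw : w + 1 ≤ (plcParams V c epsd w e).d) {k : ℕ}
    (hk : V ^ (1 + ε) ≤ (τ (k + 1) : ℝ) - τ k) :
    |(∑ t ∈ Ico (τ k) (τ (k + 1)), net.meanCost P S x t) / ((τ (k + 1) : ℝ) - τ k) -
      net.optimalCost (p k)| ≤ (net.costConst ρ η + net.transientConst ρ η epsd) / V := by
  have hadm := h.admissible
  have hκ := net.lyapExp_pos hρ
  have hδ := net.deltaMax_pos
  have hA := net.momentConst_nonneg (epsd := epsd) hρ
  have hL := hV.one_le_log
  have hVpos : 0 < V := by linarith [hV.one_le]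
  have hcc := net.costConst_pos hρ hη
  obtain ⟨n, hn, hlen⟩ := hs.exists_length hL hw k
  obtain ⟨γs, hγs⟩ := (hs.polyhedral k).exists_multiplier
  change net.IsPolyhedralMultiplier V ρ (p k) γs at hγs
  obtain ⟨ε', hε', hslack⟩ := hs.slack k
  have hopt := hγs.isDualOptimal hρ
  rw [hopt.optimalCost_eq hVpos (hs.mem k) hε'.le hη hslack]
  have hup := hs.sum_meanCost_le h he hρ hη hV hw hγs
  -- Weak duality uses only the law of the state, so it covers the unguided slots as well.
  have hlow := hadm.dual_le_sum V hγs.1 (hs.mem k) (t₀ := τ k) (n := n + w)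
    fun t h1 h2 => hs.dist_eq k t h1 (by omega)
  rw [← add_assoc, ← hn] at hlow
  have hdk : (τ (k + 1) : ℝ) - τ k = ((n + w : ℕ) : ℝ) := by rw [hn]; push_cast; ring
  rw [hdk] at hup hk ⊢
  set N : ℝ := ((n + w : ℕ) : ℝ)
  have hgrow : V * Real.log V ^ 6 ≤ N := by
    refine le_trans ?_ hk
    rw [Real.rpow_add hVpos, Real.rpow_one]
    exact mul_le_mul_of_nonneg_left hV.growth hVpos.le
  have hNpos : 0 < N := lt_of_lt_of_le (by positivity) hgrow
  -- Only the backlog at the right end matters: `O(log(V)³)` weighted by multipliers of total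
  -- `O(V)`.
  have hq : ∑ j, γs j * (∫ ω, net.queue S x (τ (k + 1)) ω j ∂P -
      ∫ ω, net.queue S x (τ k) ω j ∂P) ≤ net.transientConst ρ η epsd * (V * Real.log V ^ 6) := by
    have hm1 := (hadm.moments_of_expMoment_le hρ (by positivity)
      (hs.expMoment_le h he hρ hV hw (k + 1))).1
    have h36 : Real.log V ^ 3 ≤ Real.log V ^ 6 := pow_le_pow_right₀ hL (by norm_num)
    calc _ ≤ ∑ j, γs j * (net.momentConst ρ epsd * Real.log V ^ 3 / net.lyapExp ρ) := by
          refine sum_le_sum fun j _ => mul_le_mul_of_nonneg_left ?_ (hγs.1 j)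
          have h1 := (hadm.integral_queue_le_integral_euclNorm (τ (k + 1)) j).trans hm1
          have h2 : 0 ≤ ∫ ω, net.queue S x (τ k) ω j ∂P :=
            integral_nonneg fun ω => queue_nonneg S x _ ω j
          linarith
      _ = (∑ j, γs j) * (net.momentConst ρ epsd * Real.log V ^ 3 / net.lyapExp ρ) := by
          rw [Finset.sum_mul]
      _ ≤ 2 * net.deltaMax / η * V *
          (net.momentConst ρ epsd * Real.log V ^ 6 / net.lyapExp ρ) :=
          mul_le_mul (hopt.sum_le hVpos.le (hs.mem k) hε'.le hη hslack) (by gcongr)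
            (by positivity) (by positivity)
      _ = 2 * net.deltaMax / η * (net.momentConst ρ epsd / net.lyapExp ρ) *
          (V * Real.log V ^ 6) := by ring
      _ ≤ _ := by
          refine mul_le_mul_of_nonneg_right ?_ (by positivity)
          have h1 : 0 ≤ (net.momentConst ρ epsd ^ 2 + 2) / net.lyapExp ρ ^ 2 := by positivity
          have h2 : 0 ≤ 2 * net.deltaMax / η * net.deltaMax * ((4 * net.lyapExp ρ * r +
            net.momentConst ρ epsd) / (net.lyapExp ρ * ρ / 4) + 1) := by positivity
          have h3 : 0 ≤ 2 * net.deltaMax * (1 / epsd ^ 2 + 1) := by positivity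
          unfold transientConst
          linarith
  have htc : 0 ≤ net.transientConst ρ η epsd := by unfold transientConst; positivity
  have htN : net.transientConst ρ η epsd * (V * Real.log V ^ 6) ≤
      net.transientConst ρ η epsd * N := mul_le_mul_of_nonneg_left hgrow htc
  set F := ∑ t ∈ Ico (τ k) (τ (k + 1)), net.meanCost P S x t
  have hid : F / N - net.dual V γs (p k) / V = (V * F - N * net.dual V γs (p k)) / (N * V) := by
    field_simp
  rw [hid, abs_div, abs_of_pos (mul_pos hNpos hVpos), div_le_div_iff₀ (mul_pos hNpos hVpos) hVpos,
    ← mul_assoc]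
  refine mul_le_mul_of_nonneg_right ?_ hVpos.le
  have := mul_pos hcc hNpos
  rw [abs_le]; constructor <;> linarith

end IsPiecewiseStationary

end Network

end

theorem theorem3 {M r : ℕ} {X : Type*} [TopologicalSpace X] (net : Network M r X)
    (ρ η₀ : ℝ) (hρ : 0 < ρ) (hη₀ : 0 < η₀) :
    -- (a) stationary system
    (∃ C V₀ : ℝ, ∀ V c epsd : ℝ, V₀ ≤ V → 0 < c → c < 1 → 0 < epsd →
      ∀ (w : ℕ) (e : ℕ → ℝ), avgError w e = 0 → w + 1 ≤ (plcParams V c epsd w e).d →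
      ∀ p ∈ stdSimplex ℝ (Fin M), (∃ ε > 0, net.HasSlack p ε η₀) →
        net.HasUniqueMultiplier V p → net.IsPolyhedral V p ρ →
      ∀ (Ω : Type*) [mΩ : MeasurableSpace Ω] (P : Measure Ω) (ℱ : Filtration ℕ mΩ)
        (S : ℕ → Ω → Fin M) (pred : Ω → ℕ → ℕ → Fin M → ℝ) (x : ℕ → Ω → X)
        (γ q : ℕ → Ω → Fin r → ℝ),
        net.IsPLC (plcParams V c epsd w e) (fun _ => p) P ℱ S pred x γ q →
        -- utility
        |net.avgCost P S x - net.optimalCost p| ≤ C / V ∧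
        -- delay
        (∀ (J : Finset (Fin r)) (lam : ℝ), 0 < lam →
          (∀ᶠ T : ℕ in atTop, lam * T ≤ net.trafficUpTo P S x J T) →
          ∃ K : ℕ, ∀ᶠ T : ℕ in atTop,
            net.trafficUpTo P S x J T -
                net.servedWithin (plcParams V c epsd w e) P S pred x J K T ≤
              C / (lam * V) * net.trafficUpTo P S x J T ∧
            net.delayWithin (plcParams V c epsd w e) P S pred x J K T ≤
              C / lam * Real.log V ^ 2 *
                net.servedWithin (plcParams V c epsd w e) P S pred x J K T) ∧
        -- backlog
        (∀ᶠ T : ℕ in atTop,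
          (∑ t ∈ range T, ∑ j, ∫ ω, q t ω j ∂P) / T ≤ C * Real.log V ^ 2)) ∧
    -- (b) piecewise stationary system
    (∀ epsd ε : ℝ, 0 < epsd → 0 < ε → ∃ C V₀ : ℝ, ∀ V c : ℝ, V₀ ≤ V → 0 < c → c < 1 →
      ∀ (w : ℕ) (e : ℕ → ℝ), avgError w e = 0 → w + 1 ≤ (plcParams V c epsd w e).d →
      ∀ (p : ℕ → Fin M → ℝ) (τ : ℕ → ℕ) (dist : ℕ → Fin M → ℝ),
        τ 0 = 0 →
        (∀ k, ((plcParams V c epsd w e).d : ℝ) * Real.log V ^ 2 ≤ (τ (k + 1) : ℝ) - τ k) →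
        (∀ k t, τ k ≤ t → t < τ (k + 1) → dist t = p k) →
        (∀ k, p k ∈ stdSimplex ℝ (Fin M)) →
        (∀ k, ∃ ε' > 0, net.HasSlack (p k) ε' η₀) →
        (∀ k, net.HasUniqueMultiplier V (p k)) → (∀ k, net.IsPolyhedral V (p k) ρ) →
      ∀ (Ω : Type*) [mΩ : MeasurableSpace Ω] (P : Measure Ω) (ℱ : Filtration ℕ mΩ)
        (S : ℕ → Ω → Fin M) (pred : Ω → ℕ → ℕ → Fin M → ℝ) (x : ℕ → Ω → X)
        (γ q : ℕ → Ω → Fin r → ℝ),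
        net.IsPLC (plcParams V c epsd w e) dist P ℱ S pred x γ q →
        -- utility in every long interval
        (∀ k, V ^ (1 + ε) ≤ (τ (k + 1) : ℝ) - τ k →
          |(∑ t ∈ Ico (τ k) (τ (k + 1)), net.meanCost P S x t) / ((τ (k + 1) : ℝ) - τ k) -
            net.optimalCost (p k)| ≤ C / V) ∧
        -- backlog at every change point
        (∀ k, ∑ j, ∫ ω, q (τ k) ω j ∂P ≤ C * Real.log V ^ 4)) := by
  constructor
  · have hκ := net.lyapExp_pos hρ
    have hB := net.backlogConst_nonneg hρ
    have hcc := net.costConst_pos hρ hη₀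
    -- The threshold makes both `log V` and `2 κ log V` at least one; the factor 4 is what the delay
    -- bound asks of `C`.
    refine ⟨net.costConst ρ η₀ + 4 * net.backlogConst ρ,
      Real.exp (max 1 (1 / (2 * net.lyapExp ρ))), ?_⟩
    intro V c epsd hV _ _ _ w e he _ p hp hslack _ hpoly Ω _ P ℱ S pred x γ q h
    have hVpos : 0 < V := (Real.exp_pos _).trans_le hV
    have hlog := (Real.le_log_iff_exp_le hVpos).2 hV
    have hL : 1 ≤ Real.log V := (le_max_left _ _).trans hlog
    have hκL : 1 ≤ 2 * net.lyapExp ρ * Real.log V := by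
      have := (le_max_right _ _).trans hlog
      rwa [div_le_iff₀ (by positivity), mul_comm] at this
    obtain ⟨ε, hε, hs⟩ := hslack
    obtain ⟨γs, hγs⟩ := hpoly.exists_multiplier
    refine ⟨(h.abs_avgCost_sub_le he hρ hp hγs hε.le hη₀ hs hVpos hL hκL).trans
      (div_le_div_of_nonneg_right (by linarith) hVpos.le), fun J lam hlam hT =>
      h.exists_delay_bound he hρ hp hγs hVpos hL (by linarith) (by linarith) J hlam hT, ?_⟩
    filter_upwards [h.eventually_sum_queue_le he hρ hp hγs hL, eventually_gt_atTop 0] with T hT hT0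
    have hTpos : (0 : ℝ) < T := by exact_mod_cast hT0
    simp only [h.backlog_eq he]
    rw [div_le_iff₀ hTpos]
    refine hT.trans ?_
    gcongr
    linarith
  · intro epsd ε hepsd hε
    obtain ⟨V₀, hV₀⟩ := eventually_atTop.1 (net.eventually_isLarge hρ hepsd hε)
    set A := net.costConst ρ η₀ + net.transientConst ρ η₀ epsd
    set B := r * (net.momentConst ρ epsd / net.lyapExp ρ)
    refine ⟨max A B, V₀, ?_⟩
    intro V c hV _ _ w e he hw p τ dist hτ hlen hdist hp hslack _ hpoly Ω _ P ℱ S pred x γ q h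
    have hlarge := hV₀ V hV
    have hs : net.IsPiecewiseStationary (plcParams V c epsd w e) ρ η₀ p τ dist :=
      ⟨hτ, hlen, hdist, hp, hslack, hpoly⟩
    constructor
    · intro k hk
      exact (hs.abs_average_sub_le h he hρ hη₀ hlarge hw hk).trans
        (div_le_div_of_nonneg_right (le_max_left _ _) (by linarith [hlarge.one_le]))
    · intro k
      simp only [h.backlog_eq he]
      exact (hs.sum_queue_le h he hρ hlarge hw k).trans
        (mul_le_mul_of_nonneg_right (le_max_right _ _)
          (pow_nonneg (by linarith [hlarge.one_le_log]) 4))
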